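/- **Conventions.** An octahedron has vertices $\mathbf a_1,\mathbf a_2,\mathbf a_3,\mathbf b_1,\mathbf b_2,\mathbf b_3$ in the unit sphere $\mathbb S^3\subset\mathbb R^4$; its 12 edges are all pairs of vertices except $\{\mathbf a_i,\mathbf b_i\}$, its 8 faces are the triples of vertices with distinct indices, and the surface is oriented so that $\mathbf a_1\mathbf a_2\mathbf a_3$ is positive. Fix edge lengths $\boldsymbol\ell=(\ell_{\mathbf u\mathbf v})$. If $\mathbf u\mathbf v\mathbf w_1,\mathbf u\mathbf v\mathbf w_2$ are the faces at an edge $\mathbf u\mathbf v$, let $\mathbf m_1$ be the exterior unit normal to $\mathbf u\mathbf v\mathbf w_1$ and $\mathbf n_i$ the unit vector orthogonal to $\mathbf u\mathbf v$, tangent to $\mathbf u\mathbf v\mathbf w_i$ and pointing inside it; the oriented dihedral angle $\varphi_{\mathbf u\mathbf v}\in\mathbb R/2\pi\mathbb Z$ is the angle of the rotation from $\mathbf n_1$ to $\mathbf n_2$ in the direction in which $\mathbf n_1$ is obtained from $\mathbf m_1$ by a rotation through $\pi/2$. Put $t_{\mathbf u\mathbf v}=\tan(\varphi_{\mathbf u\mathbf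 v}/2)\in\mathbb R\cup\{\infty\}=\mathbb{RP}^1$. For a vertex $\mathbf u$ let $\mathbf v_1,\mathbf v_2,\mathbf v_3,\mathbf v_4$ be its neighbours in cyclic order, and let $\alpha=\angle\mathbf v_1\mathbf u\mathbf v_2$, $\beta=\angle\mathbf v_2\mathbf u\mathbf v_3$, $\gamma=\angle\mathbf v_3\mathbf u\mathbf v_4$, $\delta=\angle\mathbf v_4\mathbf u\mathbf v_1$ be the angles of the faces at $\mathbf u$, which are determined by $\boldsymbol\ell$. The *configuration space* $\Sigma(\boldsymbol\ell)\subset(\mathbb{RP}^1)^{12}$ is the real algebraic variety given by the 24 equations (one for each pair of edges $\mathbf u\mathbf v_1,\mathbf u\mathbf v_2$ in a common face) $$At_1^2t_2^2+Bt_1^2+2Ct_1t_2+Dt_2^2+E=0,\qquad t_i=t_{\mathbf u\mathbf v_i},$$ made homogeneous in each $t_i=(X_i:Y_i)$, where $A=\cos\gamma-\cos(\alpha+\beta+\delta)$, $B=\cos\gamma-\cos(\alpha-\beta+\delta)$, $C=-2\sin\beta\sin\delta$, $D=\cos\gamma-\cos(\alpha+\beta-\delta)$, $E=\cos\gamma-\cos(\alpha-\beta-\delta)$.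 A one-dimensional irreducible component $\Gamma$ of $\Sigma(\boldsymbol\ell)$ (in the Zariski topology of the set of real points) is *essential* if it corresponds to an essential flexion of an octahedron, that is, if every point of $\Gamma$ is the family $(t_{\mathbf u\mathbf v})$ of an octahedron with edge lengths $\boldsymbol\ell$, and no variable $t_{\mathbf u\mathbf v}$ is identically $0$ or identically $\infty$ on $\Gamma$. **Proposition.** Suppose that $0<\ell_{\mathbf u\mathbf v}<\pi$ for all edges, $$\ell_{\mathbf a_1\mathbf a_2}=\ell_{\mathbf a_1\mathbf b_2}=\ell_{\mathbf b_1\mathbf a_2}=\ell_{\mathbf b_1\mathbf b_2}=\tfrac{\pi}{2},\quad \ell_{\mathbf a_1\mathbf a_3}=\ell_{\mathbf a_1\mathbf b_3},\quad \ell_{\mathbf b_1\mathbf a_3}=\ell_{\mathbf b_1\mathbf b_3},\quad \ell_{\mathbf a_2\mathbf a_3}+\ell_{\mathbf a_2\mathbf b_3}=\ell_{\mathbf b_2\mathbf a_3}+\ell_{\mathbf b_2\mathbf b_3}=\pi,$$ and that $p_1=\cos\ell_{\mathbf a_1\mathbf a_3}$, $p_2=\cos\ell_{\mathbf b_1\mathbf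 a_3}$, $q_1=\cos\ell_{\mathbf a_2\mathbf a_3}$, $q_2=\cos\ell_{\mathbf b_2\mathbf a_3}$ satisfy $|p_1|<|p_2|$, $|q_1|<|q_2|$ and $p_2^2+q_2^2<1$. Put $\theta_{\min}=\arcsin|q_2|$, $\theta_{\max}=\arccos|p_2|$, and for $\theta\in[\theta_{\min},\theta_{\max}]$ and signs $\delta_1,\delta_2,\varepsilon_1,\varepsilon_2\in\{1,-1\}$ consider the octahedron $$\begin{aligned} \mathbf a_1&=\Bigl(\tfrac{p_1}{\cos\theta},\delta_1\sqrt{1-\tfrac{p_1^2}{\cos^2\theta}},0,0\Bigr),&\mathbf b_1&=\Bigl(\tfrac{p_2}{\cos\theta},\delta_2\sqrt{1-\tfrac{p_2^2}{\cos^2\theta}},0,0\Bigr),\\ \mathbf a_2&=\Bigl(0,0,\tfrac{q_1}{\sin\theta},\varepsilon_1\sqrt{1-\tfrac{q_1^2}{\sin^2\theta}}\Bigr),&\mathbf b_2&=\Bigl(0,0,\tfrac{q_2}{\sin\theta},\varepsilon_2\sqrt{1-\tfrac{q_2^2}{\sin^2\theta}}\Bigr),\\ \mathbf a_3&=(\cos\theta,0,\sin\theta,0),&\mathbf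 b_3&=(\cos\theta,0,-\sin\theta,0). \end{aligned}\tag{$*$}$$ Then: 1. $\Sigma(\boldsymbol\ell)$ has a unique essential one-dimensional irreducible component $\Gamma$, and all (real) points of $\Gamma$ are smooth. 2. $\Gamma$ has exactly two connected components $\Gamma_+$ and $\Gamma_-$ (in the usual topology), where $\Gamma_{\pm}$ is the set of the families $(t_{\mathbf u\mathbf v})$ of the octahedra $(*)$ with $\delta_1\varepsilon_1=\pm1$. 3. The parameter $\theta$ is a well-defined function on $\Gamma$; it maps each of $\Gamma_+$, $\Gamma_-$ onto $[\theta_{\min},\theta_{\max}]$, and every $\theta\in(\theta_{\min},\theta_{\max})$ has exactly $4$ preimages in each of them. 4. For any signs $\delta_1,\varepsilon_1$, each point of the component $\Gamma_{\delta_1\varepsilon_1}$ corresponds to an octahedron, unique up to rotation of $\mathbb S^3$, and this octahedron can be given by $(*)$ with these $\delta_1,\varepsilon_1$. The component is homeomorphic to a circle composed of four consecutive arcs on which $(\delta_2,\varepsilon_2)$ equals $(1,1),(-1,1),(-1,-1),(1,-1)$ and $\theta$ runs monotonically from $\theta_{\min}$ to $\theta_{\max}$, back to $\theta_{\min}$,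 to $\theta_{\max}$ and back to $\theta_{\min}$; that is, $\delta_1$ and $\varepsilon_1$ remain unchanged, $\delta_2$ changes when $\theta=\theta_{\max}$ and $\varepsilon_2$ changes when $\theta=\theta_{\min}$. With this choice of positions, all coordinates of the vertices are real analytic functions on $\Gamma_{\delta_1\varepsilon_1}$. -/

import Mathlib

namespace ExoticOctahedron

/-! ### Combinatorics of the octahedron -/

/-- Vertices of the octahedron: `(i, false)` is the vertex `a` and `(i, true)` is the vertex `b`
with index `i + 1`, where `i = 0, 1, 2`. -/
abbrev Vertex : Type := Fin 3 × Bool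

/-- The vertices `a₁, a₂, a₃`, indexed by `0, 1, 2`. -/
abbrev a (i : Fin 3) : Vertex := (i, false)

/-- The vertices `b₁, b₂, b₃`, indexed by `0, 1, 2`. -/
abbrev b (i : Fin 3) : Vertex := (i, true)

/-- The combinatorially opposite vertex. -/
def opp (u : Vertex) : Vertex := (u.1, !u.2)

/-- The 12 edges: unordered pairs of vertices other than the pairs `{aᵢ, bᵢ}` (and `{u, u}`). -/
abbrev Edge : Type := {e : Sym2 Vertex // ¬ (e.map Prod.fst).IsDiag}

/-- The edge joining `u` and `v`. -/
def edge (u v : Vertex) (h : u.1 ≠ v.1 := by decide) : Edge := ⟨s(u, v), by simpa using h⟩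

/-- The sign of the ordered face `u v w` with respect to the orientation of the octahedral surface
in which the face `a₁ a₂ a₃` is positive. -/
def orient (u v w : Vertex) : ℝ :=
  (if v.1 = u.1 + 1 then 1 else -1) *
    ((if u.2 then -1 else 1) * (if v.2 then -1 else 1) * (if w.2 then -1 else 1))

/-! ### Octahedra in the unit sphere of Euclidean 4-space and their oriented dihedral angles -/

/-- Euclidean 4-space. -/
abbrev E4 : Type := EuclideanSpace ℝ (Fin 4)

/-- The determinant of four vectors. -/
def det4 (x y z w : E4) : ℝ := Matrix.det (fun i j : Fin 4 => (![x, y, z, w] i) j)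

/-- `P` is an octahedron in the unit sphere with edge lengths `ℓ`
(the spherical distance of two unit vectors is the angle between them). -/
def HasEdgeLengths (ℓ : Edge → ℝ) (P : Vertex → E4) : Prop :=
  (∀ u, ‖P u‖ = 1) ∧
    ∀ (u v : Vertex) (h : u.1 ≠ v.1), InnerProductGeometry.angle (P u) (P v) = ℓ (edge u v h)

/-- `n` is the unit vector tangent to the face `x y z`, orthogonal to its edge `x y`
and pointing inside the face. -/
def IsInnerNormal (x y z n : E4) : Prop :=
  ‖n‖ = 1 ∧ inner ℝ n x = 0 ∧ inner ℝ n y = 0 ∧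
    ∃ r s c : ℝ, 0 < c ∧ z = r • x + s • y + c • n

/-- `m` is the exterior unit normal to the face `u v w` of `P`: at the point `P u` the vector `m`
followed by a positive basis of the face is a positive basis of the tangent space of the sphere
(a basis of the tangent space at `x` is positive if `x` followed by it is a positive basis
of Euclidean 4-space). -/
def IsExteriorNormal (P : Vertex → E4) (u v w : Vertex) (m : E4) : Prop :=
  ‖m‖ = 1 ∧ inner ℝ m (P u) = 0 ∧ inner ℝ m (P v) = 0 ∧ inner ℝ m (P w) = 0 ∧
    0 < orient u v w * det4 (P u) m (P v) (P w)

/-- `φ` is (a representative modulo `2π` of) the oriented dihedral angle of `P` at the edge `u v`: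
with `m₁` the exterior normal to the face `u v w`, and `n₁`, `n₂` the inner normals to the edge in
the two faces `u v w`, `u v (opp w)`, it is the angle of the rotation from `n₁` to `n₂` in the
direction in which `n₁` is obtained from `m₁` by the rotation through `π / 2`. -/
def IsDihedralAngle (P : Vertex → E4) (u v w : Vertex) (φ : ℝ) : Prop :=
  ∃ m₁ n₁ n₂ : E4, IsExteriorNormal P u v w m₁ ∧
    IsInnerNormal (P u) (P v) (P w) n₁ ∧ IsInnerNormal (P u) (P v) (P (opp w)) n₂ ∧
    n₂ = Real.cos φ • n₁ - Real.sin φ • m₁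

/-- `tan (φ / 2)` as a point of the projective line `ℝ ∪ {∞}`. -/
noncomputable def halfTan (φ : ℝ) : OnePoint ℝ :=
  open Classical in
  if Real.cos (φ / 2) = 0 then OnePoint.infty else ((Real.tan (φ / 2) : ℝ) : OnePoint ℝ)

/-! ### The configuration space -/

/-- The ambient space: the product of 12 real projective lines, with affine coordinates `t_{uv}`.
As `OnePoint ℝ` is a circle, the product topology is the usual topology. -/
abbrev Conf : Type := Edge → OnePoint ℝ

/-- `t` is the family of tangents of the halves of the oriented dihedral angles of `P`, and `P` is
an octahedron with edge lengths `ℓ`. -/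
def IsConfigOf (ℓ : Edge → ℝ) (P : Vertex → E4) (t : Conf) : Prop :=
  HasEdgeLengths ℓ P ∧
    ∀ (u v w : Vertex) (huv : u.1 ≠ v.1), u.1 ≠ w.1 → v.1 ≠ w.1 →
      ∃ φ : ℝ, IsDihedralAngle P u v w φ ∧ t (edge u v huv) = halfTan φ

/-- Homogeneous coordinates `(X : Y)` of a point of `ℝ ∪ {∞}`:
`(t : 1)` for real `t`, and `(1 : 0)` for `∞`. -/
noncomputable def homog (t : OnePoint ℝ) : Fin 2 → ℝ :=
  t.elim ![1, 0] (fun r : ℝ => ![r, 1])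

/-- The angle at the vertex `u` of the face `u v w`, by the spherical law of cosines. -/
noncomputable def faceAngle (ℓ : Edge → ℝ) (u v w : Vertex)
    (huv : u.1 ≠ v.1) (huw : u.1 ≠ w.1) (hvw : v.1 ≠ w.1) : ℝ :=
  Real.arccos
    ((Real.cos (ℓ (edge v w hvw)) - Real.cos (ℓ (edge u v huv)) * Real.cos (ℓ (edge u w huw))) /
      (Real.sin (ℓ (edge u v huv)) * Real.sin (ℓ (edge u w huw))))

/-- The biquadratic form relating the tangents `(X₁ : Y₁)`, `(X₂ : Y₂)` of the half angles of a
spherical quadrilateral with consecutive sides `α, β, γ, δ` at the two end points of `α`, the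
first one between `δ` and `α`, the second one between `α` and `β`. -/
noncomputable def bricard (α β γ δ X₁ Y₁ X₂ Y₂ : ℝ) : ℝ :=
  (Real.cos γ - Real.cos (α + β + δ)) * X₁ ^ 2 * X₂ ^ 2 +
  (Real.cos γ - Real.cos (α - β + δ)) * X₁ ^ 2 * Y₂ ^ 2 +
  2 * (-2 * Real.sin β * Real.sin δ) * X₁ * Y₁ * X₂ * Y₂ +
  (Real.cos γ - Real.cos (α + β - δ)) * Y₁ ^ 2 * X₂ ^ 2 +
  (Real.cos γ - Real.cos (α - β - δ)) * Y₁ ^ 2 * Y₂ ^ 2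

/-- The configuration space: the real algebraic variety given by the 24 biquadratic equations
indexed by the pairs of edges `u v`, `u w` in a common face. The link of `u` is the quadrilateral
`v, w, opp v, opp w`. (Exchanging `v` and `w` gives the same equation.) -/
def configSpace (ℓ : Edge → ℝ) : Set Conf :=
  {t | ∀ (u v w : Vertex) (huv : u.1 ≠ v.1) (huw : u.1 ≠ w.1) (hvw : v.1 ≠ w.1),
    bricard (faceAngle ℓ u v w huv huw hvw) (faceAngle ℓ u w (opp v) huw huv hvw.symm)
      (faceAngle ℓ u (opp v) (opp w) huv huw hvw) (faceAngle ℓ u (opp w) v huw huv hvw.symm)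
      (homog (t (edge u v huv)) 0) (homog (t (edge u v huv)) 1)
      (homog (t (edge u w huw)) 0) (homog (t (edge u w huw)) 1) = 0}

/-! ### Algebraic geometry in the product of projective lines -/

/-- Polynomials in the 12 pairs of homogeneous coordinates. -/
abbrev Poly : Type := MvPolynomial (Edge × Fin 2) ℝ

/-- `f` is homogeneous, of degree `d e`, in each pair `(X_e, Y_e)` of variables. -/
def IsMultihomogeneous (f : Poly) (d : Edge → ℕ) : Prop :=
  MvPolynomial.IsWeightedHomogeneous (fun i : Edge × Fin 2 => (Pi.single i.1 1 : Edge → ℕ)) f d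

/-- All homogeneous coordinates of a point. -/
noncomputable def coords (t : Conf) : Edge × Fin 2 → ℝ := fun i => homog (t i.1) i.2

/-- The Zariski topology on the product of projective lines: a base is given by the sets where a
multihomogeneous polynomial does not vanish. -/
@[reducible] def zariski : TopologicalSpace Conf :=
  TopologicalSpace.generateFrom
    {U | ∃ (f : Poly) (d : Edge → ℕ), IsMultihomogeneous f d ∧
      U = {t | MvPolynomial.eval (coords t) f ≠ 0}}

/-- `Γ` is an irreducible component of `S`, in the Zariski topology. -/
def IsIrredComponent (S Γ : Set Conf) : Prop :=
  Maximal (fun s : Set Conf => s ⊆ S ∧ @IsIrreducible Conf zariski s) Γ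

/-- The dimension of `Γ`: its Krull dimension in the Zariski topology. -/
noncomputable def zariskiDim (Γ : Set Conf) : WithBot ℕ∞ :=
  @topologicalKrullDim Γ (zariski.induced Subtype.val)

/-- `Γ` is an essential one-dimensional irreducible component of the configuration space: its
points correspond to octahedra with edge lengths `ℓ`, and none of the variables `t_{uv}` is
identically `0` or identically `∞` on it. -/
def IsEssentialComponent (ℓ : Edge → ℝ) (Γ : Set Conf) : Prop :=
  IsIrredComponent (configSpace ℓ) Γ ∧ zariskiDim Γ = 1 ∧
    (∀ t ∈ Γ, ∃ P : Vertex → E4, IsConfigOf ℓ P t) ∧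
    ∀ e : Edge, (∃ t ∈ Γ, t e ≠ ((0 : ℝ) : OnePoint ℝ)) ∧ (∃ t ∈ Γ, t e ≠ OnePoint.infty)

/-- The Jacobian criterion for a point `γ` of a curve `Γ` to be smooth (nonsingular): the
differentials at `γ` of the multihomogeneous polynomials vanishing on `Γ` span a space of dimension
equal to the codimension of `Γ`. (By Euler's relations, these differentials may be taken in the
homogeneous coordinates.) -/
def IsSmoothPoint (Γ : Set Conf) (γ : Conf) : Prop :=
  Module.finrank ℝ (Submodule.span ℝ
    {v : Edge × Fin 2 → ℝ | ∃ (f : Poly) (d : Edge → ℕ), IsMultihomogeneous f d ∧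
      (∀ t ∈ Γ, MvPolynomial.eval (coords t) f = 0) ∧
      v = fun i => MvPolynomial.eval (coords γ) (MvPolynomial.pderiv i f)}) + 1
    = Fintype.card Edge

/-- The affine coordinate on the projective line near `t₀`: `t` if `t₀` is real, `1 / t` if
`t₀ = ∞`. -/
noncomputable def localCoord (t₀ t : OnePoint ℝ) : ℝ :=
  t₀.elim (t.elim 0 (fun r : ℝ => r⁻¹)) (fun _ : ℝ => t.elim 0 (fun r : ℝ => r))

/-- The real function `g` is real analytic on `Γ`: near each point of `Γ` it is the restriction of
a real analytic function of the affine coordinates. -/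
def IsAnalyticOn (Γ : Set Conf) (g : Conf → ℝ) : Prop :=
  ∀ γ ∈ Γ, ∃ G : (Edge → ℝ) → ℝ, AnalyticAt ℝ G (fun e => localCoord (γ e) (γ e)) ∧
    ∀ᶠ t in nhdsWithin γ Γ, g t = G (fun e => localCoord (γ e) (t e))

/-! ### The explicit flexion -/

/-- The real number `1` or `-1`. -/
def sgn (σ : ℤˣ) : ℝ := ((σ : ℤ) : ℝ)

/-- The octahedron with parameters `p₁, p₂, q₁, q₂, θ` and signs `δ₁, δ₂, ε₁, ε₂`. -/
noncomputable def flex (p₁ p₂ q₁ q₂ θ : ℝ) (δ₁ δ₂ ε₁ ε₂ : ℤˣ) : Vertex → E4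
  | (0, false) => !₂[p₁ / Real.cos θ, sgn δ₁ * √(1 - p₁ ^ 2 / Real.cos θ ^ 2), 0, 0]
  | (0, true) => !₂[p₂ / Real.cos θ, sgn δ₂ * √(1 - p₂ ^ 2 / Real.cos θ ^ 2), 0, 0]
  | (1, false) => !₂[0, 0, q₁ / Real.sin θ, sgn ε₁ * √(1 - q₁ ^ 2 / Real.sin θ ^ 2)]
  | (1, true) => !₂[0, 0, q₂ / Real.sin θ, sgn ε₂ * √(1 - q₂ ^ 2 / Real.sin θ ^ 2)]
  | (2, false) => !₂[Real.cos θ, 0, Real.sin θ, 0]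
  | (2, true) => !₂[Real.cos θ, 0, -Real.sin θ, 0]

/-- The set of configurations of the octahedra `flex` with `δ₁ * ε₁ = σ`
and `θ` in `[arcsin |q₂|, arccos |p₂|]`. -/
def flexComponent (ℓ : Edge → ℝ) (p₁ p₂ q₁ q₂ : ℝ) (σ : ℤˣ) : Set Conf :=
  {t | ∃ θ ∈ Set.Icc (Real.arcsin |q₂|) (Real.arccos |p₂|), ∃ δ₁ δ₂ ε₁ ε₂ : ℤˣ, δ₁ * ε₁ = σ ∧
    IsConfigOf ℓ (flex p₁ p₂ q₁ q₂ θ δ₁ δ₂ ε₁ ε₂) t}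

/-- The sign `δ₂` on the four consecutive arcs of a component: it changes after the arcs
`0` and `2`. -/
def arcDelta : Fin 4 → ℤˣ := ![1, -1, -1, 1]

/-- The sign `ε₂` on the four consecutive arcs of a component: it changes after the arcs
`1` and `3`. -/
def arcEps : Fin 4 → ℤˣ := ![1, 1, -1, -1]

/-- The value of `θ` at the time `s ∈ [0, 1]` of an arc: it goes from `θmin` to `θmax` on the arcs
`0`, `2`, and back on the arcs `1`, `3`. -/
def arcTheta (θmin θmax : ℝ) (k : Fin 4) (s : ℝ) : ℝ :=
  if Even (k : ℕ) then θmin + s * (θmax - θmin) else θmax - s * (θmax - θmin)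

end ExoticOctahedron

namespace ExoticOctahedron

/-! ### The parameters and the curve of half-angle data -/

/-! Write A₁, A₂ for a₁, b₁ and B₁, B₂ for a₂, b₂, and put U = (a₃ + b₃)/2, V = (a₃ − b₃)/2. The
prescribed lengths make U orthogonal to V and to both Bⱼ, make V orthogonal to both Aᵢ, and make
every Aᵢ orthogonal to every Bⱼ. So space splits into two orthogonal planes, one containing A₁, A₂,
U, the other B₁, B₂, V. With |U| = cos θ and |V| = sin θ, an octahedron is described up to rotation
by four numbers Yᵢ = `y (false, i)`, Zⱼ = `y (true, j)` with Yᵢ² + pᵢ² = cos² θ and Zⱼ² + qⱼ² = sin²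
θ (`exists_rotation_oct`). Eliminating θ leaves the equations `OnCurve`; the pair y, −y gives the
same configuration.

The half-angle tangents are quotients of linear forms in y (`octPos_dihedral_AB`,
`octPos_dihedral_AC`, `octPos_dihedral_BC`). This defines `phi`, whose image `curve` is exactly the
set of configurations of octahedra. Three of the tangents already give y back up to sign
(`recov_coords`, `eq_or_neg_of_phi_eq`).

The curve is the required component. It lies in the configuration space because octahedra satisfy
the biquadratic equations of their links (`mem_configSpace`). Those equations force a point to lie
on it as soon as no tangent is 0 or ∞ and t₁₁t₂₂ + t₁₂t₂₁ ≠ 0 (`mem_curve_of_generic`). It is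
Zariski closed (`isClosed_curve`). A multihomogeneous polynomial vanishing at infinitely many of its
points vanishes on it (`eval_eq_zero_of_infinite`): it is a cover of the line of u = Y₁ + Y₂ by two
square roots, and a double norm of the polynomial is forced to be zero by positivity. This gives
irreducibility and dimension one. Any essential component consists of octahedra, hence is contained
in the curve, hence equals it. Smoothness is a count: the tangent space of the cone over the curve
has dimension 13, twelve Euler directions and one more (`finrank_tangentSpace`).

The topology comes from signs. As |p₁| < |p₂| and |q₁| < |q₂|, the numbers Y₁ and Z₁ never vanish,
so the sign of Y₁Z₁ separates the curve into two pieces. On a piece only the signs of Y₂ and Z₂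
change, the first at θmax and the second at θmin, which closes four arcs up to a circle
(`exists_homeomorph`). Once the sign of Y₁ is fixed, y is an analytic function of the tangents
(`isAnalyticOn_oct`). -/

/-- The sign `1` of the vertices `aᵢ` and `-1` of the vertices `bᵢ`. -/
def sg (k : Bool) : ℝ := if k then -1 else 1

@[simp] lemma sg_false : sg false = 1 := rfl
@[simp] lemma sg_true : sg true = -1 := rfl

lemma sg_sq (k : Bool) : sg k ^ 2 = 1 := by cases k <;> simp

lemma sg_ne_zero (k : Bool) : sg k ≠ 0 := by cases k <;> simp

/-- The inequalities satisfied by the parameters `p₁, p₂` and `q₁, q₂`. -/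
structure Params (p q : Bool → ℝ) : Prop where
  hp : p false ^ 2 < p true ^ 2
  hq : q false ^ 2 < q true ^ 2
  hpq : p true ^ 2 + q true ^ 2 < 1

/-- The points `y` with `y (false, i) ^ 2 + p i ^ 2 = x`, `y (true, j) ^ 2 + q j ^ 2 = 1 - x`. -/
def OnCurve (p q : Bool → ℝ) (y : Bool × Bool → ℝ) : Prop :=
  ∀ i j, y (false, i) ^ 2 + y (true, j) ^ 2 = 1 - p i ^ 2 - q j ^ 2

/-- The square root of the Gram determinant of a face. -/
noncomputable def Q (p q : Bool → ℝ) (i j : Bool) : ℝ := √(1 - p i ^ 2 - q j ^ 2)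

/-- The coefficient in the half-angle tangents at the edges `Aᵢ a₃`, `Aᵢ b₃`. -/
noncomputable def lamA (p q : Bool → ℝ) (i η : Bool) : ℝ :=
  sg i * sg η * (Q p q i false * q true - q false * Q p q i true) / √(1 - p i ^ 2)

/-- The coefficient in the half-angle tangents at the edges `Bⱼ a₃`, `Bⱼ b₃`. -/
noncomputable def lamB (p q : Bool → ℝ) (j : Bool) : ℝ :=
  -sg j * (Q p q false j * p true - p false * Q p q true j) / √(1 - q j ^ 2)

namespace Params

variable {p q : Bool → ℝ} (H : Params p q)
include H

lemma p_sq_le (i : Bool) : p i ^ 2 ≤ p true ^ 2 := by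
  cases i
  · exact H.hp.le
  · exact le_rfl

lemma q_sq_le (j : Bool) : q j ^ 2 ≤ q true ^ 2 := by
  cases j
  · exact H.hq.le
  · exact le_rfl

lemma gram_pos (i j : Bool) : 0 < 1 - p i ^ 2 - q j ^ 2 := by
  linarith [H.p_sq_le i, H.q_sq_le j, H.hpq]

lemma Q_pos (i j : Bool) : 0 < Q p q i j := Real.sqrt_pos.2 (H.gram_pos i j)

lemma Q_sq (i j : Bool) : Q p q i j ^ 2 = 1 - p i ^ 2 - q j ^ 2 := Real.sq_sqrt (H.gram_pos i j).le

lemma one_sub_p_pos (i : Bool) : 0 < 1 - p i ^ 2 := by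
  linarith [H.gram_pos i true, sq_nonneg (q true)]

lemma one_sub_q_pos (j : Bool) : 0 < 1 - q j ^ 2 := by
  linarith [H.gram_pos true j, sq_nonneg (p true)]

lemma p_true_sq_pos : 0 < p true ^ 2 := (sq_nonneg _).trans_lt H.hp

lemma q_true_sq_pos : 0 < q true ^ 2 := (sq_nonneg _).trans_lt H.hq

/-- Squaring the equality of the two terms of the numerator leaves (1 − pᵢ²)(q₂² − q₁²) = 0, which
|q₁| < |q₂| excludes. -/
lemma lamA_ne_zero (i η : Bool) : lamA p q i η ≠ 0 := by
  unfold lamA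
  have h1 : √(1 - p i ^ 2) ≠ 0 := (Real.sqrt_pos.2 (H.one_sub_p_pos i)).ne'
  refine div_ne_zero (mul_ne_zero (mul_ne_zero (sg_ne_zero _) (sg_ne_zero _)) fun h => ?_) h1
  have h2 : (Q p q i false * q true) ^ 2 = (q false * Q p q i true) ^ 2 := by
    rw [sub_eq_zero.1 h]
  rw [mul_pow, mul_pow, H.Q_sq, H.Q_sq] at h2
  nlinarith [H.one_sub_p_pos i, H.hq]

lemma lamB_ne_zero (j : Bool) : lamB p q j ≠ 0 := by
  unfold lamB
  have h1 : √(1 - q j ^ 2) ≠ 0 := (Real.sqrt_pos.2 (H.one_sub_q_pos j)).ne'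
  refine div_ne_zero (mul_ne_zero (neg_ne_zero.2 (sg_ne_zero _)) fun h => ?_) h1
  have h2 : (Q p q false j * p true) ^ 2 = (p false * Q p q true j) ^ 2 := by
    rw [sub_eq_zero.1 h]
  rw [mul_pow, mul_pow, H.Q_sq, H.Q_sq] at h2
  nlinarith [H.one_sub_q_pos j, H.hp]

end Params

/-! ### Edges -/

/-- The edge joining a vertex of index `1` and a vertex of index `2`. -/
abbrev eAB (i j : Bool) : Edge := edge (0, i) (1, j) (by simp)

/-- The edge joining a vertex of index `1` and a vertex of index `3`. -/
abbrev eAC (i k : Bool) : Edge := edge (0, i) (2, k) (by simp)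

/-- The edge joining a vertex of index `2` and a vertex of index `3`. -/
abbrev eBC (j k : Bool) : Edge := edge (1, j) (2, k) (by simp)

lemma edge_comm (u v : Vertex) (h : u.1 ≠ v.1) : edge u v h = edge v u h.symm :=
  Subtype.ext Sym2.eq_swap

lemma edge_forall {C : Edge → Prop} (h1 : ∀ i j, C (eAB i j)) (h2 : ∀ i k, C (eAC i k))
    (h3 : ∀ j k, C (eBC j k)) (e : Edge) : C e := by
  obtain ⟨e, he⟩ := e
  induction e using Sym2.ind with
  | _ u v =>
    have h : u.1 ≠ v.1 := by simpa using he
    change C (edge u v h)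
    obtain ⟨u, i⟩ := u
    obtain ⟨v, j⟩ := v
    fin_cases u <;> fin_cases v
    · exact absurd rfl h
    · exact h1 i j
    · exact h2 i j
    · rw [edge_comm]; exact h1 j i
    · exact absurd rfl h
    · exact h3 i j
    · rw [edge_comm]; exact h2 j i
    · rw [edge_comm]; exact h3 j i
    · exact absurd rfl h

lemma card_edge : Fintype.card Edge = 12 := by decide

/-! ### Homogeneous coordinates of the half-angle tangents -/

section Rep

variable {R S : Type*} [CommRing R] [Algebra ℝ R] [CommRing S] [Algebra ℝ S]

/-- Homogeneous coordinates of the half-angle tangent at the edge `Aᵢ Bⱼ`. -/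
noncomputable def repAB (y : Bool × Bool → R) (i j : Bool) : Fin 2 → R :=
  ![-(sg i * sg j) • y (true, j), y (false, i)]

/-- Two systems of homogeneous coordinates of the half-angle tangent at the edges at `Aᵢ`. -/
noncomputable def repAC (p q : Bool → ℝ) (k : Bool) (y : Bool × Bool → R) (i η : Bool) :
    Fin 2 → R :=
  bif k then ![lamA p q i η • (Q p q i true • y (true, false) - Q p q i false • y (true, true)),
    (q true ^ 2 - q false ^ 2) • y (false, i)]
  else ![lamA p q i η • y (false, i),
    Q p q i true • y (true, false) + Q p q i false • y (true, true)]

/-- Two systems of homogeneous coordinates of the half-angle tangent at the edges at `Bⱼ`. -/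
noncomputable def repBC (p q : Bool → ℝ) (k : Bool) (y : Bool × Bool → R) (j : Bool) :
    Fin 2 → R :=
  bif k then ![lamB p q j • (Q p q true j • y (false, false) - Q p q false j • y (false, true)),
    (p true ^ 2 - p false ^ 2) • y (true, j)]
  else ![lamB p q j • y (true, j),
    Q p q true j • y (false, false) + Q p q false j • y (false, true)]

/-- The systems of homogeneous coordinates at the edge joining two vertices. -/
noncomputable def repV (p q : Bool → ℝ) (k : Bool) (y : Bool × Bool → R) :
    Vertex → Vertex → Fin 2 → R
  | (0, i), (1, j) => repAB y i j
  | (1, j), (0, i) => repAB y i j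
  | (0, i), (2, η) => repAC p q k y i η
  | (2, η), (0, i) => repAC p q k y i η
  | (1, j), (2, _) => repBC p q k y j
  | (2, _), (1, j) => repBC p q k y j
  | (0, _), (0, _) => 0
  | (1, _), (1, _) => 0
  | (2, _), (2, _) => 0

lemma repV_comm (p q : Bool → ℝ) (k : Bool) (y : Bool × Bool → R) (u v : Vertex) :
    repV p q k y u v = repV p q k y v u := by
  obtain ⟨u, i⟩ := u
  obtain ⟨v, j⟩ := v
  fin_cases u <;> fin_cases v <;> rfl

/-- Two systems (`k = false`, `k = true`) of homogeneous coordinates of the half-angle tangent at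
an edge, as linear forms in the coordinates of a point of the curve. -/
noncomputable def rep (p q : Bool → ℝ) (k : Bool) (y : Bool × Bool → R) (e : Edge) : Fin 2 → R :=
  Sym2.lift ⟨repV p q k y, repV_comm p q k y⟩ e.1

variable (p q : Bool → ℝ) (k : Bool) (y : Bool × Bool → R)

lemma rep_eAB (i j : Bool) : rep p q k y (eAB i j) = repAB y i j := rfl
lemma rep_eAC (i η : Bool) : rep p q k y (eAC i η) = repAC p q k y i η := rfl
lemma rep_eBC (j η : Bool) : rep p q k y (eBC j η) = repBC p q k y j := rfl

/-- The forms are defined over any `ℝ`-algebra because the same expressions are used for real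
points, for polynomial variables and for dual numbers. -/
lemma map_rep (f : R →ₐ[ℝ] S) (e : Edge) (l : Fin 2) :
    f (rep p q k y e l) = rep p q k (fun i => f (y i)) e l := by
  revert e
  apply edge_forall
  · intro i j
    simp only [rep_eAB, repAB]
    fin_cases l <;> simp
  · intro i j
    simp only [rep_eAC, repAC]
    fin_cases l <;> cases k <;> simp
  · intro i j
    simp only [rep_eBC, repBC]
    fin_cases l <;> cases k <;> simp

/-- Linearity of the forms: only the line spanned by `y` matters for the projective point. -/
lemma rep_smul (c : R) (e : Edge) (l : Fin 2) :
    rep p q k (fun i => c * y i) e l = c * rep p q k y e l := by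
  revert e
  apply edge_forall
  · intro i j
    simp only [rep_eAB, repAB]
    fin_cases l <;> simp
  · intro i j
    simp only [rep_eAC, repAC]
    fin_cases l <;> cases k <;> simp [mul_sub, mul_add]
  · intro i j
    simp only [rep_eBC, repBC]
    fin_cases l <;> cases k <;> simp [mul_sub, mul_add]

end Rep

/-! ### Points of the projective line -/

/-- `v` represents the point `t` of the projective line, or vanishes. -/
def IsRep (t : OnePoint ℝ) (v : Fin 2 → ℝ) : Prop := homog t 0 * v 1 = homog t 1 * v 0

/-- The point of the projective line with given homogeneous coordinates. -/
noncomputable def toPt (v : Fin 2 → ℝ) : OnePoint ℝ :=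
  if v 1 = 0 then OnePoint.infty else ((v 0 / v 1 : ℝ) : OnePoint ℝ)

@[simp] lemma homog_infty : homog OnePoint.infty = ![1, 0] := rfl
@[simp] lemma homog_coe (r : ℝ) : homog (r : OnePoint ℝ) = ![r, 1] := rfl

lemma homog_ne_zero (t : OnePoint ℝ) : homog t ≠ 0 := by
  intro h
  induction t using OnePoint.rec with
  | infty => simpa using congrFun h 0
  | coe r => simpa using congrFun h 1

lemma homog_sq_pos (t : OnePoint ℝ) : 0 < homog t 0 ^ 2 + homog t 1 ^ 2 := by
  induction t using OnePoint.rec with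
  | infty => simp
  | coe r => simp; positivity

lemma homog_one_ne_zero {t : OnePoint ℝ} : homog t 1 ≠ 0 ↔ t ≠ OnePoint.infty := by
  induction t using OnePoint.rec <;> simp

lemma homog_zero_ne_zero {t : OnePoint ℝ} : homog t 0 ≠ 0 ↔ t ≠ ((0 : ℝ) : OnePoint ℝ) := by
  induction t using OnePoint.rec with
  | infty => simp [OnePoint.infty_ne_coe]
  | coe r => simp

lemma isRep_toPt (v : Fin 2 → ℝ) : IsRep (toPt v) v := by
  unfold IsRep toPt
  split_ifs with h
  · simp [h]
  · simp [h]

lemma isRep_homog (t : OnePoint ℝ) : IsRep t (homog t) := mul_comm _ _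

lemma IsRep.exists_smul {t : OnePoint ℝ} {v : Fin 2 → ℝ} (h : IsRep t v) :
    ∃ c : ℝ, v = c • homog t := by
  unfold IsRep at h
  induction t using OnePoint.rec with
  | infty =>
    refine ⟨v 0, funext fun i => ?_⟩
    fin_cases i
    · simp
    · simpa using h
  | coe r =>
    refine ⟨v 1, funext fun i => ?_⟩
    fin_cases i
    · simp at h ⊢; linarith
    · simp

lemma IsRep.eq_of_ne_zero {t t' : OnePoint ℝ} {v : Fin 2 → ℝ} (hv : v ≠ 0) (h : IsRep t v)
    (h' : IsRep t' v) : t = t' := by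
  obtain ⟨c, hc⟩ := h.exists_smul
  obtain ⟨c', hc'⟩ := h'.exists_smul
  have h0 : c ≠ 0 := by rintro rfl; simp at hc; exact hv hc
  have h0' : c' ≠ 0 := by rintro rfl; simp at hc'; exact hv hc'
  rw [hc] at hc'
  have e0 := congrFun hc' 0
  have e1 := congrFun hc' 1
  induction t using OnePoint.rec with
  | infty =>
    induction t' using OnePoint.rec with
    | infty => rfl
    | coe r => simp at e1; exact absurd e1.symm h0'
  | coe r =>
    induction t' using OnePoint.rec with
    | infty => simp at e1; exact absurd e1 h0
    | coe r' =>
      simp at e0 e1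
      subst e1
      rw [mul_left_cancel₀ h0 e0]

lemma IsRep.toPt_eq {t : OnePoint ℝ} {v : Fin 2 → ℝ} (hv : v ≠ 0) (h : IsRep t v) :
    toPt v = t := (isRep_toPt v).eq_of_ne_zero hv h

lemma IsRep.of_parallel {t : OnePoint ℝ} {v w : Fin 2 → ℝ} (hv : v ≠ 0) (h : IsRep t v)
    (hw : v 0 * w 1 = v 1 * w 0) : IsRep t w := by
  obtain ⟨c, hc⟩ := h.exists_smul
  have h0 : c ≠ 0 := by rintro rfl; simp at hc; exact hv hc
  have e0 := congrFun hc 0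
  have e1 := congrFun hc 1
  simp only [Pi.smul_apply, smul_eq_mul] at e0 e1
  rw [e0, e1] at hw
  unfold IsRep
  apply mul_left_cancel₀ h0
  linarith

lemma IsRep.smul {t : OnePoint ℝ} {v : Fin 2 → ℝ} (h : IsRep t v) (c : ℝ) :
    IsRep t (fun i => c * v i) := by
  unfold IsRep at *
  linear_combination c * h

lemma vec2_ne_zero {v : Fin 2 → ℝ} : v ≠ 0 ↔ v 0 ≠ 0 ∨ v 1 ≠ 0 := by
  rw [← not_iff_not]
  push Not
  constructor
  · rintro rfl; simp
  · rintro ⟨h0, h1⟩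
    funext i
    fin_cases i
    · exact h0
    · exact h1

lemma toPt_coe {v : Fin 2 → ℝ} (h : v 1 ≠ 0) : toPt v = ((v 0 / v 1 : ℝ) : OnePoint ℝ) := if_neg h

lemma continuousAt_toPt {v : Fin 2 → ℝ} (hv : v ≠ 0) : ContinuousAt toPt v := by
  have hc0 : ContinuousAt (fun w : Fin 2 → ℝ => w 0) v := (continuous_apply 0).continuousAt
  have hc1 : ContinuousAt (fun w : Fin 2 → ℝ => w 1) v := (continuous_apply 1).continuousAt
  by_cases h1 : v 1 = 0
  · have h0 : v 0 ≠ 0 := by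
      rcases vec2_ne_zero.1 hv with h | h
      · exact h
      · exact absurd h1 h
    have hinf : toPt v = OnePoint.infty := if_pos h1
    rw [ContinuousAt, hinf]
    -- A compact set of reals lies in some [−M, M], and the quotient leaves it where M|w₁| < |w₀|,
    -- which holds near `v` as v₁ = 0 and v₀ ≠ 0.
    refine OnePoint.le_nhds_infty.2 fun s _ hs => ?_
    obtain ⟨M, hM⟩ := hs.isBounded.exists_norm_le
    have hlt : ∀ᶠ w in nhds v, M * |w 1| < |w 0| := by
      refine (continuousAt_const.mul hc1.abs).eventually_lt hc0.abs ?_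
      simpa [h1] using h0
    rw [Filter.mem_map]
    filter_upwards [hlt] with w hw
    by_cases hw1 : w 1 = 0
    · exact Or.inr (if_pos hw1)
    · refine Or.inl ⟨w 0 / w 1, fun hr => ?_, (toPt_coe hw1).symm⟩
      have := hM _ hr
      rw [Real.norm_eq_abs, abs_div, div_le_iff₀ (abs_pos.2 hw1)] at this
      linarith
  · have : ∀ᶠ w in nhds v, toPt w = ((w 0 / w 1 : ℝ) : OnePoint ℝ) := by
      filter_upwards [hc1.eventually_ne h1] with w hw
      exact toPt_coe hw
    refine ContinuousAt.congr ?_ (this.mono fun _ h => h.symm)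
    exact OnePoint.continuous_coe.continuousAt.comp
      (f := fun w : Fin 2 → ℝ => w 0 / w 1) (hc0.div hc1 h1)

/-! ### The configuration attached to a point of the curve -/

/-- The family of half-angle tangents attached to `y`. -/
noncomputable def phi (p q : Bool → ℝ) (y : Bool × Bool → ℝ) : Conf := fun e =>
  open Classical in
  if rep p q false y e = 0 then toPt (rep p q true y e) else toPt (rep p q false y e)

section Curve

variable {p q : Bool → ℝ} {y : Bool × Bool → ℝ} (H : Params p q) (hy : OnCurve p q y)
include hy

lemma OnCurve.sq_sub_A : y (false, false) ^ 2 - y (false, true) ^ 2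
    = p true ^ 2 - p false ^ 2 := by
  linarith [hy false false, hy true false]

lemma OnCurve.sq_sub_B : y (true, false) ^ 2 - y (true, true) ^ 2 = q true ^ 2 - q false ^ 2 := by
  linarith [hy false false, hy false true]

include H

/-- Y₁² = Y₂² + (p₂² − p₁²) > 0. That Y₁, and likewise Z₁, never vanishes is what keeps the signs
δ₁, ε₁ constant along a flexion. -/
lemma OnCurve.A_ne_zero : y (false, false) ≠ 0 := fun h => by
  have := hy.sq_sub_A
  rw [h] at this
  nlinarith [H.hp, sq_nonneg (y (false, true))]

lemma OnCurve.B_ne_zero : y (true, false) ≠ 0 := fun h => by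
  have := hy.sq_sub_B
  rw [h] at this
  nlinarith [H.hq, sq_nonneg (y (true, true))]

/-- Y₂ vanishes only at θmax and Z₂ only at θmin, and these differ because p₂² + q₂² < 1. -/
lemma OnCurve.true_ne_zero : y (false, true) ≠ 0 ∨ y (true, true) ≠ 0 := by
  by_contra! h
  have := hy true true
  rw [h.1, h.2] at this
  linarith [H.gram_pos true true]

/-- The difference-of-squares factorization behind the two systems of homogeneous coordinates: it
makes them proportional wherever both are nonzero. -/
lemma OnCurve.prod_A (i : Bool) :
    (Q p q i true * y (true, false) - Q p q i false * y (true, true)) *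
      (Q p q i true * y (true, false) + Q p q i false * y (true, true)) =
    (q true ^ 2 - q false ^ 2) * y (false, i) ^ 2 := by
  have h1 := H.Q_sq i true
  have h2 := H.Q_sq i false
  have h3 := hy i false
  have h4 := hy i true
  linear_combination y (true, false) ^ 2 * h1 - y (true, true) ^ 2 * h2
    + (1 - p i ^ 2 - q true ^ 2) * h3 - (1 - p i ^ 2 - q false ^ 2) * h4

lemma OnCurve.prod_B (j : Bool) :
    (Q p q true j * y (false, false) - Q p q false j * y (false, true)) *
      (Q p q true j * y (false, false) + Q p q false j * y (false, true)) =
    (p true ^ 2 - p false ^ 2) * y (true, j) ^ 2 := by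
  have h1 := H.Q_sq true j
  have h2 := H.Q_sq false j
  have h3 := hy false j
  have h4 := hy true j
  linear_combination y (false, false) ^ 2 * h1 - y (false, true) ^ 2 * h2
    + (1 - p true ^ 2 - q j ^ 2) * h3 - (1 - p false ^ 2 - q j ^ 2) * h4

lemma OnCurve.rep_parallel (e : Edge) :
    rep p q false y e 0 * rep p q true y e 1 = rep p q false y e 1 * rep p q true y e 0 := by
  revert e
  apply edge_forall
  · intro i j
    simp [rep_eAB, repAB, mul_comm]
  · intro i j
    have := hy.prod_A H i
    simp only [rep_eAC, repAC, cond_true, cond_false, smul_eq_mul, Matrix.cons_val_zero,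
      Matrix.cons_val_one]
    linear_combination - lamA p q i j * this
  · intro i j
    have := hy.prod_B H i
    simp only [rep_eBC, repBC, cond_true, cond_false, smul_eq_mul, Matrix.cons_val_zero,
      Matrix.cons_val_one]
    linear_combination - lamB p q i * this

/-- If both systems vanished at an edge `Aᵢ a₃` or `Aᵢ b₃`, the sum and the difference of Qᵢ₂Z₁ and
Qᵢ₁Z₂ would both be 0, against Z₁ ≠ 0. The edges at `Bⱼ` use Y₁ ≠ 0 in the same way. -/
lemma OnCurve.exists_rep_ne_zero (e : Edge) : ∃ k, rep p q k y e ≠ 0 := by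
  revert e
  apply edge_forall
  · intro i j
    refine ⟨true, vec2_ne_zero.2 ?_⟩
    simp only [rep_eAB, repAB, smul_eq_mul, Matrix.cons_val_zero, Matrix.cons_val_one]
    by_contra! h
    have h1 : y (true, j) = 0 := by
      simpa [sg_ne_zero] using h.1
    have h3 := hy i j
    rw [h1, h.2] at h3
    linarith [H.gram_pos i j]
  · intro i j
    by_contra! h
    have h1 := congrFun (h true) 0
    have h2 := congrFun (h false) 1
    simp [rep_eAC, repAC, H.lamA_ne_zero] at h1 h2
    exact (mul_ne_zero (H.Q_pos i true).ne' (hy.B_ne_zero H)) (by linarith)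
  · intro i j
    by_contra! h
    have h1 := congrFun (h true) 0
    have h2 := congrFun (h false) 1
    simp [rep_eBC, repBC, H.lamB_ne_zero] at h1 h2
    exact (mul_ne_zero (H.Q_pos true i).ne' (hy.A_ne_zero H)) (by linarith)

lemma OnCurve.isRep_phi (k : Bool) (e : Edge) : IsRep (phi p q y e) (rep p q k y e) := by
  unfold phi
  split_ifs with h
  · cases k
    · rw [h]; simp [IsRep]
    · exact isRep_toPt _
  · cases k
    · exact isRep_toPt _
    · exact (isRep_toPt _).of_parallel h (hy.rep_parallel H e)

lemma OnCurve.phi_eq_toPt {k : Bool} {e : Edge} (h : rep p q k y e ≠ 0) :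
    phi p q y e = toPt (rep p q k y e) := ((hy.isRep_phi H k e).toPt_eq h).symm

lemma OnCurve.eq_phi {e : Edge} {t : OnePoint ℝ} (h : ∀ k, IsRep t (rep p q k y e)) :
    t = phi p q y e := by
  obtain ⟨k, hk⟩ := hy.exists_rep_ne_zero H e
  exact (h k).eq_of_ne_zero hk (hy.isRep_phi H k e)

end Curve

lemma continuous_rep (p q : Bool → ℝ) (k : Bool) (e : Edge) :
    Continuous fun y : Bool × Bool → ℝ => rep p q k y e := by
  refine continuous_pi fun l => ?_
  revert e
  apply edge_forall
  · intro i j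
    simp only [rep_eAB, repAB]
    fin_cases l <;> simp <;> fun_prop
  · intro i j
    simp only [rep_eAC, repAC]
    fin_cases l <;> cases k <;> simp <;> fun_prop
  · intro i j
    simp only [rep_eBC, repBC]
    fin_cases l <;> cases k <;> simp <;> fun_prop

/-- A system of forms that is nonzero at a point stays nonzero nearby, so locally `phi` is the
quotient map composed with a linear map, although no single system serves everywhere. -/
lemma continuousOn_phi {p q : Bool → ℝ} (H : Params p q) :
    ContinuousOn (phi p q) {y | OnCurve p q y} := by
  intro y hy
  refine continuousWithinAt_pi.2 fun e => ?_
  obtain ⟨k, hk⟩ := OnCurve.exists_rep_ne_zero H hy e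
  have hc := (continuous_rep p q k e).continuousAt (x := y)
  have h1 : ContinuousAt (fun z => toPt (rep p q k z e)) y :=
    ContinuousAt.comp (f := fun z => rep p q k z e) (continuousAt_toPt hk) hc
  refine h1.continuousWithinAt.congr_of_eventuallyEq ?_ (OnCurve.phi_eq_toPt H hy hk)
  filter_upwards [self_mem_nhdsWithin, mem_nhdsWithin_of_mem_nhds (hc.eventually_ne hk)]
    with z hz hz'
  exact OnCurve.phi_eq_toPt H hz hz'

/-! ### Recovering the point of the curve -/

/-- The point of the curve, up to a factor, as a function of homogeneous coordinates. -/
def recov {R : Type*} [CommRing R] (z : Edge × Fin 2 → R) : Bool × Bool → R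
  | (false, false) => -(z (eAB false false, 1) * z (eAB true false, 0) * z (eAB false true, 1))
  | (false, true) => z (eAB true false, 1) * z (eAB false false, 0) * z (eAB false true, 1)
  | (true, false) => z (eAB false false, 0) * z (eAB true false, 0) * z (eAB false true, 1)
  | (true, true) => -(z (eAB false true, 0) * z (eAB false false, 1) * z (eAB true false, 0))

section Curve

variable {p q : Bool → ℝ} {y y' : Bool × Bool → ℝ} (H : Params p q) (hy : OnCurve p q y)
include H hy

lemma OnCurve.coords_scale (i j : Bool) : ∃ c : ℝ, c ≠ 0 ∧
    y (true, j) = -(sg i * sg j) * (c * coords (phi p q y) (eAB i j, 0)) ∧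
    y (false, i) = c * coords (phi p q y) (eAB i j, 1) := by
  have h := hy.isRep_phi H true (eAB i j)
  obtain ⟨c, hc⟩ := h.exists_smul
  have h0 := congrFun hc 0
  have h1 := congrFun hc 1
  simp only [rep_eAB, repAB, smul_eq_mul, Matrix.cons_val_zero, Matrix.cons_val_one,
    Pi.smul_apply] at h0 h1
  refine ⟨c, ?_, ?_, h1⟩
  · rintro rfl
    have h3 := hy i j
    have : y (true, j) = 0 := by simpa [sg_ne_zero] using h0
    rw [this, h1] at h3
    linarith [H.gram_pos i j]
  · unfold coords
    linear_combination (-(sg i * sg j)) * h0 - y (true, j) * (sg j ^ 2 * sg_sq i + sg_sq j)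

/-- The formulas of `recov` solve t₁₁ = −Z₁/Y₁, t₁₂ = Z₂/Y₁, t₂₁ = Z₁/Y₂ for the ratios of the
coordinates, with denominators cleared. The resulting factor is nonzero because Y₁Z₁ ≠ 0. -/
lemma OnCurve.recov_coords : ∃ c : ℝ, c ≠ 0 ∧ ∀ i, recov (coords (phi p q y)) i = c * y i := by
  obtain ⟨c1, h1, a1, b1⟩ := hy.coords_scale H false false
  obtain ⟨c2, h2, a2, b2⟩ := hy.coords_scale H false true
  obtain ⟨c3, h3, a3, b3⟩ := hy.coords_scale H true false
  set z := coords (phi p q y)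
  replace a1 : c1 * z (eAB false false, 0) = -y (true, false) := by
    simp only [sg_false] at a1; linarith
  replace a2 : c2 * z (eAB false true, 0) = y (true, true) := by
    simp only [sg_false, sg_true] at a2; linarith
  replace a3 : c3 * z (eAB true false, 0) = y (true, false) := by
    simp only [sg_false, sg_true] at a3; linarith
  have hA := hy.A_ne_zero H
  have hB := hy.B_ne_zero H
  refine ⟨-(y (false, false) * y (true, false)) / (c1 * c2 * c3),
    div_ne_zero (neg_ne_zero.2 (mul_ne_zero hA hB)) (mul_ne_zero (mul_ne_zero h1 h2) h3), ?_⟩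
  have key : ∀ r s : ℝ, c1 * c2 * c3 * r = -(y (false, false) * y (true, false)) * s →
      r = -(y (false, false) * y (true, false)) / (c1 * c2 * c3) * s := by
    intro r s h
    field_simp
    linarith
  rintro ⟨_ | _, _ | _⟩ <;> apply key <;> simp only [recov]
  · calc _ = -((c1 * z (eAB false false, 1)) * (c3 * z (eAB true false, 0)) *
          (c2 * z (eAB false true, 1))) := by ring
      _ = _ := by rw [← b1, a3, ← b2]; ring
  · calc _ = (c3 * z (eAB true false, 1)) * (c1 * z (eAB false false, 0)) *
          (c2 * z (eAB false true, 1)) := by ring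
      _ = _ := by rw [← b3, a1, ← b2]; ring
  · calc _ = (c1 * z (eAB false false, 0)) * (c3 * z (eAB true false, 0)) *
          (c2 * z (eAB false true, 1)) := by ring
      _ = _ := by rw [a1, a3, ← b2]; ring
  · calc _ = -((c2 * z (eAB false true, 0)) * (c1 * z (eAB false false, 1)) *
          (c3 * z (eAB true false, 0))) := by ring
      _ = _ := by rw [a2, a3, ← b1]; ring

/-- Equal tangents make the two points proportional, and the inhomogeneous equation Y₁² + Z₁² = 1 −
p₁² − q₁² forces the factor to be ±1. -/
lemma OnCurve.eq_or_neg_of_phi_eq (hy' : OnCurve p q y') (h : phi p q y = phi p q y') :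
    y' = y ∨ y' = -y := by
  obtain ⟨c, hc, e⟩ := hy.recov_coords H
  obtain ⟨c', hc', e'⟩ := hy'.recov_coords H
  rw [← h] at e'
  have key : ∀ i, y' i = c / c' * y i := fun i => by
    have := (e i).symm.trans (e' i)
    field_simp
    linarith
  have h1 := hy false false
  have h2 := hy' false false
  rw [key, key] at h2
  have h3 : (c / c') ^ 2 = 1 := by
    have h4 : ((c / c') ^ 2 - 1) * (1 - p false ^ 2 - q false ^ 2) = 0 := by
      linear_combination h2 - (c / c') ^ 2 * h1
    rcases mul_eq_zero.1 h4 with h5 | h5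
    · linarith
    · exact absurd h5 (H.gram_pos _ _).ne'
  rcases (mul_self_eq_one_iff.1 ((sq _).symm.trans h3)) with h4 | h4
  · left; funext i; rw [key, h4, one_mul]
  · right; funext i; rw [key, h4]; simp

lemma OnCurve.eq_of_phi_eq (hy' : OnCurve p q y') (h : phi p q y = phi p q y') (i : Bool)
    (hs : 0 < y (i, false) * y' (i, false)) : y' = y := by
  rcases hy.eq_or_neg_of_phi_eq H hy' h with h1 | h1
  · exact h1
  · rw [h1] at hs
    simp only [Pi.neg_apply] at hs
    nlinarith [sq_nonneg (y (i, false))]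

end Curve

lemma OnCurve.neg {p q : Bool → ℝ} {y : Bool × Bool → ℝ} (hy : OnCurve p q y) :
    OnCurve p q (-y) := fun i j => by simpa using hy i j

lemma OnCurve.phi_neg {p q : Bool → ℝ} {y : Bool × Bool → ℝ} (H : Params p q)
    (hy : OnCurve p q y) : phi p q (-y) = phi p q y := by
  funext e
  refine OnCurve.eq_phi H hy fun k => ?_
  have := (hy.neg.isRep_phi H k e).smul (-1)
  convert this using 1
  funext l
  rw [← rep_smul]
  congr 1
  funext i
  simp

/-- The curve of the configurations attached to the points `y`. -/
def curve (p q : Bool → ℝ) : Set Conf := phi p q '' {y | OnCurve p q y}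

/-! ### Euclidean 4-space -/

lemma inner_E4 (x y : E4) : inner ℝ x y = x 0 * y 0 + x 1 * y 1 + x 2 * y 2 + x 3 * y 3 := by
  simp only [PiLp.inner_apply, Fin.sum_univ_four, RCLike.inner_apply, conj_trivial]
  ring

lemma norm_eq_one_iff_inner {x : E4} : ‖x‖ = 1 ↔ inner ℝ x x = (1 : ℝ) := by
  rw [real_inner_self_eq_norm_sq]
  constructor
  · intro h; rw [h]; norm_num
  · intro h
    have := norm_nonneg x
    nlinarith

lemma ext_E4 {x y : E4} (h0 : x 0 = y 0) (h1 : x 1 = y 1) (h2 : x 2 = y 2) (h3 : x 3 = y 3) :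
    x = y := by
  ext i
  fin_cases i <;> assumption

lemma det4_eq (x y z w : E4) : det4 x y z w =
    x 0 * (y 1 * (z 2 * w 3 - z 3 * w 2) - y 2 * (z 1 * w 3 - z 3 * w 1)
      + y 3 * (z 1 * w 2 - z 2 * w 1))
    - x 1 * (y 0 * (z 2 * w 3 - z 3 * w 2) - y 2 * (z 0 * w 3 - z 3 * w 0)
      + y 3 * (z 0 * w 2 - z 2 * w 0))
    + x 2 * (y 0 * (z 1 * w 3 - z 3 * w 1) - y 1 * (z 0 * w 3 - z 3 * w 0)
      + y 3 * (z 0 * w 1 - z 1 * w 0))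
    - x 3 * (y 0 * (z 1 * w 2 - z 2 * w 1) - y 1 * (z 0 * w 2 - z 2 * w 0)
      + y 2 * (z 0 * w 1 - z 1 * w 0)) := by
  have h : det4 x y z w = Matrix.det (Matrix.of fun i j : Fin 4 => (![x, y, z, w] i) j) := rfl
  rw [h, Matrix.det_succ_row_zero]
  simp only [Fin.sum_univ_four, Matrix.det_fin_three, Matrix.submatrix_apply]
  simp [Fin.succAbove, Fin.lt_def]
  ring

lemma det4_add_smul (x m y n : E4) (r s c : ℝ) :
    det4 x m y (r • x + s • y + c • n) = c * det4 x m y n := by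
  simp only [det4_eq, PiLp.add_apply, PiLp.smul_apply, smul_eq_mul]
  ring

lemma det4_smul_two (x m y z : E4) (c : ℝ) : det4 x (c • m) y z = c * det4 x m y z := by
  simp only [det4_eq, PiLp.smul_apply, smul_eq_mul]
  ring

lemma det4_swap (x m y z : E4) : det4 y m x z = -det4 x m y z := by
  simp only [det4_eq]
  ring

lemma det4_rotate (x y m n : E4) (a b c d : ℝ) :
    det4 x (a • n + b • m) y (c • n + d • m) = (b * c - a * d) * det4 x m y n := by
  simp only [det4_eq, PiLp.add_apply, PiLp.smul_apply, smul_eq_mul]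
  ring

lemma exists_coeff_of_det4_ne_zero {x y z w : E4} (h : det4 x y z w ≠ 0) (v : E4) :
    ∃ a b c d : ℝ, v = a • x + b • y + c • z + d • w := by
  set M : Matrix (Fin 4) (Fin 4) ℝ := fun i j => (![x, y, z, w] i) j with hM
  have hu : IsUnit M.det := isUnit_iff_ne_zero.2 h
  set k : Fin 4 → ℝ := Matrix.vecMul v.ofLp M⁻¹ with hk
  have hkM : Matrix.vecMul k M = v.ofLp := by
    rw [hk, Matrix.vecMul_vecMul, Matrix.nonsing_inv_mul _ hu, Matrix.vecMul_one]
  refine ⟨k 0, k 1, k 2, k 3, ?_⟩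
  ext i
  have := congrFun hkM i
  rw [← this]
  simp only [Matrix.vecMul, dotProduct, Fin.sum_univ_four, hM]
  simp

/-! ### Uniqueness of the half-angle tangents -/

lemma IsInnerNormal.inner_of_orthogonal {x y z n m : E4} (h : IsInnerNormal x y z n)
    (hx : inner ℝ m x = 0) (hy : inner ℝ m y = 0) (hz : inner ℝ m z = 0) :
    inner ℝ m n = 0 := by
  obtain ⟨-, -, -, r, s, c, hc, hz'⟩ := h
  rw [hz', inner_add_right, inner_add_right, inner_smul_right, inner_smul_right,
    inner_smul_right, hx, hy] at hz
  have : c * inner ℝ m n = 0 := by linarith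
  exact (mul_eq_zero.1 this).resolve_left hc.ne'

/-- The difference c n − c′ n′ lies in the span of `x`, `y` and is orthogonal to it, so it is zero;
comparing norms gives c = c′. -/
lemma IsInnerNormal.unique {x y z n n' : E4} (h : IsInnerNormal x y z n)
    (h' : IsInnerNormal x y z n') : n = n' := by
  obtain ⟨h1, h2, h3, r, s, c, hc, hz⟩ := h
  obtain ⟨h1', h2', h3', r', s', c', hc', hz'⟩ := h'
  have hd : c • n - c' • n' = (r' - r) • x + (s' - s) • y := by
    rw [hz] at hz'
    rw [← sub_eq_zero] at hz' ⊢
    rw [← hz']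
    module
  have h0 : c • n - c' • n' = 0 := by
    rw [← inner_self_eq_zero (𝕜 := ℝ)]
    nth_rewrite 2 [hd]
    simp only [inner_add_right, inner_smul_right, inner_sub_left, real_inner_smul_left, h2, h3,
      h2', h3']
    ring
  have h4 : c • n = c' • n' := sub_eq_zero.1 h0
  have h5 : c = c' := by
    have := congrArg norm h4
    rwa [norm_smul, norm_smul, h1, h1', Real.norm_of_nonneg hc.le, Real.norm_of_nonneg hc'.le,
      mul_one, mul_one] at this
  rw [h5] at h4
  exact smul_right_injective _ hc'.ne' h4

/-- Expanding m′ in the basis formed by m and the face, m′ − b m lies in the span of the face and is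
orthogonal to it. So m′ = b m with |b| = 1, and the orientation makes b positive. -/
lemma IsExteriorNormal.unique {P : Vertex → E4} {u v w : Vertex} {m m' : E4}
    (h : IsExteriorNormal P u v w m) (h' : IsExteriorNormal P u v w m') : m = m' := by
  obtain ⟨h1, h2, h3, h4, h5⟩ := h
  obtain ⟨h1', h2', h3', h4', h5'⟩ := h'
  have hd : det4 (P u) m (P v) (P w) ≠ 0 := fun h => by simp [h] at h5
  obtain ⟨a, b, c, d, e⟩ := exists_coeff_of_det4_ne_zero hd m'
  have h0 : m' - b • m = 0 := by
    rw [← inner_self_eq_zero (𝕜 := ℝ)]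
    have he : m' - b • m = a • P u + c • P v + d • P w := by rw [e]; abel
    nth_rewrite 2 [he]
    simp only [inner_add_right, inner_smul_right, inner_sub_left, real_inner_smul_left, h2, h3,
      h4, h2', h3', h4']
    ring
  have h6 : m' = b • m := sub_eq_zero.1 h0
  have h7 : |b| = 1 := by
    rw [h6, norm_smul, h1, Real.norm_eq_abs, mul_one] at h1'
    exact h1'
  rw [h6, det4_smul_two] at h5'
  have h8 : 0 < b := by
    by_contra hb
    nlinarith
  rw [abs_of_pos h8] at h7
  rw [h6, h7, one_smul]

lemma isRep_halfTan (φ : ℝ) : IsRep (halfTan φ) ![Real.sin (φ / 2), Real.cos (φ / 2)] := by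
  unfold halfTan
  split_ifs with h
  · simp [IsRep, h]
  · simp [IsRep, Real.tan_eq_sin_div_cos, h]

lemma sin_cos_vec_ne_zero (φ : ℝ) : ![Real.sin φ, Real.cos φ] ≠ 0 := by
  intro h
  have h0 := congrFun h 0
  have h1 := congrFun h 1
  simp only [Matrix.cons_val_zero, Matrix.cons_val_one, Pi.zero_apply] at h0 h1
  have := Real.sin_sq_add_cos_sq φ
  rw [h0, h1] at this
  norm_num at this

/-- Here cos(φ − ψ) = 1, so sin(φ/2 − ψ/2) = 0, which says that the vectors (sin, cos) of the half
angles are parallel. They may differ in sign, but the projective point does not see this. -/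
lemma halfTan_congr {φ ψ : ℝ} (hc : Real.cos φ = Real.cos ψ) (hs : Real.sin φ = Real.sin ψ) :
    halfTan φ = halfTan ψ := by
  refine ((isRep_halfTan φ).of_parallel (sin_cos_vec_ne_zero _) ?_).eq_of_ne_zero
    (sin_cos_vec_ne_zero _) (isRep_halfTan ψ)
  simp only [Matrix.cons_val_zero, Matrix.cons_val_one]
  have h1 : Real.cos (2 * (φ / 2 - ψ / 2)) = 1 := by
    rw [show 2 * (φ / 2 - ψ / 2) = φ - ψ by ring, Real.cos_sub, hc, hs]
    nlinarith [Real.sin_sq_add_cos_sq ψ]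
  rw [Real.cos_two_mul, Real.cos_sq'] at h1
  have h2 : Real.sin (φ / 2 - ψ / 2) = 0 := by
    have : Real.sin (φ / 2 - ψ / 2) ^ 2 = 0 := by linarith
    exact pow_eq_zero_iff (two_ne_zero) |>.1 this
  rw [Real.sin_sub] at h2
  linarith

/-- All three normals are unique, and the inner products of n₂ with n₁ and with m read off cos φ and
−sin φ. -/
lemma IsDihedralAngle.halfTan_unique {P : Vertex → E4} {u v w : Vertex} {φ ψ : ℝ}
    (h : IsDihedralAngle P u v w φ) (h' : IsDihedralAngle P u v w ψ) :
    halfTan φ = halfTan ψ := by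
  obtain ⟨m, n₁, n₂, hm, hn₁, hn₂, he⟩ := h
  obtain ⟨m', n₁', n₂', hm', hn₁', hn₂', he'⟩ := h'
  obtain rfl := hm.unique hm'
  obtain rfl := hn₁.unique hn₁'
  obtain rfl := hn₂.unique hn₂'
  have ho : inner ℝ m n₁ = 0 := hn₁.inner_of_orthogonal hm.2.1 hm.2.2.1 hm.2.2.2.1
  have ho' : inner ℝ n₁ m = 0 := by rw [real_inner_comm]; exact ho
  have i1 := norm_eq_one_iff_inner.1 hn₁.1
  have i2 := norm_eq_one_iff_inner.1 hm.1
  have key := he.symm.trans he'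
  refine halfTan_congr ?_ ?_
  · have := congrArg (fun z => inner ℝ n₁ z) key
    simpa only [inner_sub_right, inner_smul_right, i1, ho', mul_one, mul_zero, sub_zero] using this
  · have := congrArg (fun z => inner ℝ m z) key
    simp only [inner_sub_right, inner_smul_right, i2, ho, mul_one, mul_zero, zero_sub] at this
    linarith

/-- A third vertex of a face. -/
lemma exists_third (u v : Vertex) : ∃ w : Vertex, u.1 ≠ v.1 → u.1 ≠ w.1 ∧ v.1 ≠ w.1 := by
  revert u v
  decide

lemma IsConfigOf.unique {ℓ : Edge → ℝ} {P : Vertex → E4} {t t' : Conf} (h : IsConfigOf ℓ P t)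
    (h' : IsConfigOf ℓ P t') : t = t' := by
  have key : ∀ (u v : Vertex) (huv : u.1 ≠ v.1), t (edge u v huv) = t' (edge u v huv) := by
    intro u v huv
    obtain ⟨w, hw⟩ := exists_third u v
    obtain ⟨φ, h1, h2⟩ := h.2 u v w huv (hw huv).1 (hw huv).2
    obtain ⟨ψ, h1', h2'⟩ := h'.2 u v w huv (hw huv).1 (hw huv).2
    rw [h2, h2', h1.halfTan_unique h1']
  funext e
  revert e
  exact edge_forall (fun _ _ => key _ _ _) (fun _ _ => key _ _ _) (fun _ _ => key _ _ _)

/-! ### Invariance of the dihedral angles -/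

@[simp] lemma opp_opp (u : Vertex) : opp (opp u) = u := by simp [opp]

lemma orient_swap {u v : Vertex} (h : u.1 ≠ v.1) (w : Vertex) :
    orient v u w = -orient u v w := by
  obtain ⟨u, i⟩ := u
  obtain ⟨v, j⟩ := v
  obtain ⟨w, k⟩ := w
  fin_cases u <;> fin_cases v <;> cases i <;> cases j <;> cases k <;> simp [orient] at h ⊢

lemma orient_opp (u v w : Vertex) : orient u v (opp w) = -orient u v w := by
  unfold orient opp
  cases w.2 <;> simp

lemma IsInnerNormal.swap {x y z n : E4} (h : IsInnerNormal x y z n) : IsInnerNormal y x z n := by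
  obtain ⟨h1, h2, h3, r, s, c, hc, hz⟩ := h
  exact ⟨h1, h3, h2, s, r, c, hc, by rw [hz]; abel⟩

lemma IsDihedralAngle.swap {P : Vertex → E4} {u v w : Vertex} {φ : ℝ} (huv : u.1 ≠ v.1)
    (h : IsDihedralAngle P u v w φ) : IsDihedralAngle P v u w φ := by
  obtain ⟨m, n₁, n₂, hm, hn₁, hn₂, he⟩ := h
  refine ⟨m, n₁, n₂, ⟨hm.1, hm.2.2.1, hm.2.1, hm.2.2.2.1, ?_⟩, hn₁.swap, hn₂.swap, he⟩
  rw [det4_swap, orient_swap huv, neg_mul_neg]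
  exact hm.2.2.2.2

/-- In the plane normal to the edge, the reflection exchanging n₁ and n₂ carries m to −sin φ n₁ −
cos φ m, which is the exterior normal of the other face. Its determinant −1 is compensated by the
sign change of `orient`. -/
lemma IsDihedralAngle.opp {P : Vertex → E4} {u v w : Vertex} {φ : ℝ}
    (h : IsDihedralAngle P u v w φ) : IsDihedralAngle P u v (opp w) φ := by
  obtain ⟨m, n₁, n₂, hm, hn₁, hn₂, he⟩ := h
  have ho : inner ℝ m n₁ = 0 := hn₁.inner_of_orthogonal hm.2.1 hm.2.2.1 hm.2.2.2.1
  have ho' : inner ℝ n₁ m = 0 := by rw [real_inner_comm]; exact ho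
  have i1 := norm_eq_one_iff_inner.1 hn₁.1
  have i2 := norm_eq_one_iff_inner.1 hm.1
  have hsc := Real.sin_sq_add_cos_sq φ
  obtain ⟨hm1, hm2, hm3, hm4, hm5⟩ := hm
  have horth : inner ℝ ((-Real.sin φ) • n₁ + (-Real.cos φ) • m) n₂ = (0 : ℝ) := by
    rw [he]
    simp only [inner_add_left, inner_sub_right, inner_smul_right, real_inner_smul_left, i1, i2,
      ho, ho']
    ring
  refine ⟨(-Real.sin φ) • n₁ + (-Real.cos φ) • m, n₂, n₁, ⟨?_, ?_, ?_, ?_, ?_⟩, hn₂, ?_, ?_⟩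
  · rw [norm_eq_one_iff_inner]
    simp only [inner_add_left, inner_add_right, inner_smul_right, real_inner_smul_left, i1, i2,
      ho, ho']
    linarith
  · simp [inner_add_left, real_inner_smul_left, hn₁.2.1, hm2]
  · simp [inner_add_left, real_inner_smul_left, hn₁.2.2.1, hm3]
  · obtain ⟨r, s, c, hc, hz⟩ := hn₂.2.2.2
    rw [hz, inner_add_right, inner_add_right, inner_smul_right, inner_smul_right,
      inner_smul_right, horth]
    simp [inner_add_left, real_inner_smul_left, hn₁.2.1, hm2, hn₁.2.2.1, hm3]
  · obtain ⟨r, s, c, hc, hz⟩ := hn₂.2.2.2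
    obtain ⟨r', s', c', hc', hz'⟩ := hn₁.2.2.2
    rw [hz', det4_add_smul] at hm5
    have hn2 : n₂ = Real.cos φ • n₁ + (-Real.sin φ) • m := by rw [he]; module
    rw [hz, det4_add_smul, hn2, det4_rotate, orient_opp]
    have h1 : 0 < orient u v w * det4 (P u) m (P v) n₁ := by
      by_contra h0
      nlinarith
    have h2 : -orient u v w * (c * ((-Real.cos φ * Real.cos φ - -Real.sin φ * -Real.sin φ) *
        det4 (P u) m (P v) n₁)) = c * (orient u v w * det4 (P u) m (P v) n₁) := by
      linear_combination (c * (orient u v w * det4 (P u) m (P v) n₁)) * hsc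
    rw [h2]
    positivity
  · rw [opp_opp]; exact hn₁
  · rw [he]
    have : n₁ = (Real.sin φ ^ 2 + Real.cos φ ^ 2) • n₁ := by rw [hsc, one_smul]
    nth_rewrite 1 [this]
    module

lemma exists_angle {C S : ℝ} (h : C ^ 2 + S ^ 2 = 1) :
    ∃ φ, Real.cos φ = C ∧ Real.sin φ = S := by
  have hC1 : -1 ≤ C := by nlinarith [sq_nonneg S]
  have hC2 : C ≤ 1 := by nlinarith [sq_nonneg S]
  have hs : √(1 - C ^ 2) = |S| := by
    rw [show 1 - C ^ 2 = S ^ 2 by linarith, Real.sqrt_sq_eq_abs]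
  rcases le_total 0 S with hS | hS
  · refine ⟨Real.arccos C, Real.cos_arccos hC1 hC2, ?_⟩
    rw [Real.sin_arccos, hs, abs_of_nonneg hS]
  · refine ⟨-Real.arccos C, by rw [Real.cos_neg, Real.cos_arccos hC1 hC2], ?_⟩
    rw [Real.sin_neg, Real.sin_arccos, hs, abs_of_nonpos hS, neg_neg]

/-- The dihedral angle in terms of an orthonormal basis `f, g` of the orthogonal complement of
the edge. -/
lemma exists_isDihedralAngle {P : Vertex → E4} {u v w : Vertex} {f g : E4}
    (hff : inner ℝ f f = (1 : ℝ)) (hgg : inner ℝ g g = (1 : ℝ)) (hfg : inner ℝ f g = (0 : ℝ))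
    (hfu : inner ℝ f (P u) = (0 : ℝ)) (hfv : inner ℝ f (P v) = (0 : ℝ))
    (hgu : inner ℝ g (P u) = (0 : ℝ)) (hgv : inner ℝ g (P v) = (0 : ℝ))
    {κ : ℝ} (hκ : κ ^ 2 = 1) (hdet : 0 < κ * orient u v w * det4 (P u) f (P v) g)
    {C₁ S₁ C₂ S₂ r₁ s₁ ρ₁ r₂ s₂ ρ₂ : ℝ} (h₁ : C₁ ^ 2 + S₁ ^ 2 = 1) (h₂ : C₂ ^ 2 + S₂ ^ 2 = 1)
    (hρ₁ : 0 < ρ₁) (hρ₂ : 0 < ρ₂)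
    (hw₁ : P w = r₁ • P u + s₁ • P v + ρ₁ • (C₁ • f + S₁ • g))
    (hw₂ : P (opp w) = r₂ • P u + s₂ • P v + ρ₂ • (C₂ • f + S₂ • g)) :
    ∃ φ, IsDihedralAngle P u v w φ ∧ Real.cos φ = C₁ * C₂ + S₁ * S₂ ∧
      Real.sin φ = κ * (C₁ * S₂ - S₁ * C₂) := by
  obtain ⟨φ, hc, hs⟩ := exists_angle (C := C₁ * C₂ + S₁ * S₂) (S := κ * (C₁ * S₂ - S₁ * C₂)) (by
    linear_combination (C₁ * S₂ - S₁ * C₂) ^ 2 * hκ + (C₂ ^ 2 + S₂ ^ 2) * h₁ + h₂)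
  have hgf : inner ℝ g f = (0 : ℝ) := by rw [real_inner_comm]; exact hfg
  have unit : ∀ C S : ℝ, C ^ 2 + S ^ 2 = 1 → ‖C • f + S • g‖ = 1 := fun C S h => by
    rw [norm_eq_one_iff_inner]
    simp only [inner_add_left, inner_add_right, inner_smul_right, real_inner_smul_left, hff, hgg,
      hfg, hgf]
    linarith
  have orth_u : ∀ C S : ℝ, inner ℝ (C • f + S • g) (P u) = (0 : ℝ) := fun C S => by
    simp [inner_add_left, real_inner_smul_left, hfu, hgu]
  have orth_v : ∀ C S : ℝ, inner ℝ (C • f + S • g) (P v) = (0 : ℝ) := fun C S => by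
    simp [inner_add_left, real_inner_smul_left, hfv, hgv]
  -- The exterior normal is the inner normal turned by a right angle in the plane of `f`, `g`; the
  -- sign `κ` selects the direction prescribed by the orientation.
  refine ⟨φ, ⟨(κ * S₁) • f + (-κ * C₁) • g, C₁ • f + S₁ • g, C₂ • f + S₂ • g,
    ⟨unit _ _ ?_, orth_u _ _, orth_v _ _, ?_, ?_⟩, ⟨unit _ _ h₁, orth_u _ _, orth_v _ _,
    r₁, s₁, ρ₁, hρ₁, hw₁⟩, ⟨unit _ _ h₂, orth_u _ _, orth_v _ _, r₂, s₂, ρ₂, hρ₂, hw₂⟩, ?_⟩,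
    hc, hs⟩
  · linear_combination (S₁ ^ 2 + C₁ ^ 2) * hκ + h₁
  · rw [hw₁, inner_add_right, inner_add_right, inner_smul_right, inner_smul_right, orth_u, orth_v,
      inner_smul_right]
    simp only [inner_add_left, inner_add_right, inner_smul_right, real_inner_smul_left, hff, hgg,
      hfg, hgf]
    ring
  · rw [hw₁, det4_add_smul]
    have e : det4 (P u) ((κ * S₁) • f + (-κ * C₁) • g) (P v) (C₁ • f + S₁ • g) =
        κ * det4 (P u) f (P v) g := by
      have : det4 (P u) ((κ * S₁) • f + (-κ * C₁) • g) (P v) (C₁ • f + S₁ • g) =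
          κ * (C₁ ^ 2 + S₁ ^ 2) * det4 (P u) f (P v) g := by
        simp only [det4_eq, PiLp.add_apply, PiLp.smul_apply, smul_eq_mul]
        ring
      rw [this, h₁, mul_one]
    rw [e]
    have : orient u v w * (ρ₁ * (κ * det4 (P u) f (P v) g)) =
      ρ₁ * (κ * orient u v w * det4 (P u) f (P v) g) := by ring
    rw [this]
    positivity
  · rw [hc, hs]
    have e1 : (C₁ * C₂ + S₁ * S₂) * C₁ - κ * (C₁ * S₂ - S₁ * C₂) * (κ * S₁) = C₂ := by
      linear_combination (-(C₁ * S₂ - S₁ * C₂) * S₁) * hκ + C₂ * h₁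
    have e2 : (C₁ * C₂ + S₁ * S₂) * S₁ - κ * (C₁ * S₂ - S₁ * C₂) * (-κ * C₁) = S₂ := by
      linear_combination ((C₁ * S₂ - S₁ * C₂) * C₁) * hκ + S₂ * h₁
    calc C₂ • f + S₂ • g = ((C₁ * C₂ + S₁ * S₂) * C₁ - κ * (C₁ * S₂ - S₁ * C₂) * (κ * S₁)) • f +
          ((C₁ * C₂ + S₁ * S₂) * S₁ - κ * (C₁ * S₂ - S₁ * C₂) * (-κ * C₁)) • g := by rw [e1, e2]
      _ = _ := by module

/-- Both sin φ/(1 + cos φ) and (1 − cos φ)/sin φ represent tan(φ/2), but each degenerates at one of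
φ = π, φ = 0. Combining the two with weights cos(φ/2) and sin(φ/2) covers all angles. -/
lemma isRep_halfTan_of {φ : ℝ} {v : Fin 2 → ℝ}
    (h1 : v 0 * (1 + Real.cos φ) = v 1 * Real.sin φ)
    (h2 : v 0 * Real.sin φ = v 1 * (1 - Real.cos φ)) : IsRep (halfTan φ) v := by
  refine (isRep_halfTan φ).of_parallel (sin_cos_vec_ne_zero _) ?_
  simp only [Matrix.cons_val_zero, Matrix.cons_val_one]
  have hc : Real.cos φ = 2 * Real.cos (φ / 2) ^ 2 - 1 := by
    rw [← Real.cos_two_mul]; congr 1; ring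
  have hs : Real.sin φ = 2 * Real.sin (φ / 2) * Real.cos (φ / 2) := by
    rw [← Real.sin_two_mul]; congr 1; ring
  have hsc := Real.sin_sq_add_cos_sq (φ / 2)
  rw [hc, hs] at h1 h2
  linear_combination (-1 / 2 * Real.cos (φ / 2)) * h1 - (1 / 2 * Real.sin (φ / 2)) * h2
    + (Real.cos (φ / 2) * v 0) * hsc

/-! ### The octahedron attached to a point of the curve -/

/-- The octahedron with the data `y`, in the position with the first two coordinates spanned by
the vertices of index `1` and the last two ones by the vertices of index `2`. -/
noncomputable def octPos (p q : Bool → ℝ) (c s : ℝ) (y : Bool × Bool → ℝ) : Vertex → E4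
  | (0, i) => !₂[p i / c, y (false, i) / c, 0, 0]
  | (1, j) => !₂[0, 0, q j / s, y (true, j) / s]
  | (2, k) => !₂[c, 0, sg k * s, 0]

/-- The octahedron attached to a point of the curve. -/
noncomputable def oct (p q : Bool → ℝ) (y : Bool × Bool → ℝ) : Vertex → E4 :=
  octPos p q (√(y (false, false) ^ 2 + p false ^ 2)) (√(y (true, false) ^ 2 + q false ^ 2)) y

/-- The edge lengths `ℓ` are those of the proposition. -/
structure Lens (ℓ : Edge → ℝ) (p q : Bool → ℝ) : Prop where
  pos : ∀ e, 0 < ℓ e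
  lt_pi : ∀ e, ℓ e < Real.pi
  cosAB : ∀ i j, Real.cos (ℓ (eAB i j)) = 0
  cosAC : ∀ i k, Real.cos (ℓ (eAC i k)) = p i
  cosBC : ∀ j k, Real.cos (ℓ (eBC j k)) = sg k * q j

lemma angle_eq_iff_inner {x y : E4} {l : ℝ} (hx : ‖x‖ = 1) (hy : ‖y‖ = 1) (h0 : 0 < l)
    (h1 : l < Real.pi) :
    InnerProductGeometry.angle x y = l ↔ inner ℝ x y = Real.cos l := by
  have h := InnerProductGeometry.cos_angle x y
  rw [hx, hy, mul_one, div_one] at h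
  rw [← h]
  constructor
  · intro h; rw [h]
  · exact fun h => Real.injOn_cos ⟨InnerProductGeometry.angle_nonneg x y,
      InnerProductGeometry.angle_le_pi x y⟩ ⟨h0.le, h1.le⟩ h

lemma Lens.hasEdgeLengths_iff {ℓ : Edge → ℝ} {p q : Bool → ℝ} (L : Lens ℓ p q)
    {P : Vertex → E4} : HasEdgeLengths ℓ P ↔ (∀ u, inner ℝ (P u) (P u) = (1 : ℝ)) ∧
      (∀ i j, inner ℝ (P (0, i)) (P (1, j)) = (0 : ℝ)) ∧
      (∀ i k, inner ℝ (P (0, i)) (P (2, k)) = p i) ∧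
      (∀ j k, inner ℝ (P (1, j)) (P (2, k)) = sg k * q j) := by
  constructor
  · rintro ⟨h1, h2⟩
    have key : ∀ u v (h : u.1 ≠ v.1), inner ℝ (P u) (P v) = Real.cos (ℓ (edge u v h)) :=
      fun u v h => (angle_eq_iff_inner (h1 u) (h1 v) (L.pos _) (L.lt_pi _)).1 (h2 u v h)
    refine ⟨fun u => norm_eq_one_iff_inner.1 (h1 u), fun i j => ?_, fun i k => ?_, fun j k => ?_⟩
    · rw [key _ _ (by simp)]; exact L.cosAB i j
    · rw [key _ _ (by simp)]; exact L.cosAC i k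
    · rw [key _ _ (by simp)]; exact L.cosBC j k
  · rintro ⟨h0, h1, h2, h3⟩
    have hn : ∀ u, ‖P u‖ = 1 := fun u => norm_eq_one_iff_inner.2 (h0 u)
    refine ⟨hn, fun u v h => ?_⟩
    rw [angle_eq_iff_inner (hn u) (hn v) (L.pos _) (L.lt_pi _)]
    obtain ⟨u, i⟩ := u
    obtain ⟨v, j⟩ := v
    fin_cases u <;> fin_cases v
    · exact absurd rfl h
    · exact (h1 i j).trans (L.cosAB i j).symm
    · exact (h2 i j).trans (L.cosAC i j).symm
    · rw [real_inner_comm, edge_comm]; exact (h1 j i).trans (L.cosAB j i).symm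
    · exact absurd rfl h
    · exact (h3 i j).trans (L.cosBC i j).symm
    · rw [real_inner_comm, edge_comm]; exact (h2 j i).trans (L.cosAC j i).symm
    · rw [real_inner_comm, edge_comm]; exact (h3 j i).trans (L.cosBC j i).symm
    · exact absurd rfl h

/-- The two systems of homogeneous coordinates of the tangent of half of the angle with given
cosine and sine. -/
lemma isRep_halfTan_pair {φ ς lam P Y Z₁ Z₂ q₁ q₂ Q₁ Q₂ s : ℝ} (hς : ς ^ 2 = 1) (hP : P ≠ 0)
    (hs : s ≠ 0) (hQ₁ : Q₁ ≠ 0) (hQ₂ : Q₂ ≠ 0) (eQ₁ : Q₁ ^ 2 = P ^ 2 - q₁ ^ 2)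
    (eQ₂ : Q₂ ^ 2 = P ^ 2 - q₂ ^ 2) (eY : Y ^ 2 = P ^ 2 - s ^ 2) (eZ₁ : Z₁ ^ 2 = s ^ 2 - q₁ ^ 2)
    (eZ₂ : Z₂ ^ 2 = s ^ 2 - q₂ ^ 2) (hl : lam = ς * (Q₁ * q₂ - q₁ * Q₂) / P)
    (hc : Real.cos φ = (Z₁ * Z₂ * P ^ 2 + Y ^ 2 * q₁ * q₂) / (s ^ 2 * Q₁ * Q₂))
    (hsin : Real.sin φ = ς * P * Y * (Z₁ * q₂ - Z₂ * q₁) / (s ^ 2 * Q₁ * Q₂)) :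
    IsRep (halfTan φ) ![lam * Y, Q₂ * Z₁ + Q₁ * Z₂] ∧
    IsRep (halfTan φ) ![lam * (Q₂ * Z₁ - Q₁ * Z₂), (q₂ ^ 2 - q₁ ^ 2) * Y] := by
  -- Only the square of Q₁ is constrained, so the identities are stated for either root: replacing
  -- Q₁ by −Q₁ turns the identities for the first system of coordinates into those for the second.
  have ident1 : ∀ Q₁ : ℝ, Q₁ ^ 2 = P ^ 2 - q₁ ^ 2 →
      (Q₁ * q₂ - q₁ * Q₂) * (s ^ 2 * Q₁ * Q₂ + (Z₁ * Z₂ * P ^ 2 + Y ^ 2 * q₁ * q₂)) =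
        (Q₂ * Z₁ + Q₁ * Z₂) * P ^ 2 * (Z₁ * q₂ - Z₂ * q₁) := fun Q₁ eQ₁ => by
    linear_combination (Q₁ * q₂ - q₁ * Q₂) * q₁ * q₂ * eY - P ^ 2 * Q₂ * q₂ * eZ₁
      + P ^ 2 * Q₁ * q₁ * eZ₂ + s ^ 2 * Q₂ * q₂ * eQ₁ - s ^ 2 * q₁ * Q₁ * eQ₂
  have ident2 : ∀ Q₁ : ℝ, Q₁ ^ 2 = P ^ 2 - q₁ ^ 2 →
      (Q₁ * q₂ - q₁ * Q₂) * Y ^ 2 * (Z₁ * q₂ - Z₂ * q₁) =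
        (Q₂ * Z₁ + Q₁ * Z₂) * (s ^ 2 * Q₁ * Q₂ - (Z₁ * Z₂ * P ^ 2 + Y ^ 2 * q₁ * q₂)) :=
    fun Q₁ eQ₁ => by
    linear_combination (Z₁ * q₂ ^ 2 * Q₁ + Z₂ * q₁ ^ 2 * Q₂) * eY + Q₁ * P ^ 2 * Z₁ * eZ₂
      + Q₂ * P ^ 2 * Z₂ * eZ₁ - s ^ 2 * Q₁ * Z₁ * eQ₂ - s ^ 2 * Q₂ * Z₂ * eQ₁
  have i1 := ident1 Q₁ eQ₁
  have i2 := ident2 Q₁ eQ₁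
  have i3 := ident1 (-Q₁) (by rw [neg_sq]; exact eQ₁)
  have i4 := ident2 (-Q₁) (by rw [neg_sq]; exact eQ₁)
  have hD : (Q₁ * q₂ - q₁ * Q₂) * (Q₁ * q₂ + q₁ * Q₂) = P ^ 2 * (q₂ ^ 2 - q₁ ^ 2) := by
    linear_combination q₂ ^ 2 * eQ₁ - q₁ ^ 2 * eQ₂
  constructor
  · apply isRep_halfTan_of <;>
      simp only [Matrix.cons_val_zero, Matrix.cons_val_one, hl, hc, hsin] <;> field_simp
    · linear_combination ς * Y * i1
    · linear_combination (Q₁ * q₂ - q₁ * Q₂) * Y ^ 2 * (q₂ * Z₁ - q₁ * Z₂) * hς + i2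
  · apply isRep_halfTan_of <;>
      simp only [Matrix.cons_val_zero, Matrix.cons_val_one, hl, hc, hsin] <;> field_simp
    · linear_combination ς * ((Q₁ * q₂ - q₁ * Q₂) * i4 + Y ^ 2 * (Z₁ * q₂ - Z₂ * q₁) * hD)
    · apply mul_left_cancel₀ (pow_ne_zero 2 hP)
      linear_combination
        P ^ 2 * (Q₁ * q₂ - q₁ * Q₂) * (Q₂ * Z₁ - Q₁ * Z₂) * Y * (q₂ * Z₁ - q₁ * Z₂) * hς
        - Y * (Q₁ * q₂ - q₁ * Q₂) * i3
        + Y * (s ^ 2 * Q₁ * Q₂ - (Z₁ * Z₂ * P ^ 2 + Y ^ 2 * q₁ * q₂)) * hD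

/-! ### Dihedral angles of the octahedron in standard position -/

section Position

variable {p q : Bool → ℝ} {c s : ℝ} {y : Bool × Bool → ℝ} (H : Params p q)
  (hc : 0 < c) (hs : 0 < s) (hcs : c ^ 2 + s ^ 2 = 1)
  (hcy : ∀ i, c ^ 2 = y (false, i) ^ 2 + p i ^ 2) (hsy : ∀ j, s ^ 2 = y (true, j) ^ 2 + q j ^ 2)
include hc hs hcs hcy hsy

lemma octPos_hasEdgeLengths {ℓ : Edge → ℝ} (L : Lens ℓ p q) :
    HasEdgeLengths ℓ (octPos p q c s y) := by
  rw [L.hasEdgeLengths_iff]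
  refine ⟨?_, ?_, ?_, ?_⟩
  · rintro ⟨u, i⟩
    rw [inner_E4]
    fin_cases u <;> simp [octPos] <;> field_simp
    · linarith [hcy i]
    · linarith [hsy i]
    · linear_combination hcs + s ^ 2 * sg_sq i
  · intro i j
    rw [inner_E4]; simp [octPos]
  · intro i j
    rw [inner_E4]; simp [octPos]
    field_simp
  · intro i j
    rw [inner_E4]; simp [octPos]
    field_simp

include H

/-- The plane normal to the edge `Aᵢ Bⱼ` is spanned by `f`, perpendicular to `Aᵢ` in the first
coordinate plane, and `g`, perpendicular to `Bⱼ` in the second. The components of a₃ and b₃ in it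
are symmetric about the axis `f`, so the tangent of half the angle is Zⱼ/Yᵢ up to sign. -/
lemma octPos_dihedral_AB (i j : Bool) : ∃ φ,
    IsDihedralAngle (octPos p q c s y) (0, i) (1, j) (2, false) φ ∧
      IsRep (halfTan φ) (repAB y i j) := by
  have hQ := H.Q_pos i j
  have eQ := H.Q_sq i j
  have hQ2 : Q p q i j ^ 2 = y (false, i) ^ 2 + y (true, j) ^ 2 := by
    linarith [hcy i, hsy j]
  have hor : orient (0, i) (1, j) (2, false) = sg i * sg j := by
    cases i <;> cases j <;> simp [orient]
  obtain ⟨φ, h1, h2, h3⟩ := exists_isDihedralAngle (P := octPos p q c s y) (u := (0, i))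
    (v := (1, j)) (w := (2, false)) (f := !₂[-y (false, i) / c, p i / c, 0, 0])
    (g := !₂[0, 0, -y (true, j) / s, q j / s]) (κ := sg i * sg j)
    (C₁ := -y (false, i) / Q p q i j) (S₁ := -y (true, j) / Q p q i j)
    (C₂ := -y (false, i) / Q p q i j) (S₂ := y (true, j) / Q p q i j)
    (r₁ := p i) (r₂ := p i) (s₁ := q j) (s₂ := -q j) (ρ₁ := Q p q i j) (ρ₂ := Q p q i j)
    (by rw [inner_E4]; simp; field_simp; linarith [hcy i])
    (by rw [inner_E4]; simp; field_simp; linarith [hsy j])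
    (by rw [inner_E4]; simp)
    (by rw [inner_E4]; simp [octPos]; field_simp; ring)
    (by rw [inner_E4]; simp [octPos])
    (by rw [inner_E4]; simp [octPos])
    (by rw [inner_E4]; simp [octPos]; field_simp; ring)
    (by linear_combination (sg i ^ 2) * sg_sq j + sg_sq i)
    (by
      rw [hor, det4_eq]
      simp [octPos]
      field_simp
      rw [sg_sq, sg_sq, show q j ^ 2 - -y (true, j) ^ 2 = s ^ 2 by linarith [hsy j],
        show p i ^ 2 - -y (false, i) ^ 2 = c ^ 2 by linarith [hcy i]]
      have : 0 < s ^ 2 * c ^ 2 := by positivity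
      linarith)
    (by field_simp; linarith) (by field_simp; linarith) hQ hQ
    (by
      apply ext_E4 <;> simp [octPos] <;> field_simp
      · linarith [hcy i]
      · ring
      · linarith [hsy j]
      · ring)
    (by
      apply ext_E4 <;> simp [octPos, opp] <;> field_simp
      · linarith [hcy i]
      · ring
      · linarith [hsy j]
      · ring)
  refine ⟨φ, h1, isRep_halfTan_of ?_ ?_⟩
  · rw [h2, h3]
    simp only [repAB, Matrix.cons_val_zero, Matrix.cons_val_one, smul_eq_mul]
    field_simp
    linear_combination (-(sg i * sg j * y (true, j))) * hQ2
  · rw [h2, h3]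
    simp only [repAB, Matrix.cons_val_zero, Matrix.cons_val_one, smul_eq_mul]
    field_simp
    have hσ : sg i ^ 2 * sg j ^ 2 = 1 := by rw [sg_sq, sg_sq, one_mul]
    linear_combination 2 * y (true, j) ^ 2 * y (false, i) * hσ - y (false, i) * hQ2

/-- The edge lies in the hyperplane where the last coordinate is 0, so `f` is the last basis vector
and `g` completes it to a frame of the normal plane. The number P is the sine of the edge length,
and `hw` decomposes both vertices `Bⱼ` along the edge and this frame. -/
lemma octPos_dihedral_AC (i η : Bool) : ∃ φ,
    IsDihedralAngle (octPos p q c s y) (0, i) (2, η) (1, false) φ ∧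
      ∀ k, IsRep (halfTan φ) (repAC p q k y i η) := by
  have hQ1 := H.Q_pos i false
  have hQ2 := H.Q_pos i true
  have hP : 0 < √(1 - p i ^ 2) := Real.sqrt_pos.2 (H.one_sub_p_pos i)
  have eP : √(1 - p i ^ 2) ^ 2 = 1 - p i ^ 2 := Real.sq_sqrt (H.one_sub_p_pos i).le
  have eQ : ∀ j, Q p q i j ^ 2 = √(1 - p i ^ 2) ^ 2 - q j ^ 2 := fun j => by rw [H.Q_sq, eP]
  have hQ := H.Q_pos i
  have hl : lamA p q i η = (sg i * sg η) * (Q p q i false * q true - q false * Q p q i true) /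
    √(1 - p i ^ 2) := rfl
  generalize hPd : √(1 - p i ^ 2) = P at *
  have eY : y (false, i) ^ 2 = P ^ 2 - s ^ 2 := by linarith [hcy i]
  have eZ : ∀ j, y (true, j) ^ 2 = s ^ 2 - q j ^ 2 := fun j => by linarith [hsy j]
  have hη := sg_sq η
  have hor : orient (0, i) (2, η) (1, false) = -(sg i * sg η) := by
    cases i <;> cases η <;> simp [orient]
  have hw : ∀ j, octPos p q c s y (1, j) = (-(p i * sg η * q j) / P ^ 2) •
      octPos p q c s y (0, i) + (sg η * q j / P ^ 2) • octPos p q c s y (2, η) +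
      (Q p q i j / P) • ((y (true, j) * P / (s * Q p q i j)) • !₂[0, 0, 0, 1] +
      (-(y (false, i) * q j) / (s * Q p q i j)) •
        !₂[sg η * s * y (false, i) / (c * P), -(sg η * p i * s) / (c * P), -y (false, i) / P, 0]) := by
    intro j
    have := hQ j
    apply ext_E4 <;> simp [octPos] <;> field_simp
    · linear_combination (-(sg η * q j)) * hcy i
    · ring
    · linear_combination -q j * eY - q j * s ^ 2 * hη
  have hu : ∀ j, (y (true, j) * P / (s * Q p q i j)) ^ 2 +
      (-(y (false, i) * q j) / (s * Q p q i j)) ^ 2 = 1 := by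
    intro j
    have := hQ j
    field_simp
    linear_combination P ^ 2 * eZ j + q j ^ 2 * eY - s ^ 2 * eQ j
  obtain ⟨φ, h1, h2, h3⟩ := exists_isDihedralAngle (P := octPos p q c s y) (u := (0, i))
    (v := (2, η)) (w := (1, false)) (f := !₂[0, 0, 0, 1])
    (g := !₂[sg η * s * y (false, i) / (c * P), -(sg η * p i * s) / (c * P), -y (false, i) / P, 0])
    (κ := -(sg i * sg η))
    (by rw [inner_E4]; simp)
    (by
      rw [inner_E4]; simp; field_simp
      linear_combination s ^ 2 * (y (false, i) ^ 2 + p i ^ 2) * hη - s ^ 2 * hcy i + c ^ 2 * eY)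
    (by rw [inner_E4]; simp)
    (by rw [inner_E4]; simp [octPos])
    (by rw [inner_E4]; simp [octPos])
    (by rw [inner_E4]; simp [octPos]; field_simp; ring)
    (by rw [inner_E4]; simp [octPos]; field_simp; ring)
    (by linear_combination (sg i ^ 2) * sg_sq η + sg_sq i)
    (by
      rw [hor, det4_eq]
      simp [octPos]
      field_simp
      have h1 : p i ^ 2 * s ^ 2 + y (false, i) ^ 2 * s ^ 2 = c ^ 2 * s ^ 2 := by
        rw [hcy i]; ring
      have h2 : 0 < c ^ 2 * s ^ 2 := by positivity
      have h3 : 0 ≤ y (false, i) ^ 2 * c ^ 2 := by positivity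
      simp only [sg_sq]
      linarith)
    (hu false) (hu true) (div_pos (hQ false) hP) (div_pos (hQ true) hP) (hw false) (hw true)
  have := isRep_halfTan_pair (φ := φ) (ς := sg i * sg η) (lam := lamA p q i η)
    (P := P) (Y := y (false, i)) (Z₁ := y (true, false)) (Z₂ := y (true, true)) (q₁ := q false)
    (q₂ := q true) (Q₁ := Q p q i false) (Q₂ := Q p q i true) (s := s)
    (by linear_combination (sg i ^ 2) * sg_sq η + sg_sq i) hP.ne' hs.ne' hQ1.ne' hQ2.ne'
    (eQ false) (eQ true) eY (eZ false) (eZ true) hl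
    (by rw [h2]; field_simp)
    (by rw [h3]; field_simp; ring)
  refine ⟨φ, h1, fun k => ?_⟩
  cases k
  · exact this.1
  · exact this.2

/-- The same computation with the two planes exchanged. Now the sign of η occurs both in `κ` and in
the components along `g`, and the two occurrences cancel: the tangents at `Bⱼ a₃` and `Bⱼ b₃`
coincide. -/
lemma octPos_dihedral_BC (j η : Bool) : ∃ φ,
    IsDihedralAngle (octPos p q c s y) (1, j) (2, η) (0, false) φ ∧
      ∀ k, IsRep (halfTan φ) (repBC p q k y j) := by
  have hQ1 := H.Q_pos false j
  have hQ2 := H.Q_pos true j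
  have hP : 0 < √(1 - q j ^ 2) := Real.sqrt_pos.2 (H.one_sub_q_pos j)
  have eP : √(1 - q j ^ 2) ^ 2 = 1 - q j ^ 2 := Real.sq_sqrt (H.one_sub_q_pos j).le
  have eQ : ∀ i, Q p q i j ^ 2 = √(1 - q j ^ 2) ^ 2 - p i ^ 2 := fun i => by
    rw [H.Q_sq, eP]; ring
  have hQ := fun i => H.Q_pos i j
  have hl : lamB p q j = -sg j * (Q p q false j * p true - p false * Q p q true j) /
    √(1 - q j ^ 2) := rfl
  generalize hPd : √(1 - q j ^ 2) = P at *
  have eY : y (true, j) ^ 2 = P ^ 2 - c ^ 2 := by linarith [hsy j]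
  have eZ : ∀ i, y (false, i) ^ 2 = c ^ 2 - p i ^ 2 := fun i => by linarith [hcy i]
  have hη := sg_sq η
  have hor : orient (1, j) (2, η) (0, false) = sg j * sg η := by
    cases j <;> cases η <;> simp [orient]
  have hw : ∀ i, octPos p q c s y (0, i) = (-(p i * sg η * q j) / P ^ 2) •
      octPos p q c s y (1, j) + (p i / P ^ 2) • octPos p q c s y (2, η) +
      (Q p q i j / P) • ((y (false, i) * P / (c * Q p q i j)) • !₂[0, 1, 0, 0] +
      (-(sg η * y (true, j) * p i) / (c * Q p q i j)) •
        !₂[-(sg η * y (true, j)) / P, 0, c * y (true, j) / (s * P), -(q j * c) / (s * P)]) := by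
    intro i
    have := hQ i
    apply ext_E4 <;> simp [octPos] <;> field_simp
    · linear_combination -p i * eY - p i * y (true, j) ^ 2 * hη
    · linear_combination (-(p i * sg η)) * hsy j
    · ring
  have hu : ∀ i, (y (false, i) * P / (c * Q p q i j)) ^ 2 +
      (-(sg η * y (true, j) * p i) / (c * Q p q i j)) ^ 2 = 1 := by
    intro i
    have := hQ i
    field_simp
    linear_combination P ^ 2 * eZ i + p i ^ 2 * eY - c ^ 2 * eQ i + y (true, j) ^ 2 * p i ^ 2 * hη
  obtain ⟨φ, h1, h2, h3⟩ := exists_isDihedralAngle (P := octPos p q c s y) (u := (1, j))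
    (v := (2, η)) (w := (0, false)) (f := !₂[0, 1, 0, 0])
    (g := !₂[-(sg η * y (true, j)) / P, 0, c * y (true, j) / (s * P), -(q j * c) / (s * P)])
    (κ := sg j * sg η)
    (by rw [inner_E4]; simp)
    (by
      rw [inner_E4]; simp; field_simp
      linear_combination y (true, j) ^ 2 * s ^ 2 * hη - c ^ 2 * hsy j + s ^ 2 * eY)
    (by rw [inner_E4]; simp)
    (by rw [inner_E4]; simp [octPos])
    (by rw [inner_E4]; simp [octPos])
    (by rw [inner_E4]; simp [octPos]; field_simp; ring)
    (by rw [inner_E4]; simp [octPos]; field_simp; ring)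
    (by linear_combination (sg j ^ 2) * sg_sq η + sg_sq j)
    (by
      rw [hor, det4_eq]
      simp [octPos]
      field_simp
      have h1 : q j ^ 2 * c ^ 2 + y (true, j) ^ 2 * c ^ 2 = s ^ 2 * c ^ 2 := by
        rw [hsy j]; ring
      have h2 : 0 < s ^ 2 * c ^ 2 := by positivity
      have h3 : 0 ≤ y (true, j) ^ 2 * s ^ 2 := by positivity
      simp only [sg_sq]
      linarith)
    (hu false) (hu true) (div_pos (hQ false) hP) (div_pos (hQ true) hP) (hw false) (hw true)
  have := isRep_halfTan_pair (φ := φ) (ς := -sg j) (lam := lamB p q j)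
    (P := P) (Y := y (true, j)) (Z₁ := y (false, false)) (Z₂ := y (false, true)) (q₁ := p false)
    (q₂ := p true) (Q₁ := Q p q false j) (Q₂ := Q p q true j) (s := c)
    (by rw [neg_sq, sg_sq]) hP.ne' hc.ne' hQ1.ne' hQ2.ne'
    (eQ false) (eQ true) eY (eZ false) (eZ true) hl
    (by
      rw [h2]; field_simp
      linear_combination y (true, j) ^ 2 * p false * p true * hη)
    (by
      rw [h3]; field_simp
      linear_combination sg j * y (true, j) * (y (false, true) * p false
        - y (false, false) * p true) * hη)
  refine ⟨φ, h1, fun k => ?_⟩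
  cases k
  · exact this.1
  · exact this.2

lemma octPos_isConfigOf {ℓ : Edge → ℝ} (L : Lens ℓ p q) :
    IsConfigOf ℓ (octPos p q c s y) (phi p q y) := by
  have hy : OnCurve p q y := fun i j => by linarith [hcy i, hsy j]
  refine ⟨octPos_hasEdgeLengths hc hs hcs hcy hsy L, ?_⟩
  -- An angle does not depend on the order of the ends of its edge nor on which adjacent face comes
  -- first, so one computation per edge suffices.
  have full : ∀ (u v : Vertex) (k : Fin 3) (huv : u.1 ≠ v.1),
      (∃ φ, IsDihedralAngle (octPos p q c s y) u v (k, false) φ ∧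
        phi p q y (edge u v huv) = halfTan φ) → ∀ b, ∃ φ,
      IsDihedralAngle (octPos p q c s y) u v (k, b) φ ∧ phi p q y (edge u v huv) = halfTan φ := by
    rintro u v k huv ⟨φ, h1, h2⟩ b
    cases b
    · exact ⟨φ, h1, h2⟩
    · exact ⟨φ, h1.opp, h2⟩
  have swap : ∀ (u v w : Vertex) (huv : u.1 ≠ v.1),
      (∃ φ, IsDihedralAngle (octPos p q c s y) u v w φ ∧
        phi p q y (edge u v huv) = halfTan φ) → ∃ φ,
      IsDihedralAngle (octPos p q c s y) v u w φ ∧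
        phi p q y (edge v u huv.symm) = halfTan φ := by
    rintro u v w huv ⟨φ, h1, h2⟩
    exact ⟨φ, h1.swap huv, by rw [edge_comm]; exact h2⟩
  have hAB : ∀ i j b, ∃ φ, IsDihedralAngle (octPos p q c s y) (0, i) (1, j) (2, b) φ ∧
      phi p q y (eAB i j) = halfTan φ := fun i j => full _ _ _ (by simp) (by
    obtain ⟨φ, h1, h2⟩ := octPos_dihedral_AB H hc hs hcs hcy hsy i j
    exact ⟨φ, h1, (hy.eq_phi H fun k => h2).symm⟩)
  have hAC : ∀ i j b, ∃ φ, IsDihedralAngle (octPos p q c s y) (0, i) (2, j) (1, b) φ ∧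
      phi p q y (eAC i j) = halfTan φ := fun i j => full _ _ _ (by simp) (by
    obtain ⟨φ, h1, h2⟩ := octPos_dihedral_AC H hc hs hcs hcy hsy i j
    exact ⟨φ, h1, (hy.eq_phi H fun k => h2 k).symm⟩)
  have hBC : ∀ i j b, ∃ φ, IsDihedralAngle (octPos p q c s y) (1, i) (2, j) (0, b) φ ∧
      phi p q y (eBC i j) = halfTan φ := fun i j => full _ _ _ (by simp) (by
    obtain ⟨φ, h1, h2⟩ := octPos_dihedral_BC H hc hs hcs hcy hsy i j
    exact ⟨φ, h1, (hy.eq_phi H fun k => h2 k).symm⟩)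
  rintro ⟨u, i⟩ ⟨v, j⟩ ⟨w, b⟩ huv huw hvw
  fin_cases u <;> fin_cases v <;> fin_cases w <;>
    first
    | exact absurd rfl huv
    | exact absurd rfl huw
    | exact absurd rfl hvw
    | exact hAB i j b
    | exact hAC i j b
    | exact hBC i j b
    | exact swap _ _ _ _ (hAB j i b)
    | exact swap _ _ _ _ (hAC j i b)
    | exact swap _ _ _ _ (hBC j i b)

end Position

section Curve

variable {p q : Bool → ℝ} {y : Bool × Bool → ℝ} (H : Params p q) (hy : OnCurve p q y)
include hy

lemma OnCurve.sq_A (i : Bool) :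
    y (false, false) ^ 2 + p false ^ 2 = y (false, i) ^ 2 + p i ^ 2 := by
  linarith [hy false false, hy i false]

lemma OnCurve.sq_B (j : Bool) :
    y (true, false) ^ 2 + q false ^ 2 = y (true, j) ^ 2 + q j ^ 2 := by
  linarith [hy false false, hy false j]

include H

lemma OnCurve.cos_sq_pos : 0 < y (false, false) ^ 2 + p false ^ 2 := by
  have := pow_pos (abs_pos.2 (hy.A_ne_zero H)) 2
  rw [sq_abs] at this
  positivity

lemma OnCurve.sin_sq_pos : 0 < y (true, false) ^ 2 + q false ^ 2 := by
  have := pow_pos (abs_pos.2 (hy.B_ne_zero H)) 2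
  rw [sq_abs] at this
  positivity

lemma OnCurve.isConfigOf {ℓ : Edge → ℝ} (L : Lens ℓ p q) :
    IsConfigOf ℓ (oct p q y) (phi p q y) := by
  have h1 := hy.cos_sq_pos H
  have h2 := hy.sin_sq_pos H
  have e1 := Real.sq_sqrt h1.le
  have e2 := Real.sq_sqrt h2.le
  refine octPos_isConfigOf H (Real.sqrt_pos.2 h1) (Real.sqrt_pos.2 h2) ?_ (fun i => ?_)
    (fun j => ?_) L
  · rw [e1, e2]; linarith [hy false false]
  · rw [e1]; exact hy.sq_A i
  · rw [e2]; exact hy.sq_B j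

end Curve

/-! ### Rotations -/

lemma det4_eq_basis_det (x y z w : E4) :
    det4 x y z w = (EuclideanSpace.basisFun (Fin 4) ℝ).toBasis.det ![x, y, z, w] := by
  rw [Module.Basis.det_apply, ← Matrix.det_transpose]
  have h : det4 x y z w = Matrix.det (Matrix.of fun i j : Fin 4 => (![x, y, z, w] i) j) := rfl
  rw [h]
  congr 1

lemma det4_map (R : E4 →ₗ[ℝ] E4) (x y z w : E4) :
    det4 (R x) (R y) (R z) (R w) = LinearMap.det R * det4 x y z w := by
  rw [det4_eq_basis_det, det4_eq_basis_det, ← Module.Basis.det_comp]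
  congr 1
  funext i
  fin_cases i <;> rfl

/-- An orthonormal frame is the image of the standard one under an isometry. -/
lemma exists_isometry_of_orthonormal {f : Fin 4 → E4} (hf : Orthonormal ℝ f) :
    ∃ R : E4 ≃ₗᵢ[ℝ] E4, (∀ x : E4, R x = x 0 • f 0 + x 1 • f 1 + x 2 • f 2 + x 3 • f 3) ∧
      LinearMap.det (R.toLinearEquiv : E4 →ₗ[ℝ] E4) = det4 (f 0) (f 1) (f 2) (f 3) ∧
      (det4 (f 0) (f 1) (f 2) (f 3) = 1 ∨ det4 (f 0) (f 1) (f 2) (f 3) = -1) ∧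
      ∀ v : E4, v = inner ℝ (f 0) v • f 0 + inner ℝ (f 1) v • f 1 + inner ℝ (f 2) v • f 2 +
        inner ℝ (f 3) v • f 3 := by
  have hcard : Fintype.card (Fin 4) = Module.finrank ℝ E4 := by simp
  have hcoe : ⇑(basisOfOrthonormalOfCardEqFinrank hf hcard) = f :=
    coe_basisOfOrthonormalOfCardEqFinrank hf hcard
  set b := (basisOfOrthonormalOfCardEqFinrank hf hcard).toOrthonormalBasis (by rw [hcoe]; exact hf)
    with hb
  have hbf : ⇑b = f := by rw [hb, Module.Basis.coe_toOrthonormalBasis, hcoe]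
  have hR : ∀ x : E4, b.repr.symm x = x 0 • f 0 + x 1 • f 1 + x 2 • f 2 + x 3 • f 3 := fun x => by
    rw [← b.sum_repr_symm, Fin.sum_univ_four, hbf]
  have hd : det4 (f 0) (f 1) (f 2) (f 3) =
      (EuclideanSpace.basisFun (Fin 4) ℝ).toBasis.det b := by
    rw [det4_eq_basis_det, hbf]
    congr 1
    exact funext fun i => by fin_cases i <;> rfl
  refine ⟨b.repr.symm, hR, ?_, ?_, fun v => ?_⟩
  · rw [hd]
    have h1 := Module.Basis.det_comp (EuclideanSpace.basisFun (Fin 4) ℝ).toBasis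
      (b.repr.symm.toLinearEquiv : E4 →ₗ[ℝ] E4) (EuclideanSpace.basisFun (Fin 4) ℝ).toBasis
    rw [Module.Basis.det_self, mul_one] at h1
    rw [← h1]
    congr 1
  · rw [hd]
    exact (EuclideanSpace.basisFun (Fin 4) ℝ).det_to_matrix_orthonormalBasis_real b
  · conv_lhs => rw [← b.sum_repr v]
    simp only [Fin.sum_univ_four, b.repr_apply_apply, hbf]

lemma IsInnerNormal.map {x y z n : E4} (R : E4 ≃ₗᵢ[ℝ] E4) (h : IsInnerNormal x y z n) :
    IsInnerNormal (R x) (R y) (R z) (R n) := by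
  obtain ⟨h1, h2, h3, r, s, c, hc, hz⟩ := h
  refine ⟨by rw [R.norm_map, h1], by rw [R.inner_map_map, h2], by rw [R.inner_map_map, h3],
    r, s, c, hc, ?_⟩
  rw [hz]
  simp

lemma IsDihedralAngle.map {P : Vertex → E4} {u v w : Vertex} {φ : ℝ} (R : E4 ≃ₗᵢ[ℝ] E4)
    (hR : LinearMap.det (R.toLinearEquiv : E4 →ₗ[ℝ] E4) = 1) (h : IsDihedralAngle P u v w φ) :
    IsDihedralAngle (fun u => R (P u)) u v w φ := by
  obtain ⟨m, n₁, n₂, ⟨h1, h2, h3, h4, h5⟩, hn₁, hn₂, he⟩ := h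
  refine ⟨R m, R n₁, R n₂, ⟨by rw [R.norm_map, h1], by rw [R.inner_map_map, h2],
    by rw [R.inner_map_map, h3], by rw [R.inner_map_map, h4], ?_⟩, hn₁.map R, hn₂.map R, ?_⟩
  · have := det4_map (R.toLinearEquiv : E4 →ₗ[ℝ] E4) (P u) m (P v) (P w)
    rw [hR, one_mul] at this
    rw [← this] at h5
    exact h5
  · rw [he]; simp

lemma IsConfigOf.map {ℓ : Edge → ℝ} {P : Vertex → E4} {t : Conf} (R : E4 ≃ₗᵢ[ℝ] E4)
    (hR : LinearMap.det (R.toLinearEquiv : E4 →ₗ[ℝ] E4) = 1) (h : IsConfigOf ℓ P t) :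
    IsConfigOf ℓ (fun u => R (P u)) t := by
  refine ⟨⟨fun u => by rw [R.norm_map, h.1.1], fun u v huv => ?_⟩, fun u v w huv huw hvw => ?_⟩
  · rw [← h.1.2 u v huv]
    exact R.toLinearIsometry.angle_map _ _
  · obtain ⟨φ, h1, h2⟩ := h.2 u v w huv huw hvw
    exact ⟨φ, h1.map R hR, h2⟩

/-! ### Classification of the octahedra with the given edge lengths -/

lemma orthonormal_four {f : Fin 4 → E4} (h : ∀ i, inner ℝ (f i) (f i) = (1 : ℝ))
    (h01 : inner ℝ (f 0) (f 1) = (0 : ℝ)) (h02 : inner ℝ (f 0) (f 2) = (0 : ℝ))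
    (h03 : inner ℝ (f 0) (f 3) = (0 : ℝ)) (h12 : inner ℝ (f 1) (f 2) = (0 : ℝ))
    (h13 : inner ℝ (f 1) (f 3) = (0 : ℝ)) (h23 : inner ℝ (f 2) (f 3) = (0 : ℝ)) :
    Orthonormal ℝ f := by
  refine ⟨fun i => norm_eq_one_iff_inner.2 (h i), fun i j hij => ?_⟩
  fin_cases i <;> fin_cases j <;> first | exact absurd rfl hij | assumption |
    (rw [real_inner_comm]; assumption)

/-- The frame consists of the normalized U and V together with the normalized components of a₁
orthogonal to U and of a₂ orthogonal to V. The coordinates of the vertices in it are those of `oct`.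
The sign δ of Y₁ may be prescribed by the choice of the second frame vector. -/
lemma exists_rotation_oct {p q : Bool → ℝ} (H : Params p q) {ℓ : Edge → ℝ} (L : Lens ℓ p q)
    {P : Vertex → E4} (hP : HasEdgeLengths ℓ P) {δ : ℝ} (hδ : δ ^ 2 = 1) :
    ∃ (y : Bool × Bool → ℝ) (R : E4 ≃ₗᵢ[ℝ] E4), OnCurve p q y ∧ 0 < δ * y (false, false) ∧
      LinearMap.det (R.toLinearEquiv : E4 →ₗ[ℝ] E4) = 1 ∧ ∀ u, P u = R (oct p q y u) := by
  obtain ⟨h0, hAB, hAC, hBC⟩ := L.hasEdgeLengths_iff.1 hP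
  have hBA : ∀ j i, inner ℝ (P (1, j)) (P (0, i)) = (0 : ℝ) := fun j i => by
    rw [real_inner_comm]; exact hAB i j
  have hCA : ∀ k i, inner ℝ (P (2, k)) (P (0, i)) = p i := fun j i => by
    rw [real_inner_comm]; exact hAC i j
  have hCB : ∀ k i, inner ℝ (P (2, k)) (P (1, i)) = sg k * q i := fun j i => by
    rw [real_inner_comm]; exact hBC i j
  obtain ⟨U, hU⟩ : ∃ U, U = (1 / 2 : ℝ) • (P (2, false) + P (2, true)) := ⟨_, rfl⟩
  obtain ⟨V, hV⟩ : ∃ V, V = (1 / 2 : ℝ) • (P (2, false) - P (2, true)) := ⟨_, rfl⟩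
  have hUA : ∀ i, inner ℝ U (P (0, i)) = p i := fun i => by
    rw [hU, real_inner_smul_left, inner_add_left, hCA, hCA]; ring
  have hUB : ∀ i, inner ℝ U (P (1, i)) = (0 : ℝ) := fun i => by
    rw [hU, real_inner_smul_left, inner_add_left, hCB, hCB]; simp
  have hVA : ∀ i, inner ℝ V (P (0, i)) = (0 : ℝ) := fun i => by
    rw [hV, real_inner_smul_left, inner_sub_left, hCA, hCA]; ring
  have hVB : ∀ i, inner ℝ V (P (1, i)) = q i := fun i => by
    rw [hV, real_inner_smul_left, inner_sub_left, hCB, hCB]; simp; ring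
  have hUV : inner ℝ U V = (0 : ℝ) := by
    rw [hU, hV]
    simp only [real_inner_smul_left, inner_smul_right, inner_add_left, inner_sub_right, h0]
    rw [real_inner_comm (P (2, true)) (P (2, false))]
    ring
  have hsum : inner ℝ U U + inner ℝ V V = (1 : ℝ) := by
    rw [hU, hV]
    simp only [real_inner_smul_left, inner_smul_right, inner_add_left, inner_add_right,
      inner_sub_left, inner_sub_right, h0]
    ring
  -- Cauchy–Schwarz for U and the unit vector b₁. With its analogue for V, it keeps both lengths
  -- positive and places cos² θ between p₂² and 1 − q₂².
  have hUU : p true ^ 2 ≤ inner ℝ U U := by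
    have := real_inner_mul_inner_self_le U (P (0, true))
    rw [hUA, h0] at this
    linarith
  have hVV : q true ^ 2 ≤ inner ℝ V V := by
    have := real_inner_mul_inner_self_le V (P (1, true))
    rw [hVB, h0] at this
    linarith
  obtain ⟨c, hc⟩ : ∃ c, c = √(inner ℝ U U) := ⟨_, rfl⟩
  obtain ⟨s, hs⟩ : ∃ s, s = √(inner ℝ V V) := ⟨_, rfl⟩
  have hpU := H.p_true_sq_pos.trans_le hUU
  have hpV := H.q_true_sq_pos.trans_le hVV
  have hc0 : 0 < c := hc ▸ Real.sqrt_pos.2 hpU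
  have hs0 : 0 < s := hs ▸ Real.sqrt_pos.2 hpV
  have ec : inner ℝ U U = c ^ 2 := by rw [hc, Real.sq_sqrt hpU.le]
  have es : inner ℝ V V = s ^ 2 := by rw [hs, Real.sq_sqrt hpV.le]
  rw [ec] at hUU
  rw [es] at hVV
  rw [ec, es] at hsum
  have hp := H.hp
  have hq := H.hq
  obtain ⟨Y, hY⟩ : ∃ Y, Y = δ * √(c ^ 2 - p false ^ 2) := ⟨_, rfl⟩
  obtain ⟨Z, hZ⟩ : ∃ Z, Z = √(s ^ 2 - q false ^ 2) := ⟨_, rfl⟩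
  have hYs : 0 < √(c ^ 2 - p false ^ 2) := Real.sqrt_pos.2 (by linarith)
  have hZ0 : 0 < Z := hZ ▸ Real.sqrt_pos.2 (by linarith)
  have hY2 : Y ^ 2 = c ^ 2 - p false ^ 2 := by
    rw [hY, mul_pow, hδ, one_mul, Real.sq_sqrt (by linarith)]
  have hZ2 : Z ^ 2 = s ^ 2 - q false ^ 2 := by rw [hZ, Real.sq_sqrt (by linarith)]
  have hδY : 0 < δ * Y := by rw [hY, ← mul_assoc, ← sq, hδ, one_mul]; exact hYs
  have hY0 : Y ≠ 0 := by rintro h; simp [h] at hδY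
  -- the orthonormal frame
  obtain ⟨f0, hf0⟩ : ∃ f, f = (1 / c) • U := ⟨_, rfl⟩
  obtain ⟨f2, hf2⟩ : ∃ f, f = (1 / s) • V := ⟨_, rfl⟩
  obtain ⟨f1, hf1⟩ : ∃ f, f = (c / Y) • (P (0, false) - (p false / c ^ 2) • U) := ⟨_, rfl⟩
  obtain ⟨g, hg⟩ : ∃ f, f = (s / Z) • (P (1, false) - (q false / s ^ 2) • V) := ⟨_, rfl⟩
  have hAU : ∀ i, inner ℝ (P (0, i)) U = p i := fun i => by rw [real_inner_comm, hUA]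
  have hAV : ∀ i, inner ℝ (P (0, i)) V = (0 : ℝ) := fun i => by rw [real_inner_comm, hVA]
  have hBU : ∀ i, inner ℝ (P (1, i)) U = (0 : ℝ) := fun i => by rw [real_inner_comm, hUB]
  have hBV : ∀ i, inner ℝ (P (1, i)) V = q i := fun i => by rw [real_inner_comm, hVB]
  have hVU : inner ℝ V U = (0 : ℝ) := by rw [real_inner_comm, hUV]
  -- The sign ε of the last frame vector is left free, so that it can be chosen at the end to make
  -- the isometry a rotation.
  have main : ∀ ε : ℝ, ε ^ 2 = 1 → ∃ (y : Bool × Bool → ℝ) (R : E4 ≃ₗᵢ[ℝ] E4), OnCurve p q y ∧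
      0 < δ * y (false, false) ∧ (LinearMap.det (R.toLinearEquiv : E4 →ₗ[ℝ] E4) =
        ε * det4 f0 f1 f2 g ∧ (ε * det4 f0 f1 f2 g = 1 ∨ ε * det4 f0 f1 f2 g = -1)) ∧
        ∀ u, P u = R (oct p q y u) := by
    intro ε hε
    have hε0 : ε ≠ 0 := by rintro rfl; norm_num at hε
    have hon : Orthonormal ℝ ![f0, f1, f2, ε • g] := by
      apply orthonormal_four
      · intro i
        fin_cases i <;> simp only [Fin.zero_eta, Fin.mk_one, Fin.reduceFinMk, Matrix.cons_val,
          hf0, hf1, hf2, hg, real_inner_smul_left, inner_smul_right,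
          inner_sub_left, inner_sub_right, hUA, hVB, hAU, hBV, h0, ec, es] <;> field_simp
        · linarith
        · rw [hε, hZ2]; ring
      all_goals simp only [Matrix.cons_val,
          hf0, hf1, hf2, hg, real_inner_smul_left, inner_smul_right,
          inner_sub_left, inner_sub_right, hUA, hUB, hVB, hUV, hAV, hAB, ec, es]
      all_goals field_simp
      all_goals ring
    obtain ⟨R, hR, hdet, hdet', hexp⟩ := exists_isometry_of_orthonormal hon
    simp only [Matrix.cons_val] at hR hdet hdet' hexp
    have hd : det4 f0 f1 f2 (ε • g) = ε * det4 f0 f1 f2 g := by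
      simp only [det4_eq, PiLp.smul_apply, smul_eq_mul]
      ring
    rw [hd] at hdet hdet'
    have i00 : ∀ i, inner ℝ f0 (P (0, i)) = p i / c := fun i => by
      rw [hf0, real_inner_smul_left, hUA]; ring
    have i20 : ∀ i, inner ℝ f2 (P (0, i)) = (0 : ℝ) := fun i => by
      rw [hf2, real_inner_smul_left, hVA]; ring
    have i30 : ∀ i, inner ℝ (ε • g) (P (0, i)) = (0 : ℝ) := fun i => by
      rw [hg, real_inner_smul_left, real_inner_smul_left, inner_sub_left, hBA,
        real_inner_smul_left, hVA]; ring
    have i01 : ∀ i, inner ℝ f0 (P (1, i)) = (0 : ℝ) := fun i => by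
      rw [hf0, real_inner_smul_left, hUB]; ring
    have i21 : ∀ i, inner ℝ f2 (P (1, i)) = q i / s := fun i => by
      rw [hf2, real_inner_smul_left, hVB]; ring
    have i11 : ∀ i, inner ℝ f1 (P (1, i)) = (0 : ℝ) := fun i => by
      rw [hf1, real_inner_smul_left, inner_sub_left, hAB, real_inner_smul_left, hUB]; ring
    have i1A : inner ℝ f1 (P (0, false)) = Y / c := by
      rw [hf1, real_inner_smul_left, inner_sub_left, h0, real_inner_smul_left, hUA]
      field_simp
      linarith
    have i3B : inner ℝ (ε • g) (P (1, false)) = ε * Z / s := by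
      rw [hg, real_inner_smul_left, real_inner_smul_left, inner_sub_left, h0,
        real_inner_smul_left, hVB]
      field_simp
      linarith
    -- The coordinates of b₁ and b₂ in the frame are not prescribed; having unit length determines
    -- their squares.
    obtain ⟨Y', hY'⟩ : ∃ Y', Y' = c * inner ℝ f1 (P (0, true)) := ⟨_, rfl⟩
    obtain ⟨Z', hZ'⟩ : ∃ Z', Z' = s * inner ℝ (ε • g) (P (1, true)) := ⟨_, rfl⟩
    have i1A' : inner ℝ f1 (P (0, true)) = Y' / c := by rw [hY']; field_simp
    have i3B' : inner ℝ (ε • g) (P (1, true)) = Z' / s := by rw [hZ']; field_simp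
    have hY'2 : Y' ^ 2 = c ^ 2 - p true ^ 2 := by
      have := h0 (0, true)
      nth_rewrite 1 [hexp (P (0, true))] at this
      simp only [inner_add_left, real_inner_smul_left, i00, i20, i30, i1A'] at this
      field_simp at this
      linarith
    have hZ'2 : Z' ^ 2 = s ^ 2 - q true ^ 2 := by
      have := h0 (1, true)
      nth_rewrite 1 [hexp (P (1, true))] at this
      simp only [inner_add_left, real_inner_smul_left, i01, i21, i11, i3B'] at this
      field_simp at this
      linarith
    obtain ⟨y, hy1, hy2, hy3, hy4⟩ : ∃ y : Bool × Bool → ℝ, y (false, false) = Y ∧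
        y (false, true) = Y' ∧ y (true, false) = ε * Z ∧ y (true, true) = Z' :=
      ⟨fun k => bif k.1 then (bif k.2 then Z' else ε * Z) else (bif k.2 then Y' else Y),
        rfl, rfl, rfl, rfl⟩
    have hyA : ∀ i, y (false, i) ^ 2 = c ^ 2 - p i ^ 2 := by
      rintro (_ | _)
      · rw [hy1, hY2]
      · rw [hy2, hY'2]
    have hyB : ∀ i, y (true, i) ^ 2 = s ^ 2 - q i ^ 2 := by
      rintro (_ | _)
      · rw [hy3, mul_pow, hε, hZ2, one_mul]
      · rw [hy4, hZ'2]
    have hoct : oct p q y = octPos p q c s y := by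
      unfold oct
      rw [hyA, hyB, sub_add_cancel, sub_add_cancel, Real.sqrt_sq hc0.le, Real.sqrt_sq hs0.le]
    refine ⟨y, R, fun i j => by rw [hyA, hyB]; linarith, by rw [hy1]; exact hδY,
      ⟨hdet, hdet'⟩, ?_⟩
    rw [hoct]
    rintro ⟨u, i⟩
    fin_cases u
    · change P (0, i) = R (octPos p q c s y (0, i))
      rw [hR, hexp (P (0, i)), i00, i20, i30]
      have : inner ℝ f1 (P (0, i)) = y (false, i) / c := by
        cases i
        · rw [i1A, hy1]
        · rw [i1A', hy2]
      rw [this]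
      simp [octPos]
    · change P (1, i) = R (octPos p q c s y (1, i))
      rw [hR, hexp (P (1, i)), i01, i21, i11]
      have : inner ℝ (ε • g) (P (1, i)) = y (true, i) / s := by
        cases i
        · rw [i3B, hy3]
        · rw [i3B', hy4]
      rw [this]
      simp [octPos]
    · change P (2, i) = R (octPos p q c s y (2, i))
      rw [hR]
      have h1 : c • f0 = U := by
        rw [hf0, smul_smul, mul_one_div_cancel hc0.ne', one_smul]
      have h2 : (sg i * s) • f2 = sg i • V := by
        rw [hf2, smul_smul, mul_assoc, mul_one_div_cancel hs0.ne', mul_one]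
      simp only [octPos, PiLp.toLp_apply, Matrix.cons_val, h1, h2, zero_smul, add_zero]
      rw [hU, hV]
      cases i
      · simp only [sg_false]; module
      · simp only [sg_true]; module
  obtain ⟨y, R, h1, h2, ⟨h3, h4⟩, h5⟩ := main 1 (by norm_num)
  rcases h4 with h4 | h4
  · exact ⟨y, R, h1, h2, h3.trans h4, h5⟩
  · obtain ⟨y, R, h1, h2, ⟨h3, -⟩, h5⟩ := main (-1) (by norm_num)
    exact ⟨y, R, h1, h2, by rw [h3]; linarith, h5⟩

lemma IsConfigOf.exists_oct {p q : Bool → ℝ} (H : Params p q) {ℓ : Edge → ℝ} (L : Lens ℓ p q)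
    {P : Vertex → E4} {t : Conf} (hP : IsConfigOf ℓ P t) {δ : ℝ} (hδ : δ ^ 2 = 1) :
    ∃ (y : Bool × Bool → ℝ) (R : E4 ≃ₗᵢ[ℝ] E4), OnCurve p q y ∧ 0 < δ * y (false, false) ∧
      t = phi p q y ∧ LinearMap.det (R.toLinearEquiv : E4 →ₗ[ℝ] E4) = 1 ∧
      ∀ u, P u = R (oct p q y u) := by
  obtain ⟨y, R, h1, h2, h3, h4⟩ := exists_rotation_oct H L hP.1 hδ
  refine ⟨y, R, h1, h2, ?_, h3, h4⟩
  have := (h1.isConfigOf H L).map R h3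
  rw [← funext h4] at this
  exact hP.unique this

/-! ### The configurations of octahedra satisfy the biquadratic equations -/

lemma bricard_smul (α β γ δ X₁ Y₁ X₂ Y₂ c₁ c₂ : ℝ) :
    bricard α β γ δ (c₁ * X₁) (c₁ * Y₁) (c₂ * X₂) (c₂ * Y₂) =
      c₁ ^ 2 * c₂ ^ 2 * bricard α β γ δ X₁ Y₁ X₂ Y₂ := by
  unfold bricard
  ring

/-- The equation between the angles `φ₁`, `φ₂` of a spherical quadrilateral. -/
lemma bricard_halfAngle {α β γ δ φ₁ φ₂ : ℝ}
    (h : Real.cos γ = Real.cos δ * (Real.cos α * Real.cos β + Real.sin α * Real.sin β * Real.cos φ₂)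
      + Real.sin δ * Real.cos φ₁ *
        (Real.sin α * Real.cos β - Real.cos α * Real.sin β * Real.cos φ₂)
      + Real.sin δ * Real.sin β * Real.sin φ₁ * Real.sin φ₂) :
    bricard α β γ δ (Real.sin (φ₁ / 2)) (Real.cos (φ₁ / 2)) (Real.sin (φ₂ / 2))
      (Real.cos (φ₂ / 2)) = 0 := by
  have hc : ∀ φ : ℝ, Real.cos φ = Real.cos (φ / 2) ^ 2 - Real.sin (φ / 2) ^ 2 := fun φ => by
    rw [← Real.cos_two_mul']; congr 1; ring
  have hs : ∀ φ : ℝ, Real.sin φ = 2 * Real.sin (φ / 2) * Real.cos (φ / 2) := fun φ => by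
    rw [← Real.sin_two_mul]; congr 1; ring
  have h1 := Real.sin_sq_add_cos_sq (φ₁ / 2)
  have h2 := Real.sin_sq_add_cos_sq (φ₂ / 2)
  rw [hc φ₁, hc φ₂, hs φ₁, hs φ₂] at h
  unfold bricard
  simp only [Real.cos_add, Real.cos_sub, Real.sin_add, Real.sin_sub]
  generalize Real.sin (φ₁ / 2) = X₁ at *
  generalize Real.cos (φ₁ / 2) = Y₁ at *
  generalize Real.sin (φ₂ / 2) = X₂ at *
  generalize Real.cos (φ₂ / 2) = Y₂ at *
  generalize Real.sin α = sa at *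
  generalize Real.cos α = ca at *
  generalize Real.sin β = sb at *
  generalize Real.cos β = cb at *
  generalize Real.sin δ = sd at *
  generalize Real.cos δ = cd at *
  generalize Real.cos γ = g at *
  linear_combination h + (X₁ ^ 2 + Y₁ ^ 2) * g * h2 + g * h1 - cd * ca * cb * (X₁ ^ 2 + Y₁ ^ 2) * h2
    - cd * ca * cb * h1 - cd * sa * sb * (Y₂ ^ 2 - X₂ ^ 2) * h1
    - sd * sa * cb * (Y₁ ^ 2 - X₁ ^ 2) * h2

/-- The unit tangent vector at `x` of the segment of length `l` from `x` to `y`. -/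
noncomputable def unitTangent (l : ℝ) (x y : E4) : E4 := (1 / Real.sin l) • (y - Real.cos l • x)

lemma inner_unitTangent_of_orthogonal (l : ℝ) {x y n : E4}
    (h1 : inner ℝ n x = 0) (h2 : inner ℝ n y = 0) :
    inner ℝ n (unitTangent l x y) = (0 : ℝ) := by
  simp only [unitTangent, inner_smul_right, inner_sub_right, h1, h2]
  ring

/-! ### The link of a vertex as a spherical quadrilateral -/

section Link

variable {ℓ : Edge → ℝ} (hℓ : ∀ e, 0 < ℓ e ∧ ℓ e < Real.pi) {P : Vertex → E4}
  (hP : HasEdgeLengths ℓ P)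
include hℓ

lemma sin_edge_pos (e : Edge) : 0 < Real.sin (ℓ e) := Real.sin_pos_of_pos_of_lt_pi (hℓ e).1 (hℓ e).2

include hP

lemma inner_edge {u v : Vertex} (h : u.1 ≠ v.1) :
    inner ℝ (P u) (P v) = Real.cos (ℓ (edge u v h)) :=
  (angle_eq_iff_inner (hP.1 u) (hP.1 v) (hℓ _).1 (hℓ _).2).1 (hP.2 u v h)

omit hℓ in
lemma inner_self_vertex (u : Vertex) : inner ℝ (P u) (P u) = (1 : ℝ) :=
  norm_eq_one_iff_inner.1 (hP.1 u)

lemma inner_unitTangent {u v w : Vertex} (huv : u.1 ≠ v.1) (huw : u.1 ≠ w.1) (hvw : v.1 ≠ w.1) :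
    inner ℝ (unitTangent (ℓ (edge u v huv)) (P u) (P v))
      (unitTangent (ℓ (edge u w huw)) (P u) (P w)) =
    (Real.cos (ℓ (edge v w hvw)) - Real.cos (ℓ (edge u v huv)) * Real.cos (ℓ (edge u w huw))) /
      (Real.sin (ℓ (edge u v huv)) * Real.sin (ℓ (edge u w huw))) := by
  have h1 := sin_edge_pos hℓ (edge u v huv)
  have h2 := sin_edge_pos hℓ (edge u w huw)
  simp only [unitTangent, real_inner_smul_left, inner_smul_right, inner_sub_left, inner_sub_right,
    inner_edge hℓ hP hvw, inner_edge hℓ hP huw, inner_self_vertex hP]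
  rw [real_inner_comm (P u) (P v), inner_edge hℓ hP huv]
  field_simp
  ring

lemma inner_self_unitTangent {u v : Vertex} (huv : u.1 ≠ v.1) :
    inner ℝ (unitTangent (ℓ (edge u v huv)) (P u) (P v))
      (unitTangent (ℓ (edge u v huv)) (P u) (P v)) = (1 : ℝ) := by
  have h1 := sin_edge_pos hℓ (edge u v huv)
  simp only [unitTangent, real_inner_smul_left, inner_smul_right, inner_sub_left, inner_sub_right,
    inner_self_vertex hP]
  rw [real_inner_comm (P u) (P v), inner_edge hℓ hP huv]
  field_simp
  linarith [Real.sin_sq_add_cos_sq (ℓ (edge u v huv))]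

lemma inner_vertex_unitTangent {u v : Vertex} (huv : u.1 ≠ v.1) :
    inner ℝ (P u) (unitTangent (ℓ (edge u v huv)) (P u) (P v)) = (0 : ℝ) := by
  simp only [unitTangent, inner_smul_right, inner_sub_right,
    inner_self_vertex hP, inner_edge hℓ hP huv]
  ring

lemma cos_faceAngle {u v w : Vertex} (huv : u.1 ≠ v.1) (huw : u.1 ≠ w.1) (hvw : v.1 ≠ w.1) :
    Real.cos (faceAngle ℓ u v w huv huw hvw) =
      inner ℝ (unitTangent (ℓ (edge u v huv)) (P u) (P v))
        (unitTangent (ℓ (edge u w huw)) (P u) (P w)) := by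
  have h := inner_unitTangent hℓ hP huv huw hvw
  have h1 := abs_real_inner_le_norm (unitTangent (ℓ (edge u v huv)) (P u) (P v))
    (unitTangent (ℓ (edge u w huw)) (P u) (P w))
  rw [norm_eq_one_iff_inner.2 (inner_self_unitTangent hℓ hP huv),
    norm_eq_one_iff_inner.2 (inner_self_unitTangent hℓ hP huw), mul_one] at h1
  rw [h] at h1 ⊢
  unfold faceAngle
  exact Real.cos_arccos (abs_le.1 h1).1 (abs_le.1 h1).2

omit hℓ hP in
lemma faceAngle_comm {u v w : Vertex} (huv : u.1 ≠ v.1) (huw : u.1 ≠ w.1) (hvw : v.1 ≠ w.1) :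
    faceAngle ℓ u v w huv huw hvw = faceAngle ℓ u w v huw huv hvw.symm := by
  unfold faceAngle
  rw [edge_comm v w hvw, mul_comm (Real.cos _), mul_comm (Real.sin _)]

/-- The unit tangent vector of an edge in the orthonormal frame given by an adjacent edge. -/
lemma unitTangent_eq {u v w : Vertex} (huv : u.1 ≠ v.1) (huw : u.1 ≠ w.1) (hvw : v.1 ≠ w.1)
    {n : E4} (hn : IsInnerNormal (P u) (P v) (P w) n) :
    0 < Real.sin (faceAngle ℓ u v w huv huw hvw) ∧
    unitTangent (ℓ (edge u w huw)) (P u) (P w) =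
      Real.cos (faceAngle ℓ u v w huv huw hvw) • unitTangent (ℓ (edge u v huv)) (P u) (P v) +
      Real.sin (faceAngle ℓ u v w huv huw hvw) • n := by
  have hsv := sin_edge_pos hℓ (edge u v huv)
  have hsw := sin_edge_pos hℓ (edge u w huw)
  have hcos := cos_faceAngle hℓ hP huv huw hvw
  have hv1 := inner_self_unitTangent hℓ hP huv
  have hw1 := inner_self_unitTangent hℓ hP huw
  have hvu := inner_vertex_unitTangent hℓ hP huv
  have hwu := inner_vertex_unitTangent hℓ hP huw
  have hnv := inner_unitTangent_of_orthogonal (ℓ (edge u v huv)) hn.2.1 hn.2.2.1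
  have hnn := norm_eq_one_iff_inner.1 hn.1
  have hnu := hn.2.1
  obtain ⟨-, -, -, r, s, c, hc, hz⟩ := hn
  have hPv : P v = Real.cos (ℓ (edge u v huv)) • P u +
      Real.sin (ℓ (edge u v huv)) • unitTangent (ℓ (edge u v huv)) (P u) (P v) := by
    unfold unitTangent
    rw [smul_smul, mul_one_div_cancel hsv.ne', one_smul]
    abel
  have hPw : unitTangent (ℓ (edge u w huw)) (P u) (P w) =
      (1 / Real.sin (ℓ (edge u w huw))) • (P w - Real.cos (ℓ (edge u w huw)) • P u) := rfl
  have huu := inner_self_vertex hP u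
  have hsin : 0 ≤ Real.sin (faceAngle ℓ u v w huv huw hvw) :=
    Real.sin_nonneg_of_nonneg_of_le_pi (Real.arccos_nonneg _) (Real.arccos_le_pi _)
  have hsc := Real.sin_sq_add_cos_sq (faceAngle ℓ u v w huv huw hvw)
  generalize faceAngle ℓ u v w huv huw hvw = α at *
  generalize unitTangent (ℓ (edge u v huv)) (P u) (P v) = Tv at *
  generalize unitTangent (ℓ (edge u w huw)) (P u) (P w) = Tw at *
  obtain ⟨x, y, z, hz0, e⟩ : ∃ x y z : ℝ, 0 < z ∧ Tw = x • P u + y • Tv + z • n := by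
    refine ⟨(r + s * Real.cos (ℓ (edge u v huv)) - Real.cos (ℓ (edge u w huw))) /
      Real.sin (ℓ (edge u w huw)), s * Real.sin (ℓ (edge u v huv)) / Real.sin (ℓ (edge u w huw)),
      c / Real.sin (ℓ (edge u w huw)), by positivity, ?_⟩
    rw [hPw, hz, hPv]
    module
  have hvu' : inner ℝ Tv (P u) = (0 : ℝ) := by rw [real_inner_comm]; exact hvu
  have hvn : inner ℝ Tv n = (0 : ℝ) := by rw [real_inner_comm]; exact hnv
  have hun : inner ℝ (P u) n = (0 : ℝ) := by rw [real_inner_comm]; exact hnu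
  have hx : x = 0 := by
    rw [e] at hwu
    simp only [inner_add_right, inner_smul_right, huu, hvu, hun] at hwu
    linarith
  have hy : y = Real.cos α := by
    rw [hcos, e]
    simp only [inner_add_right, inner_smul_right, hv1, hvu', hvn]
    ring
  subst hx
  subst hy
  have hz2 : z ^ 2 = Real.sin α ^ 2 := by
    rw [e] at hw1
    simp only [inner_add_left, inner_add_right, inner_smul_right, real_inner_smul_left, hnn, hv1,
      hnv, hvn, huu, hvu, hvu', hun, hnu] at hw1
    linarith
  have hzs : z = Real.sin α := by
    rcases sq_eq_sq_iff_eq_or_eq_neg.1 hz2 with h | h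
    · exact h
    · linarith
  rw [← hzs]
  exact ⟨hz0, by rw [e, zero_smul, zero_add]⟩

end Link

lemma orient_swap_right {u v w : Vertex} (huv : u.1 ≠ v.1) (huw : u.1 ≠ w.1) (hvw : v.1 ≠ w.1) :
    orient u w v = -orient u v w := by
  obtain ⟨u, i⟩ := u
  obtain ⟨v, j⟩ := v
  obtain ⟨w, k⟩ := w
  fin_cases u <;> fin_cases v <;> fin_cases w <;> cases i <;> cases j <;> cases k <;>
    simp [orient] at huv huw hvw ⊢

lemma IsExteriorNormal.swap_right {P : Vertex → E4} {u v w : Vertex} {m : E4} (huv : u.1 ≠ v.1)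
    (huw : u.1 ≠ w.1) (hvw : v.1 ≠ w.1) (h : IsExteriorNormal P u w v m) :
    IsExteriorNormal P u v w m := by
  obtain ⟨h1, h2, h3, h4, h5⟩ := h
  refine ⟨h1, h2, h4, h3, ?_⟩
  have : det4 (P u) m (P w) (P v) = -det4 (P u) m (P v) (P w) := by
    simp only [det4_eq]; ring
  rw [this, orient_swap_right huv huw hvw, neg_mul_neg] at h5
  exact h5

lemma halfTan_homog (φ : ℝ) : ∃ c : ℝ, c ≠ 0 ∧ Real.sin (φ / 2) = c * homog (halfTan φ) 0 ∧
    Real.cos (φ / 2) = c * homog (halfTan φ) 1 := by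
  obtain ⟨c, hc⟩ := (isRep_halfTan φ).exists_smul
  refine ⟨c, ?_, congrFun hc 0, congrFun hc 1⟩
  rintro rfl
  rw [zero_smul] at hc
  exact sin_cos_vec_ne_zero _ hc

/-- The cosine of γ is the inner product of the unit tangents at u towards `opp v` and `opp w`.
Expressing the first through the frame of the edge `u w` and φ₂, the second through the frame of `u
v` and φ₁, gives the relation of `bricard_halfAngle`. -/
lemma IsConfigOf.mem_configSpace {ℓ : Edge → ℝ} (hℓ : ∀ e, 0 < ℓ e ∧ ℓ e < Real.pi)
    {P : Vertex → E4} {t : Conf} (h : IsConfigOf ℓ P t) : t ∈ configSpace ℓ := by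
  intro u v w huv huw hvw
  have hP := h.1
  obtain ⟨φ₁, ⟨m, nv, n₂, hm, hnv, hn₂, he⟩, ht₁⟩ := h.2 u v w huv huw hvw
  obtain ⟨φ₂, ⟨m', nw, n₂', hm', hnw, hn₂', he'⟩, ht₂⟩ := h.2 u w v huw huv hvw.symm
  obtain rfl : m = m' := hm.unique (hm'.swap_right huv huw hvw)
  obtain ⟨hα, e1⟩ := unitTangent_eq hℓ hP huv huw hvw hnv
  obtain ⟨-, e2⟩ := unitTangent_eq hℓ hP huw huv hvw.symm hnw
  have huw' : u.1 ≠ (opp w).1 := huw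
  have huv' : u.1 ≠ (opp v).1 := huv
  have hvw' : v.1 ≠ (opp w).1 := hvw
  have hwv' : w.1 ≠ (opp v).1 := hvw.symm
  have hvw'' : (opp v).1 ≠ (opp w).1 := hvw
  obtain ⟨-, e3⟩ := unitTangent_eq hℓ hP huv huw' hvw' hn₂
  obtain ⟨-, e4⟩ := unitTangent_eq hℓ hP huw huv' hwv' hn₂'
  have e5 := cos_faceAngle hℓ hP huv' huw' hvw''
  have hα2 := cos_faceAngle hℓ hP huv huw hvw
  rw [faceAngle_comm (v := w) (w := v)] at e2
  rw [faceAngle_comm (v := v) (w := opp w)] at e3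
  have hv1 := inner_self_unitTangent hℓ hP huv
  have hw1 := inner_self_unitTangent hℓ hP huw
  have mv := inner_unitTangent_of_orthogonal (ℓ (edge u v huv)) hm.2.1 hm.2.2.1
  have mw := inner_unitTangent_of_orthogonal (ℓ (edge u w huw)) hm.2.1 hm.2.2.2.1
  have mnv := hnv.inner_of_orthogonal hm.2.1 hm.2.2.1 hm.2.2.2.1
  have mnw := hnw.inner_of_orthogonal hm.2.1 hm.2.2.2.1 hm.2.2.1
  have nvv := inner_unitTangent_of_orthogonal (ℓ (edge u v huv)) hnv.2.1 hnv.2.2.1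
  have nww := inner_unitTangent_of_orthogonal (ℓ (edge u w huw)) hnw.2.1 hnw.2.2.1
  have hmm := norm_eq_one_iff_inner.1 hm.1
  have hnvv := norm_eq_one_iff_inner.1 hnv.1
  have hnww := norm_eq_one_iff_inner.1 hnw.1
  rw [e3, e4, he, he'] at e5
  obtain ⟨c₁, hc₁, s1, k1⟩ := halfTan_homog φ₁
  obtain ⟨c₂, hc₂, s2, k2⟩ := halfTan_homog φ₂
  rw [ht₁, ht₂]
  refine (mul_eq_zero.1 ((bricard_smul _ _ _ _ _ _ _ _ c₁ c₂).symm.trans ?_)).resolve_left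
    (mul_ne_zero (pow_ne_zero 2 hc₁) (pow_ne_zero 2 hc₂))
  rw [← s1, ← s2, ← k1, ← k2]
  apply bricard_halfAngle
  rw [e5]
  have hsc := Real.sin_sq_add_cos_sq (faceAngle ℓ u v w huv huw hvw)
  generalize faceAngle ℓ u v w huv huw hvw = α at *
  generalize unitTangent (ℓ (edge u v huv)) (P u) (P v) = Tv at *
  generalize unitTangent (ℓ (edge u w huw)) (P u) (P w) = Tw at *
  have vm : inner ℝ Tv m = (0 : ℝ) := by rw [real_inner_comm]; exact mv
  have wm : inner ℝ Tw m = (0 : ℝ) := by rw [real_inner_comm]; exact mw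
  have nvm : inner ℝ nv m = (0 : ℝ) := by rw [real_inner_comm]; exact mnv
  have nwm : inner ℝ nw m = (0 : ℝ) := by rw [real_inner_comm]; exact mnw
  have vnv : inner ℝ Tv nv = (0 : ℝ) := by rw [real_inner_comm]; exact nvv
  have wnw : inner ℝ Tw nw = (0 : ℝ) := by rw [real_inner_comm]; exact nww
  have hwv : inner ℝ Tw Tv = Real.cos α := by rw [real_inner_comm]; exact hα2.symm
  have nvw : inner ℝ Tw nv = Real.sin α := by
    rw [e1]
    simp only [inner_add_left, real_inner_smul_left, vnv, hnvv]
    ring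
  have nwv : inner ℝ nw Tv = Real.sin α := by
    rw [e2]
    simp only [inner_add_right, inner_smul_right, nww, hnww]
    ring
  -- Pairing n_w with the expansion of T_w gives 0 = sin α (cos α + ⟨n_w, n_v⟩), and sin α is
  -- positive.
  have nvnw : inner ℝ nw nv = -Real.cos α := by
    have h1 : inner ℝ nw Tw = Real.cos α * inner ℝ nw Tv + Real.sin α * inner ℝ nw nv := by
      conv_lhs => rw [e1]
      simp only [inner_add_right, inner_smul_right]
    rw [nww, nwv] at h1
    have : Real.sin α * (inner ℝ nw nv + Real.cos α) = 0 := by linarith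
    have := (mul_eq_zero.1 this).resolve_left hα.ne'
    linarith
  simp only [inner_add_left, inner_add_right, inner_sub_left, inner_sub_right, inner_smul_right,
    real_inner_smul_left, hwv, nvw, nwv, nvnw, wm, mv, mnv, nwm, hmm]
  ring

/-! ### The biquadratic equations at the vertices of index `1` and `2` -/

lemma Lens.sin_eq {ℓ : Edge → ℝ} {p q : Bool → ℝ} (L : Lens ℓ p q) (e : Edge) :
    Real.sin (ℓ e) = √(1 - Real.cos (ℓ e) ^ 2) := by
  rw [← Real.abs_sin_eq_sqrt_one_sub_cos_sq,
    abs_of_pos (Real.sin_pos_of_pos_of_lt_pi (L.pos e) (L.lt_pi e))]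

lemma cos_sin_arccos_div {a P Q : ℝ} (hP : 0 < P) (hQ : 0 < Q) (h : Q ^ 2 = P ^ 2 - a ^ 2) :
    Real.cos (Real.arccos (a / P)) = a / P ∧ Real.sin (Real.arccos (a / P)) = Q / P := by
  have h1 : (a / P) ^ 2 + (Q / P) ^ 2 = 1 := by
    field_simp
    linarith
  have h2 : 0 < (Q / P) ^ 2 := by positivity
  constructor
  · exact Real.cos_arccos (by nlinarith) (by nlinarith)
  · rw [Real.sin_arccos, show 1 - (a / P) ^ 2 = (Q / P) ^ 2 by linarith,
      Real.sqrt_sq (by positivity)]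

section FaceAngles

variable {ℓ : Edge → ℝ} {p q : Bool → ℝ} (H : Params p q) (L : Lens ℓ p q)
include H L

lemma faceAngle_A (i j η : Bool) (h1 : ((0, i) : Vertex).1 ≠ ((1, j) : Vertex).1)
    (h2 : ((0, i) : Vertex).1 ≠ ((2, η) : Vertex).1)
    (h3 : ((1, j) : Vertex).1 ≠ ((2, η) : Vertex).1) :
    Real.cos (faceAngle ℓ (0, i) (1, j) (2, η) h1 h2 h3) = sg η * q j / √(1 - p i ^ 2) ∧
    Real.sin (faceAngle ℓ (0, i) (1, j) (2, η) h1 h2 h3) = Q p q i j / √(1 - p i ^ 2) := by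
  unfold faceAngle
  rw [L.sin_eq, L.sin_eq, L.cosAB, L.cosAC, L.cosBC]
  have hP := H.one_sub_p_pos i
  have := cos_sin_arccos_div (a := sg η * q j) (Real.sqrt_pos.2 hP) (H.Q_pos i j) (by
    rw [H.Q_sq, Real.sq_sqrt hP.le, mul_pow, sg_sq, one_mul])
  simpa using this

lemma faceAngle_B (i j η : Bool) (h1 : ((1, j) : Vertex).1 ≠ ((0, i) : Vertex).1)
    (h2 : ((1, j) : Vertex).1 ≠ ((2, η) : Vertex).1)
    (h3 : ((0, i) : Vertex).1 ≠ ((2, η) : Vertex).1) :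
    Real.cos (faceAngle ℓ (1, j) (0, i) (2, η) h1 h2 h3) = p i / √(1 - q j ^ 2) ∧
    Real.sin (faceAngle ℓ (1, j) (0, i) (2, η) h1 h2 h3) = Q p q i j / √(1 - q j ^ 2) := by
  unfold faceAngle
  rw [L.sin_eq, L.sin_eq, edge_comm (1, j) (0, i), L.cosAB, L.cosAC, L.cosBC]
  have hP := H.one_sub_q_pos j
  have := cos_sin_arccos_div (a := p i) (Real.sqrt_pos.2 hP) (H.Q_pos i j) (by
    rw [H.Q_sq, Real.sq_sqrt hP.le]; ring)
  simpa [mul_pow, sg_sq] using this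

end FaceAngles

/-- The biquadratic equation when opposite sides are supplementary in pairs. -/
lemma bricard_of_supplementary {α β γ δ : ℝ} (hγ : Real.cos γ = -Real.cos β)
    (hδ : Real.cos δ = -Real.cos α) (hδ' : Real.sin δ = Real.sin α) (X₁ Y₁ X₂ Y₂ : ℝ) :
    bricard α β γ δ X₁ Y₁ X₂ Y₂ = -2 * Real.sin α * Y₁ * (2 * Real.sin β * X₁ * X₂ * Y₂ +
      (Real.sin α * Real.cos β + Real.cos α * Real.sin β) * Y₁ * X₂ ^ 2 +
      (Real.sin α * Real.cos β - Real.cos α * Real.sin β) * Y₁ * Y₂ ^ 2) := by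
  have h := Real.sin_sq_add_cos_sq α
  unfold bricard
  simp only [Real.cos_add, Real.cos_sub, Real.sin_add, Real.sin_sub, hγ, hδ, hδ']
  linear_combination (Real.cos β * (X₁ ^ 2 * X₂ ^ 2 + X₁ ^ 2 * Y₂ ^ 2 + Y₁ ^ 2 * X₂ ^ 2
    + Y₁ ^ 2 * Y₂ ^ 2)) * h

/-- The biquadratic equation of a deltoid. -/
lemma bricard_of_deltoid {α β γ δ : ℝ} (hγ : Real.cos γ = Real.cos β)
    (hδ : Real.cos δ = Real.cos α) (hδ' : Real.sin δ = Real.sin α) (X₁ Y₁ X₂ Y₂ : ℝ) :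
    bricard α β γ δ X₁ Y₁ X₂ Y₂ = 2 * Real.sin α * X₁ *
      ((Real.sin α * Real.cos β + Real.cos α * Real.sin β) * X₁ * X₂ ^ 2 +
      (Real.sin α * Real.cos β - Real.cos α * Real.sin β) * X₁ * Y₂ ^ 2
      - 2 * Real.sin β * Y₁ * X₂ * Y₂) := by
  have h := Real.sin_sq_add_cos_sq α
  unfold bricard
  simp only [Real.cos_add, Real.cos_sub, Real.sin_add, Real.sin_sub, hγ, hδ, hδ']
  linear_combination (-Real.cos β * (X₁ ^ 2 * X₂ ^ 2 + X₁ ^ 2 * Y₂ ^ 2 + Y₁ ^ 2 * X₂ ^ 2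
    + Y₁ ^ 2 * Y₂ ^ 2)) * h

/-! ### Elimination in the link equations at points with finite tangents -/

section Generic

variable {ℓ : Edge → ℝ} {p q : Bool → ℝ} (H : Params p q) (L : Lens ℓ p q) {t : Conf}
  (ht : t ∈ configSpace ℓ) {r : Edge → ℝ} (hr : ∀ e, t e = ((r e : ℝ) : OnePoint ℝ))
include H L ht hr

/-- Opposite angles at `Aᵢ` differ from the adjacent ones by supplements, so the biquadratic form
splits off the factor Y₁ of the trivial solution t = ∞. At a finite tangent the other factor must
vanish. -/
lemma link_eq_A (i j η : Bool) :
    2 * √(1 - p i ^ 2) * Q p q i (!j) * r (eAB i j) * r (eAC i η) +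
      sg η * (Q p q i j * q (!j) + q j * Q p q i (!j)) * r (eAC i η) ^ 2 +
      sg η * (Q p q i j * q (!j) - q j * Q p q i (!j)) = 0 := by
  have h1 : ((0, i) : Vertex).1 ≠ ((1, j) : Vertex).1 := by simp
  have h2 : ((0, i) : Vertex).1 ≠ ((2, η) : Vertex).1 := by simp
  have h3 : ((1, j) : Vertex).1 ≠ ((2, η) : Vertex).1 := by simp
  have h := ht (0, i) (1, j) (2, η) h1 h2 h3
  change bricard (faceAngle ℓ (0, i) (1, j) (2, η) h1 h2 h3)
    (faceAngle ℓ (0, i) (2, η) (1, !j) h2 h1 h3.symm)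
    (faceAngle ℓ (0, i) (1, !j) (2, !η) h1 h2 h3)
    (faceAngle ℓ (0, i) (2, !η) (1, j) h2 h1 h3.symm)
    (homog (t (eAB i j)) 0) (homog (t (eAB i j)) 1)
    (homog (t (eAC i η)) 0) (homog (t (eAC i η)) 1) = 0 at h
  have eα := faceAngle_A H L i j η h1 h2 h3
  have eβ := faceAngle_A H L i (!j) η h1 h2 h3
  have eγ := faceAngle_A H L i (!j) (!η) h1 h2 h3
  have eδ := faceAngle_A H L i j (!η) h1 h2 h3
  rw [faceAngle_comm (v := (1, !j)) (w := (2, η)) h1 h2 h3] at eβ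
  rw [faceAngle_comm (v := (1, j)) (w := (2, !η)) h1 h2 h3] at eδ
  have hP := Real.sqrt_pos.2 (H.one_sub_p_pos i)
  have hQ := H.Q_pos i j
  have hsg : sg (!η) = -sg η := by cases η <;> simp
  rw [hsg] at eγ eδ
  rw [bricard_of_supplementary (by rw [eγ.1, eβ.1]; ring) (by rw [eδ.1, eα.1]; ring)
    (by rw [eδ.2, eα.2]), hr, hr, eα.1, eα.2, eβ.1, eβ.2] at h
  simp only [homog_coe, Matrix.cons_val_zero, Matrix.cons_val_one] at h
  set P := √(1 - p i ^ 2)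
  field_simp at h
  refine mul_left_cancel₀ (mul_ne_zero two_ne_zero hQ.ne') ?_
  linear_combination -h

/-- The link of `Bⱼ` is a deltoid, and the factor to be discarded is X₁, the trivial solution t = 0.
-/
lemma link_eq_B (hr0 : ∀ e, r e ≠ 0) (i j η : Bool) :
    (Q p q i j * p (!i) + p i * Q p q (!i) j) * r (eAB i j) * r (eBC j η) ^ 2 +
      (Q p q i j * p (!i) - p i * Q p q (!i) j) * r (eAB i j) -
      2 * √(1 - q j ^ 2) * Q p q (!i) j * r (eBC j η) = 0 := by
  have h1 : ((1, j) : Vertex).1 ≠ ((0, i) : Vertex).1 := by simp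
  have h2 : ((1, j) : Vertex).1 ≠ ((2, η) : Vertex).1 := by simp
  have h3 : ((0, i) : Vertex).1 ≠ ((2, η) : Vertex).1 := by simp
  have h := ht (1, j) (0, i) (2, η) h1 h2 h3
  rw [edge_comm (1, j) (0, i)] at h
  change bricard (faceAngle ℓ (1, j) (0, i) (2, η) h1 h2 h3)
    (faceAngle ℓ (1, j) (2, η) (0, !i) h2 h1 h3.symm)
    (faceAngle ℓ (1, j) (0, !i) (2, !η) h1 h2 h3)
    (faceAngle ℓ (1, j) (2, !η) (0, i) h2 h1 h3.symm)
    (homog (t (eAB i j)) 0) (homog (t (eAB i j)) 1)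
    (homog (t (eBC j η)) 0) (homog (t (eBC j η)) 1) = 0 at h
  have eα := faceAngle_B H L i j η h1 h2 h3
  have eβ := faceAngle_B H L (!i) j η h1 h2 h3
  have eγ := faceAngle_B H L (!i) j (!η) h1 h2 h3
  have eδ := faceAngle_B H L i j (!η) h1 h2 h3
  rw [faceAngle_comm (v := (0, !i)) (w := (2, η)) h1 h2 h3] at eβ
  rw [faceAngle_comm (v := (0, i)) (w := (2, !η)) h1 h2 h3] at eδ
  have hP := Real.sqrt_pos.2 (H.one_sub_q_pos j)
  have hQ := H.Q_pos i j
  rw [bricard_of_deltoid (by rw [eγ.1, eβ.1]) (by rw [eδ.1, eα.1])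
    (by rw [eδ.2, eα.2]), hr, hr, eα.1, eα.2, eβ.1, eβ.2] at h
  simp only [homog_coe, Matrix.cons_val_zero, Matrix.cons_val_one] at h
  set P := √(1 - q j ^ 2)
  have hr1 := hr0 (eAB i j)
  field_simp at h
  refine mul_left_cancel₀ (mul_ne_zero (mul_ne_zero two_ne_zero hQ.ne') hr1) ?_
  linear_combination h

/-- In the difference of the equations for the two values of j the terms quadratic in the tangent at
`a₃` or `b₃` cancel. -/
lemma link_A_sub (i η : Bool) : √(1 - p i ^ 2) * r (eAC i η) *
    (Q p q i true * r (eAB i false) - Q p q i false * r (eAB i true)) =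
      -(sg η * (Q p q i false * q true - q false * Q p q i true)) := by
  have h1 := link_eq_A H L ht hr i false η
  have h2 := link_eq_A H L ht hr i true η
  simp only [Bool.not_true, Bool.not_false] at h1 h2
  linear_combination (h1 - h2) / 2

/-- The sum of the two equations is linear after division by the tangent at `a₃`; multiplying it by
their difference eliminates that tangent. -/
lemma link_A_sq (hr0 : ∀ e, r e ≠ 0) (i : Bool) : Q p q i true ^ 2 * r (eAB i false) ^ 2 -
    Q p q i false ^ 2 * r (eAB i true) ^ 2 = q true ^ 2 - q false ^ 2 := by
  have h1 := link_eq_A H L ht hr i false false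
  have h2 := link_eq_A H L ht hr i true false
  have h3 := link_A_sub H L ht hr i false
  simp only [Bool.not_true, Bool.not_false, sg_false] at h1 h2 h3
  have hf := hr0 (eAC i false)
  have hP := Real.sqrt_pos.2 (H.one_sub_p_pos i)
  have hP2 := Real.sq_sqrt (H.one_sub_p_pos i).le
  have e1 := H.Q_sq i false
  have e2 := H.Q_sq i true
  set P := √(1 - p i ^ 2)
  set f := r (eAC i false)
  have h4 : P * (Q p q i true * r (eAB i false) + Q p q i false * r (eAB i true)) =
      -(Q p q i false * q true + q false * Q p q i true) * f := by
    refine mul_left_cancel₀ (mul_ne_zero two_ne_zero hf) ?_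
    linear_combination h1 + h2
  refine mul_left_cancel₀ (mul_ne_zero (pow_ne_zero 2 hP.ne') hf) ?_
  linear_combination (P * (Q p q i true * r (eAB i false) + Q p q i false * r (eAB i true))) * h3
    - (Q p q i false * q true - q false * Q p q i true) * h4 + f * q true ^ 2 * e1
    - f * q false ^ 2 * e2 - f * (q true ^ 2 - q false ^ 2) * hP2

/-- The equations at `Bⱼ` become those at `Aᵢ` in shape when the tangents at `Aᵢ Bⱼ` are replaced by
their inverses. -/
lemma link_B_sub (hr0 : ∀ e, r e ≠ 0) (j η : Bool) : √(1 - q j ^ 2) * r (eBC j η) *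
    (Q p q true j * (r (eAB false j))⁻¹ - Q p q false j * (r (eAB true j))⁻¹) =
      Q p q false j * p true - p false * Q p q true j := by
  have h1 := link_eq_B H L ht hr hr0 false j η
  have h2 := link_eq_B H L ht hr hr0 true j η
  simp only [Bool.not_true, Bool.not_false] at h1 h2
  have a1 := hr0 (eAB false j)
  have a2 := hr0 (eAB true j)
  field_simp
  linear_combination (r (eAB false j) * h2 - r (eAB true j) * h1) / 2

lemma link_B_sq (hr0 : ∀ e, r e ≠ 0) (j : Bool) : Q p q true j ^ 2 * (r (eAB false j))⁻¹ ^ 2 -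
    Q p q false j ^ 2 * (r (eAB true j))⁻¹ ^ 2 = p true ^ 2 - p false ^ 2 := by
  have h1 := link_eq_B H L ht hr hr0 false j false
  have h2 := link_eq_B H L ht hr hr0 true j false
  have h3 := link_B_sub H L ht hr hr0 j false
  simp only [Bool.not_true, Bool.not_false] at h1 h2 h3
  have a1 := mul_inv_cancel₀ (hr0 (eAB false j))
  have a2 := mul_inv_cancel₀ (hr0 (eAB true j))
  have hf := hr0 (eBC j false)
  have hP := Real.sqrt_pos.2 (H.one_sub_q_pos j)
  have hP2 := Real.sq_sqrt (H.one_sub_q_pos j).le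
  have e1 := H.Q_sq false j
  have e2 := H.Q_sq true j
  set P := √(1 - q j ^ 2)
  set g := r (eBC j false)
  set τ₁ := (r (eAB false j))⁻¹
  set τ₂ := (r (eAB true j))⁻¹
  have h4 : P * (Q p q true j * τ₁ + Q p q false j * τ₂) =
      (Q p q false j * p true + p false * Q p q true j) * g := by
    refine mul_left_cancel₀ (mul_ne_zero two_ne_zero hf) ?_
    linear_combination -τ₁ * h1 - τ₂ * h2
      + ((Q p q false j * p true + p false * Q p q true j) * g ^ 2 +
        (Q p q false j * p true - p false * Q p q true j)) * a1
      + ((Q p q false j * p true + p false * Q p q true j) * g ^ 2 -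
        (Q p q false j * p true - p false * Q p q true j)) * a2
  refine mul_left_cancel₀ (mul_ne_zero (pow_ne_zero 2 hP.ne') hf) ?_
  linear_combination (P * (Q p q true j * τ₁ + Q p q false j * τ₂)) * h3
    + (Q p q false j * p true - p false * Q p q true j) * h4 + g * p true ^ 2 * e1
    - g * p false ^ 2 * e2 - g * (p true ^ 2 - p false ^ 2) * hP2

end Generic

/-! ### Membership in the curve -/

/-- The hypotheses are the forms in which the equations appear after elimination. As Q₁₁ ≠ 0, each
of the last two can be solved for one square with the help of the first. -/
lemma onCurve_of {p q : Bool → ℝ} (H : Params p q) {y : Bool × Bool → ℝ}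
    (h1 : y (false, false) ^ 2 + y (true, false) ^ 2 = Q p q false false ^ 2)
    (h2 : Q p q false true ^ 2 * y (true, false) ^ 2 - Q p q false false ^ 2 * y (true, true) ^ 2 =
      (q true ^ 2 - q false ^ 2) * y (false, false) ^ 2)
    (h3 : Q p q true false ^ 2 * y (false, false) ^ 2 - Q p q false false ^ 2 * y (false, true) ^ 2
      = (p true ^ 2 - p false ^ 2) * y (true, false) ^ 2) : OnCurve p q y := by
  have h0 := H.gram_pos false false
  rw [H.Q_sq] at h1
  rw [H.Q_sq, H.Q_sq] at h2 h3
  have e2 : y (true, true) ^ 2 = y (true, false) ^ 2 - (q true ^ 2 - q false ^ 2) := by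
    refine mul_left_cancel₀ h0.ne' ?_
    linear_combination -h2 - (q true ^ 2 - q false ^ 2) * h1
  have e3 : y (false, true) ^ 2 = y (false, false) ^ 2 - (p true ^ 2 - p false ^ 2) := by
    refine mul_left_cancel₀ h0.ne' ?_
    linear_combination -h3 - (p true ^ 2 - p false ^ 2) * h1
  rintro (_ | _) (_ | _) <;> linarith

lemma OnCurve.eq_phi_of_exists {p q : Bool → ℝ} (H : Params p q) {y : Bool × Bool → ℝ}
    (hy : OnCurve p q y) {t : Conf}
    (h : ∀ e, ∃ k, rep p q k y e ≠ 0 ∧ IsRep (t e) (rep p q k y e)) : t = phi p q y := by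
  funext e
  obtain ⟨k, h1, h2⟩ := h e
  exact h2.eq_of_ne_zero h1 (hy.isRep_phi H k e)

/-- The point y is built from t₁₁, t₁₂, t₂₁. The relations obtained by elimination show that it is
on the curve, and t₂₂ fits because of `key`; the remaining tangents are then given by the relations
linear in them. -/
lemma mem_curve_of_generic {ℓ : Edge → ℝ} {p q : Bool → ℝ} (H : Params p q) (L : Lens ℓ p q)
    {t : Conf} (ht : t ∈ configSpace ℓ) {r : Edge → ℝ}
    (hr : ∀ e, t e = ((r e : ℝ) : OnePoint ℝ)) (hr0 : ∀ e, r e ≠ 0)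
    (hg : r (eAB false false) * r (eAB true true) + r (eAB false true) * r (eAB true false) ≠ 0) :
    t ∈ curve p q := by
  have hA := link_A_sq H L ht hr hr0
  have hB := link_B_sq H L ht hr hr0
  have hS := link_A_sub H L ht hr
  have hT := link_B_sub H L ht hr hr0
  have r11 := hr0 (eAB false false)
  have r12 := hr0 (eAB false true)
  have r21 := hr0 (eAB true false)
  have r22 := hr0 (eAB true true)
  have key : r (eAB false false) * r (eAB true true) = r (eAB false true) * r (eAB true false) := by
    have hA1 := hA false
    have hA2 := hA true
    have hB1 := hB false
    have hB2 := hB true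
    have g := H.gram_pos
    have g11 := g false false
    have g12 := g false true
    have g21 := g true false
    have g22 := g true true
    simp only [H.Q_sq] at hA1 hA2 hB1 hB2
    field_simp at hB1 hB2
    set a := r (eAB false false)
    set b := r (eAB false true)
    set c := r (eAB true false)
    set d := r (eAB true true)
    have k : a ^ 2 * d ^ 2 = b ^ 2 * c ^ 2 := by
      have ha : 0 < 1 + a ^ 2 := by positivity
      have hd : 0 < 1 + d ^ 2 := by positivity
      set A := 1 - p false ^ 2 - q false ^ 2
      set B := 1 - p false ^ 2 - q true ^ 2
      set C := 1 - p true ^ 2 - q false ^ 2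
      set D := 1 - p true ^ 2 - q true ^ 2
      -- Each of the four relations at A₁, A₂, B₁, B₂ prescribes a ratio; combining them around the
      -- 4-cycle of the edges `Aᵢ Bⱼ` leaves only a²d² = b²c². The generic condition excludes ad =
      -- −bc.
      have k1 : B * (1 + a ^ 2) = A * (1 + b ^ 2) := by linear_combination hA1
      have k2 : D * (1 + c ^ 2) = C * (1 + d ^ 2) := by linear_combination hA2
      have k3 : C * (1 + a ^ 2) * c ^ 2 = A * (1 + c ^ 2) * a ^ 2 := by linear_combination hB1
      have k4 : D * (1 + b ^ 2) * d ^ 2 = B * (1 + d ^ 2) * b ^ 2 := by linear_combination hB2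
      refine mul_left_cancel₀ (mul_pos (mul_pos (mul_pos g12 ha) g21) hd).ne' ?_
      linear_combination (C * (1 + d ^ 2)) * a ^ 2 * d ^ 2 * k1 -
        A * (1 + b ^ 2) * a ^ 2 * d ^ 2 * k2 - (B * (1 + d ^ 2) * b ^ 2) * k3
        + A * (1 + c ^ 2) * a ^ 2 * k4
    have : (a * d - b * c) * (a * d + b * c) = 0 := by linear_combination k
    rcases mul_eq_zero.1 this with h | h
    · linarith
    · exact absurd h hg
  have hpos : 0 < 1 + r (eAB false false) ^ 2 := by positivity
  -- The size of Y₁ is dictated by Y₁² + Z₁² = Q₁₁² with Z₁ = −t₁₁Y₁.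
  set Y := Q p q false false / √(1 + r (eAB false false) ^ 2)
  have hY : Y ≠ 0 := div_ne_zero (H.Q_pos _ _).ne' (Real.sqrt_pos.2 hpos).ne'
  have hY2 : (1 + r (eAB false false) ^ 2) * Y ^ 2 = Q p q false false ^ 2 := by
    simp only [Y, div_pow, Real.sq_sqrt hpos.le]
    field_simp
  obtain ⟨y, hyy⟩ : ∃ y : Bool × Bool → ℝ, y = fun
    | (false, false) => Y
    | (true, false) => -(r (eAB false false) * Y)
    | (true, true) => r (eAB false true) * Y
    | (false, true) => -(r (eAB false false) * Y) / r (eAB true false) := ⟨_, rfl⟩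
  have y1 : y (false, false) = Y := by rw [hyy]
  have y2 : y (false, true) = -(r (eAB false false) * Y) / r (eAB true false) := by rw [hyy]
  have z1 : y (true, false) = -(r (eAB false false) * Y) := by rw [hyy]
  have z2 : y (true, true) = r (eAB false true) * Y := by rw [hyy]
  have hyc : OnCurve p q y := by
    apply onCurve_of H
    · rw [y1, z1]; linear_combination hY2
    · rw [y1, z1, z2]; linear_combination Y ^ 2 * hA false
    · have := hB false
      rw [y1, z1, y2]
      field_simp at this ⊢
      linear_combination this
  have hAB : ∀ i j, r (eAB i j) * y (false, i) = -(sg i * sg j) * y (true, j) := by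
    rintro (_ | _) (_ | _)
    · rw [y1, z1]; simp
    · rw [y1, z2]; simp
    · rw [y2, z1]; simp; field_simp
    · rw [y2, z2]; simp; field_simp; linear_combination -key
  have hY0 : ∀ i, y (false, i) ≠ 0 := by
    rintro (_ | _)
    · rwa [y1]
    · rw [y2]; exact div_ne_zero (neg_ne_zero.2 (mul_ne_zero r11 hY)) r21
  have hZ0 : ∀ j, y (true, j) ≠ 0 := by
    rintro (_ | _)
    · rw [z1]; exact neg_ne_zero.2 (mul_ne_zero r11 hY)
    · rw [z2]; exact mul_ne_zero r12 hY
  refine ⟨y, hyc, (hyc.eq_phi_of_exists H ?_).symm⟩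
  apply edge_forall
  · intro i j
    refine ⟨false, vec2_ne_zero.2 (Or.inr ?_), ?_⟩
    · simpa [rep_eAB, repAB] using hY0 i
    · simp only [IsRep, hr, rep_eAB, repAB, homog_coe, Matrix.cons_val_zero, Matrix.cons_val_one,
        smul_eq_mul]
      linear_combination hAB i j
  · intro i η
    refine ⟨false, vec2_ne_zero.2 (Or.inl ?_), ?_⟩
    · simpa [rep_eAC, repAC] using ⟨H.lamA_ne_zero i η, hY0 i⟩
    · simp only [IsRep, hr, rep_eAC, repAC, homog_coe, Matrix.cons_val_zero, Matrix.cons_val_one,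
        smul_eq_mul, cond_false, lamA]
      have h1 := hAB i false
      have h2 := hAB i true
      have h3 := hS i η
      have hs := sg_sq i
      have hP := Real.sqrt_pos.2 (H.one_sub_p_pos i)
      set P := √(1 - p i ^ 2)
      simp only [sg_false, sg_true] at h1 h2
      field_simp
      linear_combination -sg i * y (false, i) * h3
        + P * r (eAC i η) * sg i * (Q p q i true * h1 - Q p q i false * h2)
        - P * r (eAC i η) * (Q p q i true * y (true, false) + Q p q i false * y (true, true)) * hs
  · intro j η
    refine ⟨false, vec2_ne_zero.2 (Or.inl ?_), ?_⟩
    · simpa [rep_eBC, repBC] using ⟨H.lamB_ne_zero j, hZ0 j⟩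
    · simp only [IsRep, hr, rep_eBC, repBC, homog_coe, Matrix.cons_val_zero, Matrix.cons_val_one,
        smul_eq_mul, cond_false, lamB]
      have h1 := hAB false j
      have h2 := hAB true j
      have h3 := hT j η
      have a1 := hr0 (eAB false j)
      have a2 := hr0 (eAB true j)
      have hP := Real.sqrt_pos.2 (H.one_sub_q_pos j)
      set P := √(1 - q j ^ 2)
      simp only [sg_false, sg_true] at h1 h2
      have e1 : y (false, false) = -(sg j * y (true, j)) * (r (eAB false j))⁻¹ := by
        field_simp; linear_combination h1
      have e2 : y (false, true) = (sg j * y (true, j)) * (r (eAB true j))⁻¹ := by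
        field_simp; linear_combination h2
      rw [e1, e2, div_mul_eq_mul_div, mul_div_assoc', eq_div_iff hP.ne']
      linear_combination -sg j * y (true, j) * h3

/-! ### Multihomogeneous polynomials on the curve -/

lemma isMultihomogeneous_degree {f : Poly} {d : Edge → ℕ} (hf : IsMultihomogeneous f d)
    {m : Edge × Fin 2 →₀ ℕ} (hm : m ∈ f.support) (e : Edge) : m (e, 0) + m (e, 1) = d e := by
  have h := hf (MvPolynomial.mem_support_iff.1 hm)
  rw [Finsupp.weight_apply, Finsupp.sum_fintype _ _ (by simp)] at h
  have h2 := congrFun h e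
  rw [Fintype.sum_prod_type] at h2
  simp only [Fin.sum_univ_two, Finset.sum_apply, Pi.add_apply, Pi.smul_apply, Pi.single_apply,
    smul_eq_mul, mul_ite, mul_one, mul_zero] at h2
  rw [← h2, Finset.sum_eq_single e]
  · simp
  · intro b _ hb; simp [Ne.symm hb]
  · simp

/-- The scaling factors may lie in any algebra; dual numbers are used later to differentiate along
such scalings. -/
lemma aeval_scale {A : Type*} [CommRing A] [Algebra ℝ A] {f : Poly} {d : Edge → ℕ}
    (hf : IsMultihomogeneous f d) (c : Edge → A) (x : Edge × Fin 2 → A) :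
    MvPolynomial.aeval (fun i => c i.1 * x i) f = (∏ e, c e ^ d e) * MvPolynomial.aeval x f := by
  rw [MvPolynomial.aeval_def, MvPolynomial.aeval_def, MvPolynomial.eval₂_eq',
    MvPolynomial.eval₂_eq', Finset.mul_sum]
  refine Finset.sum_congr rfl fun m hm => ?_
  have h : ∏ i : Edge × Fin 2, c i.1 ^ m i = ∏ e, c e ^ d e := by
    rw [Fintype.prod_prod_type]
    refine Finset.prod_congr rfl fun e _ => ?_
    rw [Fin.prod_univ_two, ← pow_add, isMultihomogeneous_degree hf hm]
  simp only [mul_pow, Finset.prod_mul_distrib, h]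
  ring

lemma eval_scale {f : Poly} {d : Edge → ℕ} (hf : IsMultihomogeneous f d) (c : Edge → ℝ)
    (x : Edge × Fin 2 → ℝ) : MvPolynomial.eval (fun i => c i.1 * x i) f =
      (∏ e, c e ^ d e) * MvPolynomial.eval x f := by
  simpa only [MvPolynomial.aeval_eq_eval] using aeval_scale hf c x

/-- The representing vectors are allowed to vanish here. Only the converse, `eval_coords_eq_zero`,
needs them nonzero, because it divides by the scaling factors. -/
lemma eval_eq_zero_of_isRep {f : Poly} {d : Edge → ℕ} (hf : IsMultihomogeneous f d) {t : Conf}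
    {v : Edge → Fin 2 → ℝ} (hv : ∀ e, IsRep (t e) (v e))
    (h : MvPolynomial.eval (coords t) f = 0) :
    MvPolynomial.eval (fun i : Edge × Fin 2 => v i.1 i.2) f = 0 := by
  choose c hc using fun e => (hv e).exists_smul
  have : (fun i : Edge × Fin 2 => v i.1 i.2) = fun i => c i.1 * coords t i := by
    funext i
    rw [hc]; rfl
  rw [this, eval_scale hf, h, mul_zero]

lemma eval_coords_eq_zero {f : Poly} {d : Edge → ℕ} (hf : IsMultihomogeneous f d) {t : Conf}
    {v : Edge → Fin 2 → ℝ} (hv : ∀ e, IsRep (t e) (v e)) (hv0 : ∀ e, v e ≠ 0)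
    (h : MvPolynomial.eval (fun i : Edge × Fin 2 => v i.1 i.2) f = 0) :
    MvPolynomial.eval (coords t) f = 0 := by
  choose c hc using fun e => (hv e).exists_smul
  have : (fun i : Edge × Fin 2 => v i.1 i.2) = fun i => c i.1 * coords t i := by
    funext i
    rw [hc]; rfl
  rw [this, eval_scale hf] at h
  refine (mul_eq_zero.1 h).resolve_left (Finset.prod_ne_zero_iff.2 fun e _ => pow_ne_zero _ ?_)
  intro h0
  exact hv0 e (by rw [hc, h0, zero_smul])

/-- The functions `a u + b u * w₁ + c u * w₂ + g u * w₁ * w₂` with polynomial coefficients on the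
curve `w₁ ^ 2 = S₁ u`, `w₂ ^ 2 = S₂ u`. -/
def IsNormalForm (S₁ S₂ : Polynomial ℝ) (G : ℝ → ℝ → ℝ → ℝ) : Prop :=
  ∃ a b c g : Polynomial ℝ, ∀ u w₁ w₂ : ℝ, w₁ ^ 2 = S₁.eval u → w₂ ^ 2 = S₂.eval u →
    G u w₁ w₂ = a.eval u + b.eval u * w₁ + c.eval u * w₂ + g.eval u * w₁ * w₂

/-! ### Functions on a cover of the line by two square roots -/

namespace IsNormalForm

variable {S₁ S₂ : Polynomial ℝ} {G G' : ℝ → ℝ → ℝ → ℝ}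

lemma poly (f : Polynomial ℝ) : IsNormalForm S₁ S₂ fun u _ _ => f.eval u :=
  ⟨f, 0, 0, 0, by simp⟩

lemma fst : IsNormalForm S₁ S₂ fun _ w _ => w := ⟨0, 1, 0, 0, by simp⟩

lemma snd : IsNormalForm S₁ S₂ fun _ _ w => w := ⟨0, 0, 1, 0, by simp⟩

lemma add (h : IsNormalForm S₁ S₂ G) (h' : IsNormalForm S₁ S₂ G') :
    IsNormalForm S₁ S₂ fun u v w => G u v w + G' u v w := by
  obtain ⟨a, b, c, g, h⟩ := h
  obtain ⟨a', b', c', g', h'⟩ := h'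
  refine ⟨a + a', b + b', c + c', g + g', fun u v w h1 h2 => ?_⟩
  dsimp only
  rw [h u v w h1 h2, h' u v w h1 h2]
  simp only [Polynomial.eval_add]
  ring

lemma mul (h : IsNormalForm S₁ S₂ G) (h' : IsNormalForm S₁ S₂ G') :
    IsNormalForm S₁ S₂ fun u v w => G u v w * G' u v w := by
  obtain ⟨a, b, c, g, h⟩ := h
  obtain ⟨a', b', c', g', h'⟩ := h'
  refine ⟨a * a' + S₁ * b * b' + S₂ * c * c' + S₁ * S₂ * g * g',
    a * b' + b * a' + S₂ * (c * g' + g * c'), a * c' + c * a' + S₁ * (b * g' + g * b'),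
    a * g' + g * a' + b * c' + c * b', fun u v w h1 h2 => ?_⟩
  dsimp only
  rw [h u v w h1 h2, h' u v w h1 h2]
  simp only [Polynomial.eval_add, Polynomial.eval_mul, ← h1, ← h2]
  ring

lemma const (r : ℝ) : IsNormalForm S₁ S₂ fun _ _ _ => r := by
  simpa using poly (S₁ := S₁) (S₂ := S₂) (Polynomial.C r)

lemma mvEval {σ : Type*} (f : MvPolynomial σ ℝ) {v : σ → ℝ → ℝ → ℝ → ℝ}
    (hv : ∀ i, IsNormalForm S₁ S₂ (v i)) :
    IsNormalForm S₁ S₂ fun u w₁ w₂ => MvPolynomial.eval (fun i => v i u w₁ w₂) f := by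
  induction f using MvPolynomial.induction_on with
  | C r => simpa using const r
  | add f g hf hg => simpa using hf.add hg
  | mul_X f i hf => simpa using hf.mul (hv i)

lemma eq_zero_of_infinite {f : Polynomial ℝ} {T : Set ℝ} (hT : T.Infinite)
    (h : ∀ u ∈ T, f.eval u = 0) : f = 0 :=
  Polynomial.eq_zero_of_infinite_isRoot f (hT.mono fun u hu => h u hu)

/-- A function in normal form on the curve which vanishes over infinitely many `u` is zero, since
its iterated norms are sums of squares over some of the intervals of the parameter. -/
lemma eq_zero (h : IsNormalForm S₁ S₂ G) (hS : {u | S₁.eval u < 0}.Infinite)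
    (hS' : {u | 0 < S₁.eval u ∧ S₂.eval u < 0}.Infinite)
    (hG : {u | ∃ w₁ w₂, w₁ ^ 2 = S₁.eval u ∧ w₂ ^ 2 = S₂.eval u ∧ G u w₁ w₂ = 0}.Infinite)
    {u w₁ w₂ : ℝ} (h₁ : w₁ ^ 2 = S₁.eval u) (h₂ : w₂ ^ 2 = S₂.eval u) : G u w₁ w₂ = 0 := by
  obtain ⟨a, b, c, g, h⟩ := h
  -- M + K w₁ is the norm (a + b w₁)² − S₂(c + g w₁)² that eliminates w₂, and M² − S₁K² is the norm
  -- of this in turn.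
  set M : Polynomial ℝ := a ^ 2 + S₁ * b ^ 2 - S₂ * (c ^ 2 + S₁ * g ^ 2) with hM
  set K : Polynomial ℝ := 2 * (a * b - S₂ * c * g) with hK
  have hN : M ^ 2 - S₁ * K ^ 2 = 0 := by
    refine eq_zero_of_infinite hG ?_
    rintro u ⟨v, w, h1, h2, h3⟩
    rw [h u v w h1 h2] at h3
    simp only [hM, hK, Polynomial.eval_sub, Polynomial.eval_pow, Polynomial.eval_mul,
      Polynomial.eval_add, ← h1, ← h2, Polynomial.eval_ofNat]
    set a := a.eval u
    set b := b.eval u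
    set c := c.eval u
    set g := g.eval u
    linear_combination (a + b * v - c * w - g * v * w) * (a - b * v + c * w - g * v * w) *
      (a - b * v - c * w + g * v * w) * h3
  -- Where S₁ < 0, the equation M² = S₁K² has sides of opposite sign, so both vanish. These u are
  -- not under real points of the curve, but the polynomial identity holds there too.
  have hMK : ∀ u ∈ {u | S₁.eval u < 0}, M.eval u = 0 ∧ K.eval u = 0 := by
    intro u (hu : S₁.eval u < 0)
    have h1 := congrArg (Polynomial.eval u) hN
    simp only [Polynomial.eval_sub, Polynomial.eval_pow, Polynomial.eval_mul,
      Polynomial.eval_zero] at h1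
    have h2 : 0 ≤ -S₁.eval u * (K.eval u) ^ 2 := mul_nonneg (by linarith) (sq_nonneg _)
    have h3 : M.eval u ^ 2 = 0 := le_antisymm (by linarith) (sq_nonneg _)
    refine ⟨pow_eq_zero_iff two_ne_zero |>.1 h3, ?_⟩
    have h4 : S₁.eval u * K.eval u ^ 2 = 0 := by linarith
    exact pow_eq_zero_iff two_ne_zero |>.1 ((mul_eq_zero.1 h4).resolve_left hu.ne)
  have hM0 : M = 0 := eq_zero_of_infinite hS fun u hu => (hMK u hu).1
  -- Where S₁ > 0 > S₂, the polynomial M is a combination of the squares of a, b, c, g with positive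
  -- coefficients.
  have h0 : ∀ u ∈ {u | 0 < S₁.eval u ∧ S₂.eval u < 0},
      a.eval u = 0 ∧ b.eval u = 0 ∧ c.eval u = 0 ∧ g.eval u = 0 := by
    rintro u ⟨h1, h2⟩
    have h3 := congrArg (Polynomial.eval u) hM0
    simp only [hM, Polynomial.eval_sub, Polynomial.eval_pow, Polynomial.eval_mul,
      Polynomial.eval_add, Polynomial.eval_zero] at h3
    set a := a.eval u
    set b := b.eval u
    set c := c.eval u
    set g := g.eval u
    have e1 : 0 ≤ S₁.eval u * b ^ 2 := mul_nonneg h1.le (sq_nonneg _)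
    have e2 : 0 ≤ -S₂.eval u * c ^ 2 := mul_nonneg (by linarith) (sq_nonneg _)
    have e3 : 0 ≤ -S₂.eval u * (S₁.eval u * g ^ 2) :=
      mul_nonneg (by linarith) (mul_nonneg h1.le (sq_nonneg _))
    have e4 := sq_nonneg a
    have key : ∀ {x y : ℝ}, x ≠ 0 → x * y ^ 2 = 0 → y = 0 := fun hx h =>
      pow_eq_zero_iff two_ne_zero |>.1 ((mul_eq_zero.1 h).resolve_left hx)
    exact ⟨key one_ne_zero (by linarith), key h1.ne' (by linarith), key h2.ne (by linarith),
      key (mul_ne_zero h2.ne h1.ne') (by linarith)⟩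
  rw [h u w₁ w₂ h₁ h₂, eq_zero_of_infinite hS' fun u hu => (h0 u hu).1,
    eq_zero_of_infinite hS' fun u hu => (h0 u hu).2.1,
    eq_zero_of_infinite hS' fun u hu => (h0 u hu).2.2.1,
    eq_zero_of_infinite hS' fun u hu => (h0 u hu).2.2.2]
  simp

end IsNormalForm

/-- The polynomial `(2 u Z) ^ 2` on the curve, where `Y₁ = (u ^ 2 + d) / 2 u`
and `Y₁ ^ 2 + Z ^ 2 = m`. -/
noncomputable def radicand (d m : ℝ) : Polynomial ℝ :=
  Polynomial.C (4 * m) * Polynomial.X ^ 2 - (Polynomial.X ^ 2 + Polynomial.C d) ^ 2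

lemma eval_radicand (d m u : ℝ) :
    (radicand d m).eval u = 4 * m * u ^ 2 - (u ^ 2 + d) ^ 2 := by simp [radicand]

lemma infinite_of_isOpen {S : Set ℝ} (h : IsOpen S) (hn : S.Nonempty) : S.Infinite := by
  obtain ⟨x, hx⟩ := hn
  exact infinite_of_mem_nhds x (h.mem_nhds hx)

lemma infinite_radicand_neg {d : ℝ} (hd : 0 < d) (m : ℝ) :
    {u | (radicand d m).eval u < 0}.Infinite := by
  refine infinite_of_isOpen (isOpen_lt (radicand d m).continuous continuous_const) ⟨0, ?_⟩
  simp only [Set.mem_ofPred_eq, eval_radicand]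
  nlinarith

/-- Take x strictly between m′ and m and u = √x + √(x − d), the point where (u² + d)/2u equals √x.
The radicands are then 4u²(m − x) and 4u²(m′ − x), of opposite signs. -/
lemma infinite_radicand_pos_neg {d m m' : ℝ} (hd : 0 < d) (hm : m' < m) (hm' : d ≤ m') :
    {u | 0 < (radicand d m).eval u ∧ (radicand d m').eval u < 0}.Infinite := by
  refine infinite_of_isOpen ((isOpen_lt continuous_const (radicand d m).continuous).inter
    (isOpen_lt (radicand d m').continuous continuous_const)) ?_
  set x := (m + m') / 2
  have hx : d < x := by simp only [x]; linarith
  have h1 := Real.sq_sqrt (hd.trans hx).le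
  have h2 := Real.sq_sqrt (sub_pos.2 hx).le
  have h3 := Real.sqrt_pos.2 (hd.trans hx)
  have h4 := Real.sqrt_pos.2 (sub_pos.2 hx)
  refine ⟨√x + √(x - d), ?_⟩
  have h5 : (√x + √(x - d)) ^ 2 + d = 2 * √x * (√x + √(x - d)) := by linarith
  have h6 : 0 < (√x + √(x - d)) ^ 2 := by positivity
  simp only [Set.mem_ofPred_eq, eval_radicand, h5, mul_pow, h1]
  constructor
  · nlinarith [show x < m by simp only [x]; linarith]
  · nlinarith [show m' < x by simp only [x]; linarith]

/-! ### Polynomials vanishing at infinitely many points of the curve -/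

section Curve

variable {p q : Bool → ℝ} (H : Params p q)
include H

/-- The points of the curve, up to a factor, in terms of `u` and of the square roots `w₁`, `w₂`
of the radicands. -/
def param (d u w₁ w₂ : ℝ) : Bool × Bool → ℝ
  | (false, false) => u ^ 2 + d
  | (false, true) => u ^ 2 - d
  | (true, false) => w₁
  | (true, true) => w₂

omit H in
lemma isNormalForm_rep (S₁ S₂ : Polynomial ℝ) (d : ℝ) (k : Bool) (e : Edge) (l : Fin 2) :
    IsNormalForm S₁ S₂ fun u w₁ w₂ => rep p q k (param d u w₁ w₂) e l := by
  have hc : ∀ r, IsNormalForm S₁ S₂ fun _ _ _ => r := IsNormalForm.const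
  have hA : ∀ i, IsNormalForm S₁ S₂ fun u w₁ w₂ => param d u w₁ w₂ (false, i) := by
    rintro (_ | _)
    · convert IsNormalForm.poly (S₁ := S₁) (S₂ := S₂) (Polynomial.X ^ 2 + Polynomial.C d) using 4
      simp [param]
    · convert IsNormalForm.poly (S₁ := S₁) (S₂ := S₂) (Polynomial.X ^ 2 - Polynomial.C d) using 4
      simp [param]
  have hB : ∀ i, IsNormalForm S₁ S₂ fun u w₁ w₂ => param d u w₁ w₂ (true, i) := by
    rintro (_ | _)
    · exact IsNormalForm.fst
    · exact IsNormalForm.snd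
  revert e
  apply edge_forall
  · intro i j
    simp only [rep_eAB, repAB]
    fin_cases l
    · simpa using (hc (-(sg i * sg j))).mul (hB j)
    · simpa using hA i
  · intro i j
    simp only [rep_eAC, repAC]
    fin_cases l <;> cases k
    · simpa using (hc _).mul (hA i)
    · simpa [sub_eq_add_neg] using (hc (lamA p q i j)).mul
        (((hc _).mul (hB false)).add ((hc (-Q p q i false)).mul (hB true)))
    · simpa using ((hc _).mul (hB false)).add ((hc _).mul (hB true))
    · simpa using (hc _).mul (hA i)
  · intro i j
    simp only [rep_eBC, repBC]
    fin_cases l <;> cases k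
    · simpa using (hc _).mul (hB i)
    · simpa [sub_eq_add_neg] using (hc (lamB p q i)).mul
        (((hc _).mul (hA false)).add ((hc (-Q p q false i)).mul (hA true)))
    · simpa using ((hc _).mul (hA false)).add ((hc _).mul (hA true))
    · simpa using (hc _).mul (hB i)

/-- The product (Y₁ + Y₂)(Y₁ − Y₂) = p₂² − p₁² is nonzero, so u = Y₁ + Y₂ is a rational parameter of
the hyperbola of pairs (Y₁, Y₂). -/
lemma OnCurve.sum_ne_zero {y : Bool × Bool → ℝ} (hy : OnCurve p q y) :
    y (false, false) + y (false, true) ≠ 0 := fun h => by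
  have := hy.sq_sub_A
  have h1 : (y (false, false) + y (false, true)) * (y (false, false) - y (false, true)) =
    p true ^ 2 - p false ^ 2 := by linear_combination this
  rw [h, zero_mul] at h1
  linarith [H.hp]

omit H in
lemma OnCurve.param_eq {y : Bool × Bool → ℝ} (hy : OnCurve p q y) {u : ℝ}
    (hu : u = y (false, false) + y (false, true)) :
    param (p true ^ 2 - p false ^ 2) u (2 * u * y (true, false)) (2 * u * y (true, true)) =
      fun i => 2 * u * y i := by
  have := hy.sq_sub_A
  funext i
  rcases i with ⟨_ | _, _ | _⟩ <;> simp only [param]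
  · rw [hu]; linear_combination -this
  · rw [hu]; linear_combination this

omit H in
lemma OnCurve.radicand_eq {y : Bool × Bool → ℝ} (hy : OnCurve p q y) {u : ℝ}
    (hu : u = y (false, false) + y (false, true)) (j : Bool) :
    (2 * u * y (true, j)) ^ 2 =
      (radicand (p true ^ 2 - p false ^ 2) (1 - p false ^ 2 - q j ^ 2)).eval u := by
  have h := congrFun (hy.param_eq hu) (false, false)
  simp only [param] at h
  rw [eval_radicand, h]
  linear_combination 4 * u ^ 2 * hy false j

/-- The value u determines Y₁, hence the squares of the other coordinates, which leaves finitely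
many sign choices. -/
lemma finite_onCurve_fiber (u : ℝ) :
    {y | OnCurve p q y ∧ y (false, false) + y (false, true) = u}.Finite := by
  rcases Set.eq_empty_or_nonempty {y | OnCurve p q y ∧ y (false, false) + y (false, true) = u}
    with h | ⟨y, hy, hu⟩
  · rw [h]; exact Set.finite_empty
  refine (Set.Finite.pi' (t := fun i => {y i, -y i}) fun i => by simp).subset ?_
  rintro z ⟨hz, hzu⟩
  have h1 : z (false, false) = y (false, false) := by
    have e1 := hy.sq_sub_A
    have e2 := hz.sq_sub_A
    refine mul_left_cancel₀ (hy.sum_ne_zero H) ?_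
    rw [hu]
    linear_combination (e2 - e1 + (u - z (false, false) + z (false, true)) * hzu
      - (u - y (false, false) + y (false, true)) * hu) / 2
  have h2 : ∀ i, z i ^ 2 = y i ^ 2 := by
    have e1 := hy false false
    have e2 := hz false false
    rintro ⟨_ | _, _ | _⟩
    · rw [h1]
    · have e3 := hy true false
      have e4 := hz true false
      rw [h1] at e2
      linarith
    · rw [h1] at e2; linarith
    · have e3 := hy false true
      have e4 := hz false true
      rw [h1] at e4
      linarith
  intro i
  exact sq_eq_sq_iff_eq_or_eq_neg.1 (h2 i)

/-- A multihomogeneous polynomial vanishing at infinitely many points of the curve vanishes on the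
curve. -/
lemma eval_eq_zero_of_infinite {f : Poly} {d : Edge → ℕ} (hf : IsMultihomogeneous f d)
    (hT : {t ∈ curve p q | MvPolynomial.eval (coords t) f = 0}.Infinite) {t : Conf}
    (ht : t ∈ curve p q) : MvPolynomial.eval (coords t) f = 0 := by
  set T := {y | OnCurve p q y ∧ MvPolynomial.eval (coords (phi p q y)) f = 0}
  have hT1 : T.Infinite := by
    refine Set.Infinite.of_image (phi p q) (hT.mono ?_)
    rintro _ ⟨⟨y, hy, rfl⟩, h⟩
    exact ⟨y, ⟨hy, h⟩, rfl⟩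
  have hT2 : ((fun y => y (false, false) + y (false, true)) '' T).Infinite := by
    intro hfin
    refine hT1 (Set.Finite.of_finite_fibers _ hfin fun u _ => ?_)
    exact (finite_onCurve_fiber H u).subset fun y hy => ⟨hy.1.1, hy.2⟩
  obtain ⟨y, hy, rfl⟩ := ht
  -- The systems of forms are chosen to be nonzero at the target point `y`. They may vanish at some
  -- of the given zeros, which is harmless, since there only the implication from zero to zero is
  -- used.
  choose κ hκ using hy.exists_rep_ne_zero H
  refine eval_coords_eq_zero hf (fun e => hy.isRep_phi H (κ e) e) hκ ?_
  have hnf := IsNormalForm.mvEval f fun i : Edge × Fin 2 => isNormalForm_rep (p := p) (q := q)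
    (radicand (p true ^ 2 - p false ^ 2) (1 - p false ^ 2 - q false ^ 2))
    (radicand (p true ^ 2 - p false ^ 2) (1 - p false ^ 2 - q true ^ 2))
    (p true ^ 2 - p false ^ 2) (κ i.1) i.1 i.2
  have hd := sub_pos.2 H.hp
  have key : ∀ z, OnCurve p q z → ∀ u, u = z (false, false) + z (false, true) →
      (fun i : Edge × Fin 2 => rep p q (κ i.1) (param (p true ^ 2 - p false ^ 2) u
        (2 * u * z (true, false)) (2 * u * z (true, true))) i.1 i.2) =
      fun i => (2 * u) * rep p q (κ i.1) z i.1 i.2 := by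
    intro z hz u hu
    rw [hz.param_eq hu]
    funext i
    rw [rep_smul]
  have h0 := hnf.eq_zero (infinite_radicand_neg hd _)
    (infinite_radicand_pos_neg hd (by linarith [H.hq]) (by linarith [H.hpq]))
    (hT2.mono ?_) (hy.radicand_eq rfl false) (hy.radicand_eq rfl true)
  · simp only [key y hy _ rfl] at h0
    rw [eval_scale hf (fun _ => 2 * (y (false, false) + y (false, true)))] at h0
    refine (mul_eq_zero.1 h0).resolve_left (Finset.prod_ne_zero_iff.2 fun e _ => pow_ne_zero _ ?_)
    exact mul_ne_zero two_ne_zero (hy.sum_ne_zero H)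
  · rintro _ ⟨z, ⟨hz, hz0⟩, rfl⟩
    refine ⟨_, _, hz.radicand_eq rfl false, hz.radicand_eq rfl true, ?_⟩
    simp only [key z hz _ rfl]
    rw [eval_scale hf (fun _ => 2 * (z (false, false) + z (false, true))),
      eval_eq_zero_of_isRep hf (fun e => hz.isRep_phi H (κ e) e) hz0, mul_zero]

end Curve

/-! ### Points of the curve -/

/-- The point with `Yᵢ = sᵢ √(x - pᵢ ^ 2)` and `Zⱼ = sⱼ √(1 - x - qⱼ ^ 2)`. -/
noncomputable def arcPt (p q : Bool → ℝ) (x : ℝ) (s : Bool × Bool → ℝ) : Bool × Bool → ℝ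
  | (false, i) => s (false, i) * √(x - p i ^ 2)
  | (true, j) => s (true, j) * √(1 - x - q j ^ 2)

section ArcPt

variable {p q : Bool → ℝ} (H : Params p q) {x : ℝ}
  (hx : x ∈ Set.Icc (p true ^ 2) (1 - q true ^ 2)) {s : Bool × Bool → ℝ} (hs : ∀ i, s i ^ 2 = 1)
include H hx

lemma sub_p_sq_nonneg (i : Bool) : 0 ≤ x - p i ^ 2 := by linarith [H.p_sq_le i, hx.1]

lemma sub_q_sq_nonneg (j : Bool) : 0 ≤ 1 - x - q j ^ 2 := by linarith [H.q_sq_le j, hx.2]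

include hs

lemma arcPt_A_sq (i : Bool) : arcPt p q x s (false, i) ^ 2 = x - p i ^ 2 := by
  simp only [arcPt, mul_pow, hs, one_mul]
  exact Real.sq_sqrt (sub_p_sq_nonneg H hx i)

lemma arcPt_B_sq (j : Bool) : arcPt p q x s (true, j) ^ 2 = 1 - x - q j ^ 2 := by
  simp only [arcPt, mul_pow, hs, one_mul]
  exact Real.sq_sqrt (sub_q_sq_nonneg H hx j)

lemma onCurve_arcPt : OnCurve p q (arcPt p q x s) := fun i j => by
  rw [arcPt_A_sq H hx hs, arcPt_B_sq H hx hs]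
  ring

end ArcPt

lemma Params.sq_lt_one_sub_sq {p q : Bool → ℝ} (H : Params p q) :
    p true ^ 2 < 1 - q true ^ 2 := by linarith [H.hpq]

lemma infinite_curve {p q : Bool → ℝ} (H : Params p q) : (curve p q).Infinite := by
  have hinj : Set.InjOn (fun x => phi p q (arcPt p q x 1))
      (Set.Icc (p true ^ 2) (1 - q true ^ 2)) := by
    intro x hx x' hx' h
    have h1 := arcPt_A_sq H hx (s := 1) (by simp) false
    have h2 := arcPt_A_sq H hx' (s := 1) (by simp) false
    rcases (onCurve_arcPt H hx (s := 1) (by simp)).eq_or_neg_of_phi_eq H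
      (onCurve_arcPt H hx' (s := 1) (by simp)) h with h3 | h3
    · rw [h3] at h2; linarith
    · rw [h3, Pi.neg_apply, neg_sq] at h2; linarith
  refine ((Set.Icc_infinite H.sq_lt_one_sub_sq).image hinj).mono ?_
  rintro _ ⟨x, hx, rfl⟩
  exact ⟨_, onCurve_arcPt H hx (by simp), rfl⟩

/-! ### The Zariski topology of the curve -/

lemma isMultihomogeneous_one : IsMultihomogeneous 1 0 :=
  MvPolynomial.isWeightedHomogeneous_one ℝ _

lemma IsMultihomogeneous.mul {f g : Poly} {d d' : Edge → ℕ} (hf : IsMultihomogeneous f d)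
    (hg : IsMultihomogeneous g d') : IsMultihomogeneous (f * g) (d + d') :=
  MvPolynomial.IsWeightedHomogeneous.mul hf hg

lemma isMultihomogeneous_X (i : Edge × Fin 2) :
    IsMultihomogeneous (MvPolynomial.X i) (Pi.single i.1 1) :=
  MvPolynomial.isWeightedHomogeneous_X ℝ _ i

lemma IsMultihomogeneous.sub {f g : Poly} {d : Edge → ℕ} (hf : IsMultihomogeneous f d)
    (hg : IsMultihomogeneous g d) : IsMultihomogeneous (f - g) d :=
  Submodule.sub_mem (MvPolynomial.weightedHomogeneousSubmodule ℝ _ d) hf hg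

lemma IsMultihomogeneous.smul {f : Poly} {d : Edge → ℕ} (hf : IsMultihomogeneous f d) (r : ℝ) :
    IsMultihomogeneous (r • f) d :=
  Submodule.smul_mem (MvPolynomial.weightedHomogeneousSubmodule ℝ _ d) r hf

/-- A product of multihomogeneous polynomials is multihomogeneous, so the generating sets are stable
under intersection and form a base. -/
lemma exists_isMultihomogeneous_of_isOpen {U : Set Conf} (hU : @IsOpen Conf zariski U) {t : Conf}
    (ht : t ∈ U) : ∃ (f : Poly) (d : Edge → ℕ), IsMultihomogeneous f d ∧
      MvPolynomial.eval (coords t) f ≠ 0 ∧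
      ∀ s, MvPolynomial.eval (coords s) f ≠ 0 → s ∈ U := by
  induction hU with
  | basic s hs =>
    obtain ⟨f, d, hf, rfl⟩ := hs
    exact ⟨f, d, hf, ht, fun s hs => hs⟩
  | univ => exact ⟨1, 0, isMultihomogeneous_one, by simp, fun _ _ => trivial⟩
  | inter u v _ _ h1 h2 =>
    obtain ⟨f, d, hf, hft, hf'⟩ := h1 ht.1
    obtain ⟨g, d', hg, hgt, hg'⟩ := h2 ht.2
    refine ⟨f * g, d + d', hf.mul hg, by simpa using ⟨hft, hgt⟩, fun s hs => ?_⟩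
    rw [map_mul] at hs
    exact ⟨hf' s (left_ne_zero_of_mul hs), hg' s (right_ne_zero_of_mul hs)⟩
  | sUnion S _ ih =>
    obtain ⟨u, hu, htu⟩ := ht
    obtain ⟨f, d, hf, hft, hf'⟩ := ih u hu htu
    exact ⟨f, d, hf, hft, fun s hs => ⟨u, hu, hf' s hs⟩⟩

lemma isOpen_ne_zero {f : Poly} {d : Edge → ℕ} (hf : IsMultihomogeneous f d) :
    @IsOpen Conf zariski {t : Conf | MvPolynomial.eval (coords t) f ≠ 0} :=
  TopologicalSpace.isOpen_generateFrom_of_mem ⟨f, d, hf, rfl⟩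

lemma isClosed_eq_zero {f : Poly} {d : Edge → ℕ} (hf : IsMultihomogeneous f d) :
    @IsClosed Conf zariski {t : Conf | MvPolynomial.eval (coords t) f = 0} := by
  let _ := zariski
  rw [← isOpen_compl_iff]
  exact isOpen_ne_zero hf

lemma eq_of_isRep_homog {s t : OnePoint ℝ} (h : IsRep s (homog t)) : s = t :=
  h.eq_of_ne_zero (homog_ne_zero t) (isRep_homog t)

lemma isClosed_singleton_zariski (t : Conf) : @IsClosed Conf zariski {t} := by
  let _ := zariski
  have : ({t} : Set Conf) = ⋂ e : Edge, {s : Conf | MvPolynomial.eval (coords s)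
      (homog (t e) 1 • MvPolynomial.X (e, 0) - homog (t e) 0 • MvPolynomial.X (e, 1)) = 0} := by
    ext s
    simp only [Set.mem_singleton_iff, Set.mem_iInter, Set.mem_ofPred_eq, map_sub,
      MvPolynomial.smul_eval, MvPolynomial.eval_X]
    constructor
    · rintro rfl e
      simp only [coords]; ring
    · intro h
      funext e
      refine eq_of_isRep_homog ?_
      have := h e
      simp only [coords] at this
      unfold IsRep
      linarith
  rw [this]
  refine isClosed_iInter fun e => ?_
  exact isClosed_eq_zero (((isMultihomogeneous_X (e, 0)).smul _).sub
    ((isMultihomogeneous_X (e, 1)).smul _))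

/-- On the curve the Zariski topology is the cofinite one: a polynomial nonzero somewhere has only
finitely many zeros. Irreducibility and dimension one both follow from this. -/
lemma finite_curve_diff {p q : Bool → ℝ} (H : Params p q) {U : Set Conf} (hU : @IsOpen Conf zariski U)
    (hn : (U ∩ curve p q).Nonempty) : (curve p q \ U).Finite := by
  obtain ⟨t, htU, ht⟩ := hn
  obtain ⟨f, d, hf, hft, hf'⟩ := exists_isMultihomogeneous_of_isOpen hU htU
  by_contra hinf
  refine hft (eval_eq_zero_of_infinite H hf (Set.Infinite.mono ?_ hinf) ht)
  rintro s ⟨hs, hsU⟩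
  exact ⟨hs, by_contra fun h => hsU (hf' s h)⟩

lemma isIrreducible_curve {p q : Bool → ℝ} (H : Params p q) :
    @IsIrreducible Conf zariski (curve p q) := by
  let _ := zariski
  refine ⟨(infinite_curve H).nonempty, ?_⟩
  intro U V hU hV hU' hV'
  have h1 := finite_curve_diff H hU (by rwa [Set.inter_comm])
  have h2 := finite_curve_diff H hV (by rwa [Set.inter_comm])
  obtain ⟨t, ht, ht'⟩ := ((infinite_curve H).sdiff (h1.union h2)).nonempty
  refine ⟨t, ht, ?_, ?_⟩
  · by_contra h; exact ht' (Or.inl ⟨ht, h⟩)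
  · by_contra h; exact ht' (Or.inr ⟨ht, h⟩)

/-- A finite irreducible set in a T₁ space is a single point, so a chain of irreducible closed sets
consists at most of a point and the whole space. The whole space is irreducible because two cofinite
subsets of an infinite set meet. -/
lemma topologicalKrullDim_eq_one {X : Type*} [TopologicalSpace X] [T1Space X] [Infinite X]
    (h : ∀ C : Set X, IsClosed C → C ≠ Set.univ → C.Finite) : topologicalKrullDim X = 1 := by
  have hsub : ∀ C : Set X, IsIrreducible C → C.Finite → C.Subsingleton := by
    intro C hC hfin x hx y hy
    by_contra hxy
    obtain ⟨z, hz, hz1, hz2⟩ := hC.2 (C \ {x})ᶜ {x}ᶜ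
      (hfin.subset Set.sdiff_subset).isClosed.isOpen_compl isClosed_singleton.isOpen_compl
      ⟨x, hx, by simp⟩ ⟨y, hy, fun h => hxy h.symm⟩
    exact hz1 ⟨hz, hz2⟩
  have hirr : IsIrreducible (Set.univ : Set X) := by
    refine ⟨Set.univ_nonempty, ?_⟩
    intro U V hU hV hU' hV'
    simp only [Set.univ_inter] at hU' hV' ⊢
    have key : ∀ W : Set X, IsOpen W → W.Nonempty → Wᶜ.Finite := by
      rintro W hW ⟨w, hw⟩
      refine h _ hW.isClosed_compl fun h0 => ?_
      exact absurd (h0.symm ▸ Set.mem_univ w : w ∈ Wᶜ) (by simpa using hw)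
    obtain ⟨t, ht⟩ := ((key U hU hU').union (key V hV hV')).infinite_compl.nonempty
    rw [Set.compl_union, compl_compl, compl_compl] at ht
    exact ⟨t, ht⟩
  refine le_antisymm ?_ ?_
  · refine Order.krullDim_le_one_iff.2 fun C => ?_
    by_cases hC : (C : Set X) = Set.univ
    · right
      intro D hCD x _
      change x ∈ (C : Set X)
      rw [hC]; trivial
    · left
      intro D hDC x hx
      obtain ⟨y, hy⟩ := D.isIrreducible'.1
      have := hsub C C.isIrreducible' (h C C.isClosed' hC) hx (hDC hy)
      rw [this]; exact hy
  · refine Order.one_le_krullDim_iff.2 ?_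
    obtain ⟨x⟩ := (inferInstance : Nonempty X)
    obtain ⟨y, hy⟩ := exists_ne x
    refine ⟨⟨{x}, isIrreducible_singleton, isClosed_singleton⟩, ⟨Set.univ, hirr, isClosed_univ⟩, ?_⟩
    refine lt_of_le_not_ge (fun z _ => trivial) fun h => ?_
    exact hy (h (Set.mem_univ y))

lemma zariskiDim_curve {p q : Bool → ℝ} (H : Params p q) : zariskiDim (curve p q) = 1 := by
  let _ : TopologicalSpace Conf := zariski
  have : T1Space Conf := ⟨isClosed_singleton_zariski⟩
  have : Infinite (curve p q) := (infinite_curve H).to_subtype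
  change topologicalKrullDim (curve p q) = 1
  refine topologicalKrullDim_eq_one fun C hC hne => ?_
  obtain ⟨D, hD, rfl⟩ := isClosed_induced_iff.1 hC
  obtain ⟨t, ht⟩ := (Set.ne_univ_iff_exists_notMem _).1 hne
  have := finite_curve_diff H hD.isOpen_compl ⟨t, ht, t.2⟩
  refine Set.Finite.of_finite_image (f := Subtype.val) (this.subset ?_)
    Subtype.val_injective.injOn
  rintro _ ⟨s, hs, rfl⟩
  exact ⟨s.2, fun h => h hs⟩

/-! ### The equations of the curve -/

/-- Homogeneous coordinates as variables. -/
noncomputable def vars : Edge × Fin 2 → Poly := MvPolynomial.X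

/-- The first of the two equations in the half-angle tangents at three of the edges `Aᵢ Bⱼ`. -/
noncomputable def eqnA (p q : Bool → ℝ) {R : Type*} [CommRing R] [Algebra ℝ R]
    (z : Edge × Fin 2 → R) : R :=
  (Q p q true false ^ 2) • (z (eAB false false, 1) ^ 2 * z (eAB true false, 0) ^ 2) -
  (Q p q false false ^ 2) • (z (eAB false false, 0) ^ 2 * z (eAB true false, 1) ^ 2) -
  (p true ^ 2 - p false ^ 2) • (z (eAB false false, 0) ^ 2 * z (eAB true false, 0) ^ 2)

/-- The second of the two equations in the half-angle tangents at three of the edges `Aᵢ Bⱼ`. -/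
noncomputable def eqnB (p q : Bool → ℝ) {R : Type*} [CommRing R] [Algebra ℝ R]
    (z : Edge × Fin 2 → R) : R :=
  (Q p q false true ^ 2) • (z (eAB false false, 0) ^ 2 * z (eAB false true, 1) ^ 2) -
  (Q p q false false ^ 2) • (z (eAB false false, 1) ^ 2 * z (eAB false true, 0) ^ 2) -
  (q true ^ 2 - q false ^ 2) • (z (eAB false false, 1) ^ 2 * z (eAB false true, 1) ^ 2)

/-- The equation expressing that the half-angle tangent at the edge `e` is determined by three of
those at the edges `Aᵢ Bⱼ`. -/
noncomputable def eqnRep (p q : Bool → ℝ) (k : Bool) (e : Edge) {R : Type*} [CommRing R]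
    [Algebra ℝ R] (z : Edge × Fin 2 → R) : R :=
  z (e, 0) * rep p q k (recov z) e 1 - z (e, 1) * rep p q k (recov z) e 0

/-- Used with the submodule of multihomogeneous polynomials of a fixed multidegree, on which linear
forms act without changing the degree. -/
lemma rep_mem {R : Type*} [CommRing R] [Algebra ℝ R] (N : Submodule ℝ R) (p q : Bool → ℝ)
    (k : Bool) {y : Bool × Bool → R} (hy : ∀ i, y i ∈ N) (e : Edge) (l : Fin 2) :
    rep p q k y e l ∈ N := by
  revert e
  apply edge_forall
  · intro i j
    simp only [rep_eAB, repAB]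
    fin_cases l
    · exact N.smul_mem _ (hy _)
    · exact hy _
  · intro i j
    simp only [rep_eAC, repAC]
    fin_cases l <;> cases k
    · exact N.smul_mem _ (hy _)
    · exact N.smul_mem _ (N.sub_mem (N.smul_mem _ (hy _)) (N.smul_mem _ (hy _)))
    · exact N.add_mem (N.smul_mem _ (hy _)) (N.smul_mem _ (hy _))
    · exact N.smul_mem _ (hy _)
  · intro i j
    simp only [rep_eBC, repBC]
    fin_cases l <;> cases k
    · exact N.smul_mem _ (hy _)
    · exact N.smul_mem _ (N.sub_mem (N.smul_mem _ (hy _)) (N.smul_mem _ (hy _)))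
    · exact N.add_mem (N.smul_mem _ (hy _)) (N.smul_mem _ (hy _))
    · exact N.smul_mem _ (hy _)

/-- The multidegree of the coordinates of `recov`. -/
def recovDeg : Edge → ℕ :=
  Pi.single (eAB false false) 1 + Pi.single (eAB true false) 1 + Pi.single (eAB false true) 1

lemma isMultihomogeneous_recov (i : Bool × Bool) :
    IsMultihomogeneous (recov vars i) recovDeg := by
  have key : ∀ k l m : Fin 2, IsMultihomogeneous
      (vars (eAB false false, k) * vars (eAB true false, l) * vars (eAB false true, m))
      recovDeg := fun k l m =>
    ((isMultihomogeneous_X _).mul (isMultihomogeneous_X _)).mul (isMultihomogeneous_X _)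
  have hneg : ∀ f : Poly, IsMultihomogeneous f recovDeg → IsMultihomogeneous (-f) recovDeg :=
    fun f hf => by simpa using hf.smul (-1)
  rcases i with ⟨_ | _, _ | _⟩
  · exact hneg _ (key 1 0 1)
  · simp only [recov]
    convert key 0 1 1 using 1
    ring
  · exact key 0 0 1
  · simp only [recov]
    convert hneg _ (key 1 0 0) using 1
    rw [mul_comm (vars (eAB false true, 0)), mul_right_comm]

lemma isMultihomogeneous_eqnRep (p q : Bool → ℝ) (k : Bool) (e : Edge) :
    IsMultihomogeneous (eqnRep p q k e vars) (Pi.single e 1 + recovDeg) := by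
  have h : ∀ l, IsMultihomogeneous (rep p q k (recov vars) e l) recovDeg := fun l =>
    rep_mem (MvPolynomial.weightedHomogeneousSubmodule ℝ _ recovDeg) p q k
      isMultihomogeneous_recov e l
  exact ((isMultihomogeneous_X (e, 0)).mul (h 1)).sub ((isMultihomogeneous_X (e, 1)).mul (h 0))

lemma isMultihomogeneous_sq_mul_sq (i j : Edge × Fin 2) : IsMultihomogeneous
    (vars i ^ 2 * vars j ^ 2) (2 • Pi.single i.1 1 + 2 • Pi.single j.1 1) :=
  IsMultihomogeneous.mul (MvPolynomial.IsWeightedHomogeneous.pow (isMultihomogeneous_X i) 2)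
    (MvPolynomial.IsWeightedHomogeneous.pow (isMultihomogeneous_X j) 2)

lemma isMultihomogeneous_eqnA (p q : Bool → ℝ) : ∃ d, IsMultihomogeneous (eqnA p q vars) d :=
  ⟨_, (((isMultihomogeneous_sq_mul_sq (eAB false false, 1) (eAB true false, 0)).smul _).sub
    ((isMultihomogeneous_sq_mul_sq (eAB false false, 0) (eAB true false, 1)).smul _)).sub
    ((isMultihomogeneous_sq_mul_sq (eAB false false, 0) (eAB true false, 0)).smul _)⟩

lemma isMultihomogeneous_eqnB (p q : Bool → ℝ) : ∃ d, IsMultihomogeneous (eqnB p q vars) d :=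
  ⟨_, (((isMultihomogeneous_sq_mul_sq (eAB false false, 0) (eAB false true, 1)).smul _).sub
    ((isMultihomogeneous_sq_mul_sq (eAB false false, 1) (eAB false true, 0)).smul _)).sub
    ((isMultihomogeneous_sq_mul_sq (eAB false false, 1) (eAB false true, 1)).smul _)⟩

section Map

variable {R S : Type*} [CommRing R] [Algebra ℝ R] [CommRing S] [Algebra ℝ S] (p q : Bool → ℝ)
  (f : R →ₐ[ℝ] S) (z : Edge × Fin 2 → R)

lemma map_recov (i : Bool × Bool) : f (recov z i) = recov (fun i => f (z i)) i := by
  rcases i with ⟨_ | _, _ | _⟩ <;> simp [recov]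

lemma map_eqnRep (k : Bool) (e : Edge) :
    f (eqnRep p q k e z) = eqnRep p q k e fun i => f (z i) := by
  have h : (fun i => f (recov z i)) = recov fun i => f (z i) := funext (map_recov f z)
  simp only [eqnRep, map_sub, map_mul, map_rep, h]

lemma map_eqnA : f (eqnA p q z) = eqnA p q fun i => f (z i) := by simp [eqnA]

lemma map_eqnB : f (eqnB p q z) = eqnB p q fun i => f (z i) := by simp [eqnB]

variable (x : Edge × Fin 2 → R)

lemma aeval_eqnRep (k : Bool) (e : Edge) :
    MvPolynomial.aeval x (eqnRep p q k e vars) = eqnRep p q k e x := by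
  simp [map_eqnRep, vars]

lemma aeval_eqnA : MvPolynomial.aeval x (eqnA p q vars) = eqnA p q x := by
  simp [map_eqnA, vars]

lemma aeval_eqnB : MvPolynomial.aeval x (eqnB p q vars) = eqnB p q x := by
  simp [map_eqnB, vars]

end Map

section Curve

variable {p q : Bool → ℝ} (H : Params p q)
include H

lemma eqn_coords_eq_zero {y : Bool × Bool → ℝ} (hy : OnCurve p q y) :
    eqnA p q (coords (phi p q y)) = 0 ∧ eqnB p q (coords (phi p q y)) = 0 ∧
      ∀ k e, eqnRep p q k e (coords (phi p q y)) = 0 := by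
  obtain ⟨c, hc, h⟩ := hy.recov_coords H
  obtain ⟨c1, h1, a1, b1⟩ := hy.coords_scale H false false
  obtain ⟨c2, h2, a2, b2⟩ := hy.coords_scale H false true
  obtain ⟨c3, h3, a3, b3⟩ := hy.coords_scale H true false
  have hR := fun k e => hy.isRep_phi H k e
  set z := coords (phi p q y) with hz
  simp only [sg_false, sg_true] at a1 a2 a3
  have e11 := hy false false
  have e12 := hy false true
  have e21 := hy true false
  refine ⟨?_, ?_, fun k e => ?_⟩
  · refine mul_left_cancel₀ (mul_ne_zero (pow_ne_zero 2 h1) (pow_ne_zero 2 h3)) ?_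
    have : c1 ^ 2 * c3 ^ 2 * eqnA p q z =
        Q p q true false ^ 2 * ((c1 * z (eAB false false, 1)) ^ 2 *
          (c3 * z (eAB true false, 0)) ^ 2) -
        Q p q false false ^ 2 * ((-(1 * 1) * (c1 * z (eAB false false, 0))) ^ 2 *
          (c3 * z (eAB true false, 1)) ^ 2) -
        (p true ^ 2 - p false ^ 2) * ((-(1 * 1) * (c1 * z (eAB false false, 0))) ^ 2 *
          (c3 * z (eAB true false, 0)) ^ 2) := by
      simp only [eqnA, smul_eq_mul]; ring
    rw [this, ← a1, ← b1, ← b3, show c3 * z (eAB true false, 0) = y (true, false) by linarith,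
      H.Q_sq, H.Q_sq]
    linear_combination y (true, false) ^ 2 * ((1 - p true ^ 2 - q false ^ 2) * e11 -
      (1 - p false ^ 2 - q false ^ 2) * e21)
  · refine mul_left_cancel₀ (mul_ne_zero (pow_ne_zero 2 h1) (pow_ne_zero 2 h2)) ?_
    have : c1 ^ 2 * c2 ^ 2 * eqnB p q z =
        Q p q false true ^ 2 * ((-(1 * 1) * (c1 * z (eAB false false, 0))) ^ 2 *
          (c2 * z (eAB false true, 1)) ^ 2) -
        Q p q false false ^ 2 * ((c1 * z (eAB false false, 1)) ^ 2 *
          (c2 * z (eAB false true, 0)) ^ 2) -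
        (q true ^ 2 - q false ^ 2) * ((c1 * z (eAB false false, 1)) ^ 2 *
          (c2 * z (eAB false true, 1)) ^ 2) := by
      simp only [eqnB, smul_eq_mul]; ring
    rw [this, ← a1, ← b1, ← b2, show c2 * z (eAB false true, 0) = y (true, true) by linarith,
      H.Q_sq, H.Q_sq]
    linear_combination y (false, false) ^ 2 * ((1 - p false ^ 2 - q true ^ 2) * e11 -
      (1 - p false ^ 2 - q false ^ 2) * e12)
  · have := hR k e
    unfold IsRep at this
    rw [eqnRep, funext h, rep_smul, rep_smul]
    simp only [hz, coords]
    linear_combination c * this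

/-- The main point is that `recov` does not vanish at t, which the positivity of p₂² − p₁² and q₂² −
q₁² ensures. Rescaled to satisfy Y₁² + Z₁² = Q₁₁², it is a point of the curve, and `eqnRep`
identifies its image with t. -/
lemma mem_curve_of_eqn {t : Conf} (hA : eqnA p q (coords t) = 0) (hB : eqnB p q (coords t) = 0)
    (hR : ∀ k e, eqnRep p q k e (coords t) = 0) : t ∈ curve p q := by
  have hpos : ∀ e, 0 < coords t (e, 0) ^ 2 + coords t (e, 1) ^ 2 := fun e => homog_sq_pos (t e)
  have hR' : ∀ k e, coords t (e, 0) * rep p q k (recov (coords t)) e 1 =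
    coords t (e, 1) * rep p q k (recov (coords t)) e 0 := fun k e => sub_eq_zero.1 (hR k e)
  have p11 := hpos (eAB false false)
  have p12 := hpos (eAB false true)
  have p21 := hpos (eAB true false)
  have hd := sub_pos.2 H.hp
  have he := sub_pos.2 H.hq
  have g11 := H.Q_pos false false
  have hr1 : recov (coords t) (false, false) = -(coords t (eAB false false, 1) *
    coords t (eAB true false, 0) * coords t (eAB false true, 1)) := rfl
  have hr2 : recov (coords t) (false, true) = coords t (eAB true false, 1) *
    coords t (eAB false false, 0) * coords t (eAB false true, 1) := rfl
  have hr3 : recov (coords t) (true, false) = coords t (eAB false false, 0) *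
    coords t (eAB true false, 0) * coords t (eAB false true, 1) := rfl
  have hr4 : recov (coords t) (true, true) = -(coords t (eAB false true, 0) *
    coords t (eAB false false, 1) * coords t (eAB true false, 0)) := rfl
  simp only [eqnA, eqnB, smul_eq_mul] at hA hB
  set z := recov (coords t)
  set x₁ := coords t (eAB false false, 0)
  set y₁ := coords t (eAB false false, 1)
  set x₂ := coords t (eAB false true, 0)
  set y₂ := coords t (eAB false true, 1)
  set x₃ := coords t (eAB true false, 0)
  set y₃ := coords t (eAB true false, 1)
  have hx1 : x₁ ≠ 0 := by
    intro h
    rw [h] at p11 hB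
    have h1 : 0 < y₁ ^ 2 := by linarith
    have h2 : y₁ ^ 2 * (Q p q false false ^ 2 * x₂ ^ 2 + (q true ^ 2 - q false ^ 2) * y₂ ^ 2) = 0 := by
      linear_combination -hB
    have h3 := (mul_eq_zero.1 h2).resolve_left h1.ne'
    have h4 : 0 ≤ Q p q false false ^ 2 * x₂ ^ 2 := by positivity
    have h5 : 0 ≤ (q true ^ 2 - q false ^ 2) * y₂ ^ 2 := mul_nonneg he.le (sq_nonneg _)
    have h6 : x₂ ^ 2 = 0 :=
      (mul_eq_zero.1 (by linarith : Q p q false false ^ 2 * x₂ ^ 2 = 0)).resolve_left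
        (pow_ne_zero 2 g11.ne')
    have h7 : y₂ ^ 2 = 0 :=
      (mul_eq_zero.1 (by linarith : (q true ^ 2 - q false ^ 2) * y₂ ^ 2 = 0)).resolve_left he.ne'
    linarith
  have hx3 : x₃ ≠ 0 := by
    intro h
    rw [h] at p21 hA
    have h2 : Q p q false false ^ 2 * x₁ ^ 2 * y₃ ^ 2 = 0 := by linear_combination -hA
    have h3 : y₃ ^ 2 = 0 := (mul_eq_zero.1 h2).resolve_left
      (mul_ne_zero (pow_ne_zero 2 g11.ne') (pow_ne_zero 2 hx1))
    linarith
  have hy2 : y₂ ≠ 0 := by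
    intro h
    rw [h] at p12 hB
    have h1 : x₂ ≠ 0 := by rintro h1; rw [h1] at p12; norm_num at p12
    have h2 : Q p q false false ^ 2 * x₂ ^ 2 * y₁ ^ 2 = 0 := by linear_combination -hB
    have h3 : y₁ ^ 2 = 0 := (mul_eq_zero.1 h2).resolve_left
      (mul_ne_zero (pow_ne_zero 2 g11.ne') (pow_ne_zero 2 h1))
    rw [h3] at hA
    have h4 : x₁ ^ 2 * (Q p q false false ^ 2 * y₃ ^ 2 + (p true ^ 2 - p false ^ 2) * x₃ ^ 2) = 0 := by
      linear_combination -hA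
    have h5 := (mul_eq_zero.1 h4).resolve_left (pow_ne_zero 2 hx1)
    have h6 : 0 < (p true ^ 2 - p false ^ 2) * x₃ ^ 2 := mul_pos hd (by positivity)
    have h7 : 0 ≤ Q p q false false ^ 2 * y₃ ^ 2 := by positivity
    linarith
  have hz3 : z (true, false) ≠ 0 := by
    rw [hr3]; exact mul_ne_zero (mul_ne_zero hx1 hx3) hy2
  set n := z (false, false) ^ 2 + z (true, false) ^ 2
  have hn : 0 < n := by positivity
  set c := Q p q false false / √n
  have hc : c ≠ 0 := div_ne_zero g11.ne' (Real.sqrt_pos.2 hn).ne'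
  have hc2 : c ^ 2 * n = Q p q false false ^ 2 := by
    simp only [c, div_pow, Real.sq_sqrt hn.le]
    field_simp
  have hyc : OnCurve p q fun i => c * z i := by
    apply onCurve_of H
    · rw [← hc2]; ring
    · rw [hr1, hr3, hr4]; linear_combination c ^ 2 * x₃ ^ 2 * hB
    · rw [hr1, hr2, hr3]; linear_combination c ^ 2 * y₂ ^ 2 * hA
  refine ⟨_, hyc, funext fun e => (hyc.eq_phi H fun k => ?_).symm⟩
  unfold IsRep
  rw [rep_smul, rep_smul]
  have := hR' k e
  simp only [coords] at this
  linear_combination c * this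

lemma mem_curve_iff (t : Conf) : t ∈ curve p q ↔ eqnA p q (coords t) = 0 ∧
    eqnB p q (coords t) = 0 ∧ ∀ k e, eqnRep p q k e (coords t) = 0 := by
  constructor
  · rintro ⟨y, hy, rfl⟩
    exact eqn_coords_eq_zero H hy
  · rintro ⟨hA, hB, hR⟩
    exact mem_curve_of_eqn H hA hB hR

lemma isClosed_curve : @IsClosed Conf zariski (curve p q) := by
  let _ := zariski
  have : curve p q = {t : Conf | MvPolynomial.eval (coords t) (eqnA p q vars) = 0} ∩
      ({t : Conf | MvPolynomial.eval (coords t) (eqnB p q vars) = 0} ∩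
      ⋂ k, ⋂ e, {t : Conf | MvPolynomial.eval (coords t) (eqnRep p q k e vars) = 0}) := by
    ext t
    rw [mem_curve_iff H]
    simp only [← MvPolynomial.aeval_eq_eval, aeval_eqnA, aeval_eqnB, aeval_eqnRep, Set.mem_inter_iff, Set.mem_iInter,
      Set.mem_ofPred_eq]
  rw [this]
  obtain ⟨d, hd⟩ := isMultihomogeneous_eqnA p q
  obtain ⟨d', hd'⟩ := isMultihomogeneous_eqnB p q
  exact (isClosed_eq_zero hd).inter ((isClosed_eq_zero hd').inter (isClosed_iInter fun k =>
    isClosed_iInter fun e => isClosed_eq_zero (isMultihomogeneous_eqnRep p q k e)))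

end Curve

/-! ### The curve as an irreducible component -/

/-- The equation of the points where the half-angle tangents at the edges `Aᵢ Bⱼ` satisfy
`t₁₁ t₂₂ + t₁₂ t₂₁ = 0`. -/
def eqnGen {R : Type*} [CommRing R] (z : Edge × Fin 2 → R) : R :=
  z (eAB false false, 0) * z (eAB true true, 0) *
    (z (eAB false true, 1) * z (eAB true false, 1)) +
  z (eAB false true, 0) * z (eAB true false, 0) *
    (z (eAB false false, 1) * z (eAB true true, 1))

lemma isMultihomogeneous_eqnGen : ∃ d, IsMultihomogeneous (eqnGen vars) d := by
  have h : ∀ i j k l : Edge × Fin 2, IsMultihomogeneous (vars i * vars j * (vars k * vars l))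
      (Pi.single i.1 1 + Pi.single j.1 1 + (Pi.single k.1 1 + Pi.single l.1 1)) := fun i j k l =>
    ((isMultihomogeneous_X i).mul (isMultihomogeneous_X j)).mul
      ((isMultihomogeneous_X k).mul (isMultihomogeneous_X l))
  refine ⟨_, Submodule.add_mem (MvPolynomial.weightedHomogeneousSubmodule ℝ _ _) (h _ _ _ _) ?_⟩
  change IsMultihomogeneous _ _
  convert h (eAB false true, 0) (eAB true false, 0) (eAB false false, 1) (eAB true true, 1) using 1
  simp only
  abel

lemma eval_eqnGen (z : Edge × Fin 2 → ℝ) :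
    MvPolynomial.eval z (eqnGen vars) = eqnGen z := by
  simp [eqnGen, vars]

/-- The points where no half-angle tangent is `0` or `∞` and `t₁₁ t₂₂ + t₁₂ t₂₁ ≠ 0`. -/
def genericSet : Set Conf := {t | (∀ i, coords t i ≠ 0) ∧ eqnGen (coords t) ≠ 0}

lemma isOpen_genericSet : @IsOpen Conf zariski genericSet := by
  let _ := zariski
  have : genericSet = (⋂ i, {t : Conf | MvPolynomial.eval (coords t) (MvPolynomial.X i) ≠ 0}) ∩
      {t : Conf | MvPolynomial.eval (coords t) (eqnGen vars) ≠ 0} := by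
    ext t
    simp [genericSet, eval_eqnGen]
  rw [this]
  obtain ⟨d, hd⟩ := isMultihomogeneous_eqnGen
  exact (isOpen_iInter_of_finite fun i => isOpen_ne_zero (isMultihomogeneous_X i)).inter
    (isOpen_ne_zero hd)

section Component

variable {p q : Bool → ℝ} (H : Params p q)
include H

/-- At a point with all Yᵢ and Zⱼ positive no linear form in use vanishes. After rescaling, the
value of `eqnGen` there is 2Y₁Y₂Z₁Z₂ > 0. -/
lemma exists_mem_genericSet : ∃ t ∈ curve p q, t ∈ genericSet := by
  obtain ⟨x, hx1, hx2⟩ := exists_between H.sq_lt_one_sub_sq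
  have hx : x ∈ Set.Icc (p true ^ 2) (1 - q true ^ 2) := ⟨hx1.le, hx2.le⟩
  have hy := onCurve_arcPt H hx (s := 1) (by simp)
  have hA : ∀ i, 0 < arcPt p q x 1 (false, i) := fun i => by
    simpa [arcPt] using (H.p_sq_le i).trans_lt hx1
  have hB : ∀ j, 0 < arcPt p q x 1 (true, j) := fun j => by
    have := H.q_sq_le j
    simp only [arcPt, Pi.one_apply, one_mul]
    exact Real.sqrt_pos.2 (by linarith)
  have hne : ∀ i, coords (phi p q (arcPt p q x 1)) i ≠ 0 := by
    have key : ∀ e, (rep p q false (arcPt p q x 1) e 0 ≠ 0 ∧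
        rep p q false (arcPt p q x 1) e 1 ≠ 0) := by
      apply edge_forall
      · intro i j
        simp [rep_eAB, repAB, sg_ne_zero, (hA i).ne', (hB j).ne']
      · intro i j
        have h1 := mul_pos (H.Q_pos i true) (hB false)
        have h2 := mul_pos (H.Q_pos i false) (hB true)
        simp [rep_eAC, repAC, H.lamA_ne_zero, (hA i).ne', (add_pos h1 h2).ne']
      · intro i j
        have h1 := mul_pos (H.Q_pos true i) (hA false)
        have h2 := mul_pos (H.Q_pos false i) (hA true)
        simp [rep_eBC, repBC, H.lamB_ne_zero, (hB i).ne', (add_pos h1 h2).ne']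
    rintro ⟨e, l⟩ h
    obtain ⟨c, hc⟩ := (hy.isRep_phi H false e).exists_smul
    have h0 := congrFun hc l
    have h1 : homog (phi p q (arcPt p q x 1) e) l = 0 := h
    rw [Pi.smul_apply, h1, smul_zero] at h0
    fin_cases l
    · exact (key e).1 h0
    · exact (key e).2 h0
  refine ⟨_, ⟨_, hy, rfl⟩, hne, ?_⟩
  obtain ⟨c1, h1, a1, b1⟩ := hy.coords_scale H false false
  obtain ⟨c2, h2, a2, b2⟩ := hy.coords_scale H false true
  obtain ⟨c3, h3, a3, b3⟩ := hy.coords_scale H true false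
  obtain ⟨c4, h4, a4, b4⟩ := hy.coords_scale H true true
  intro h0
  have h5 : c1 * c2 * c3 * c4 * eqnGen (coords (phi p q (arcPt p q x 1))) = 0 := by
    rw [h0, mul_zero]
  simp only [eqnGen] at h5
  set z := coords (phi p q (arcPt p q x 1))
  simp only [sg_false, sg_true] at a1 a2 a3 a4
  have h6 : c1 * c2 * c3 * c4 * (z (eAB false false, 0) * z (eAB true true, 0) *
    (z (eAB false true, 1) * z (eAB true false, 1)) +
      z (eAB false true, 0) * z (eAB true false, 0) *
    (z (eAB false false, 1) * z (eAB true true, 1))) =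
    (-(1 * 1) * (c1 * z (eAB false false, 0))) * (-(-1 * -1) * (c4 * z (eAB true true, 0))) *
    ((c2 * z (eAB false true, 1)) * (c3 * z (eAB true false, 1))) +
    (-(1 * -1) * (c2 * z (eAB false true, 0))) * (-(-1 * 1) * (c3 * z (eAB true false, 0))) *
    ((c1 * z (eAB false false, 1)) * (c4 * z (eAB true true, 1))) := by ring
  rw [h6, ← a1, ← a2, ← a3, ← a4, ← b1, ← b2, ← b3, ← b4] at h5
  have := hA false
  have := hA true
  have := hB false
  have := hB true
  refine (?_ : (0 : ℝ) < _).ne' h5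
  positivity

variable {ℓ : Edge → ℝ} (L : Lens ℓ p q)
include L

lemma curve_subset_configSpace : curve p q ⊆ configSpace ℓ := by
  rintro _ ⟨y, hy, rfl⟩
  exact (hy.isConfigOf H L).mem_configSpace fun e => ⟨L.pos e, L.lt_pi e⟩

lemma mem_curve_of_isConfigOf {P : Vertex → E4} {t : Conf} (h : IsConfigOf ℓ P t) :
    t ∈ curve p q := by
  obtain ⟨y, R, hy, -, rfl, -⟩ := h.exists_oct H L (one_pow 2)
  exact ⟨y, hy, rfl⟩

lemma configSpace_inter_genericSet_subset : configSpace ℓ ∩ genericSet ⊆ curve p q := by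
  rintro t ⟨ht, hg, hg'⟩
  have h1 : ∀ e, ∃ r : ℝ, t e = ((r : ℝ) : OnePoint ℝ) := fun e => by
    have := hg (e, 1)
    obtain ⟨r, hr⟩ := OnePoint.ne_infty_iff_exists.1 (homog_one_ne_zero.1 this)
    exact ⟨r, hr.symm⟩
  choose r hr using h1
  have hz0 : ∀ e, coords t (e, 0) = r e := fun e => by simp [coords, hr]
  have hz1 : ∀ e, coords t (e, 1) = 1 := fun e => by simp [coords, hr]
  refine mem_curve_of_generic H L ht hr (fun e => hz0 e ▸ hg (e, 0)) ?_
  simpa [eqnGen, hz0, hz1] using hg'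

/-- A strictly larger irreducible set would meet the open set `genericSet` and the open complement
of the curve, hence their intersection, where no point of the configuration space lies. -/
lemma isIrredComponent_curve : IsIrredComponent (configSpace ℓ) (curve p q) := by
  let _ := zariski
  refine ⟨⟨curve_subset_configSpace H L, isIrreducible_curve H⟩, ?_⟩
  rintro s ⟨hs, hirr⟩ hle t ht
  obtain ⟨g, hg, hg'⟩ := exists_mem_genericSet H
  by_contra hn
  obtain ⟨u, hu, hu1, hu2⟩ := hirr.2 genericSet (curve p q)ᶜ isOpen_genericSet
    (isClosed_curve H).isOpen_compl ⟨g, hle hg, hg'⟩ ⟨t, ht, hn⟩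
  exact hu2 (configSpace_inter_genericSet_subset H L ⟨hs hu, hu1⟩)

lemma isEssentialComponent_curve : IsEssentialComponent ℓ (curve p q) := by
  refine ⟨isIrredComponent_curve H L, zariskiDim_curve H, ?_, fun e => ?_⟩
  · rintro _ ⟨y, hy, rfl⟩
    exact ⟨_, hy.isConfigOf H L⟩
  · obtain ⟨g, hg, hg', -⟩ := exists_mem_genericSet H
    exact ⟨⟨g, hg, homog_zero_ne_zero.1 (hg' (e, 0))⟩, ⟨g, hg, homog_one_ne_zero.1 (hg' (e, 1))⟩⟩

/-- Every point of an essential component comes from an octahedron and so lies on the curve; the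
curve is irreducible, and maximality gives equality. -/
lemma IsEssentialComponent.eq_curve {Γ : Set Conf} (h : IsEssentialComponent ℓ Γ) :
    Γ = curve p q := by
  have h1 : Γ ⊆ curve p q := fun t ht => by
    obtain ⟨P, hP⟩ := h.2.2.1 t ht
    exact mem_curve_of_isConfigOf H L hP
  exact h1.antisymm (h.1.2 (isIrredComponent_curve H L).1 h1)

end Component

/-! ### Smoothness of the curve -/

open TrivSqZeroExt in
/-- The point `z` displaced by `w` to first order, in the dual numbers. -/
noncomputable def dual {σ : Type*} (z w : σ → ℝ) : σ → DualNumber ℝ := fun i => inl (z i) + inr (w i)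

@[simp] lemma fst_dual {σ : Type*} (z w : σ → ℝ) (i : σ) : (dual z w i).fst = z i := by
  simp [dual]

@[simp] lemma snd_dual {σ : Type*} (z w : σ → ℝ) (i : σ) : (dual z w i).snd = w i := by
  simp [dual]

/-- The derivative of a polynomial in a direction. -/
noncomputable def dirDeriv {σ : Type*} [Fintype σ] (f : MvPolynomial σ ℝ) (z w : σ → ℝ) : ℝ :=
  ∑ i, MvPolynomial.eval z (MvPolynomial.pderiv i f) * w i

section DirDeriv

variable {σ : Type*} [Fintype σ] (z w : σ → ℝ)

lemma dirDeriv_C (r : ℝ) : dirDeriv (MvPolynomial.C r) z w = 0 := by simp [dirDeriv]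

lemma dirDeriv_add (f g : MvPolynomial σ ℝ) :
    dirDeriv (f + g) z w = dirDeriv f z w + dirDeriv g z w := by
  simp [dirDeriv, add_mul, Finset.sum_add_distrib]

lemma dirDeriv_mul_X (f : MvPolynomial σ ℝ) (i : σ) : dirDeriv (f * MvPolynomial.X i) z w =
    dirDeriv f z w * z i + MvPolynomial.eval z f * w i := by
  classical
  simp only [dirDeriv, Derivation.leibniz, MvPolynomial.pderiv_X, smul_eq_mul, map_add, map_mul,
    MvPolynomial.eval_X, add_mul, Finset.sum_add_distrib]
  rw [add_comm, Finset.sum_mul]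
  congr 1
  · exact Finset.sum_congr rfl fun _ _ => by ring
  · rw [Finset.sum_eq_single i]
    · simp
    · intro j _ hj
      simp [hj.symm]
    · simp

lemma aeval_dual (f : MvPolynomial σ ℝ) :
    (MvPolynomial.aeval (dual z w) f).fst = MvPolynomial.eval z f ∧
    (MvPolynomial.aeval (dual z w) f).snd = dirDeriv f z w := by
  induction f using MvPolynomial.induction_on with
  | C r => simp [dirDeriv_C, TrivSqZeroExt.algebraMap_eq_inl]
  | add f g hf hg => simp [hf, hg, dirDeriv_add]
  | mul_X f i hf =>
    simp [hf, dirDeriv_mul_X, TrivSqZeroExt.fst_mul, TrivSqZeroExt.snd_mul]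
    ring

lemma hasDerivAt_eval {ζ : ℝ → σ → ℝ} {w : σ → ℝ}
    (h : ∀ i, HasDerivAt (fun s => ζ s i) (w i) 0) (f : MvPolynomial σ ℝ) :
    HasDerivAt (fun s => MvPolynomial.eval (ζ s) f) (dirDeriv f (ζ 0) w) 0 := by
  induction f using MvPolynomial.induction_on with
  | C r => simpa [dirDeriv_C] using hasDerivAt_const (0 : ℝ) r
  | add f g hf hg =>
    simp only [dirDeriv_add, map_add]
    exact hf.fun_add hg
  | mul_X f i hf =>
    simp only [dirDeriv_mul_X, map_mul, MvPolynomial.eval_X]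
    exact hf.fun_mul (h i)

lemma dirDeriv_eq_zero_of_eventually {ζ : ℝ → σ → ℝ} {w : σ → ℝ}
    (h : ∀ i, HasDerivAt (fun s => ζ s i) (w i) 0) {f : MvPolynomial σ ℝ}
    (h0 : ∀ᶠ s in nhds 0, MvPolynomial.eval (ζ s) f = 0) : dirDeriv f (ζ 0) w = 0 :=
  (hasDerivAt_eval h f).unique ((hasDerivAt_const (0 : ℝ) (0 : ℝ)).congr_of_eventuallyEq h0)

end DirDeriv

/-- Over the dual numbers, vanishing of the value and of the derivative together is the single
equation f(z + εw) = 0, and this is preserved when each pair of coordinates is scaled. -/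
lemma dirDeriv_scale_eq_zero {f : Poly} {d : Edge → ℕ} (hf : IsMultihomogeneous f d)
    {z w : Edge × Fin 2 → ℝ} (c : Edge → ℝ) (h0 : MvPolynomial.eval z f = 0)
    (h1 : dirDeriv f z w = 0) :
    dirDeriv f (fun i => c i.1 * z i) (fun i => c i.1 * w i) = 0 := by
  have h2 : dual (fun i : Edge × Fin 2 => c i.1 * z i) (fun i => c i.1 * w i) =
      fun i => TrivSqZeroExt.inl (c i.1) * dual z w i := by
    funext i
    ext <;> simp [TrivSqZeroExt.fst_mul, TrivSqZeroExt.snd_mul]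
  have h3 : MvPolynomial.aeval (dual z w) f = (0 : DualNumber ℝ) := by
    ext
    · rw [(aeval_dual _ _ f).1, h0]; rfl
    · rw [(aeval_dual _ _ f).2, h1]; rfl
  rw [← (aeval_dual _ _ f).2, h2, aeval_scale hf (fun e => TrivSqZeroExt.inl (c e)), h3, mul_zero]
  rfl

/-- The polynomials vanishing on the curve have derivative zero at `z` in the direction `w`. -/
def IsTangent (p q : Bool → ℝ) (z w : Edge × Fin 2 → ℝ) : Prop :=
  ∀ (f : Poly) (d : Edge → ℕ), IsMultihomogeneous f d →
    (∀ t ∈ curve p q, MvPolynomial.eval (coords t) f = 0) → dirDeriv f z w = 0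

/-- Euler's relation: z + ε a z is z scaled edgewise by 1 + ε a, so f stays zero to first order. -/
lemma isTangent_euler {p q : Bool → ℝ} {t : Conf} (ht : t ∈ curve p q) (a : Edge → ℝ) :
    IsTangent p q (coords t) fun i => a i.1 * coords t i := by
  intro f d hf h0
  have h1 := h0 t ht
  have h2 : dual (coords t) (fun i => a i.1 * coords t i) =
      fun i => (TrivSqZeroExt.inl 1 + TrivSqZeroExt.inr (a i.1)) * dual (coords t) 0 i := by
    funext i
    ext <;> simp [TrivSqZeroExt.fst_mul, TrivSqZeroExt.snd_mul, mul_comm]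
  rw [← (aeval_dual _ _ f).2, h2,
    aeval_scale hf (fun e => TrivSqZeroExt.inl 1 + TrivSqZeroExt.inr (a e))]
  have h3 : MvPolynomial.aeval (dual (coords t) 0) f = (0 : DualNumber ℝ) := by
    ext
    · rw [(aeval_dual _ _ f).1, h1]; rfl
    · rw [(aeval_dual _ _ f).2]; simp [dirDeriv]
  rw [h3, mul_zero]
  rfl

/-- A vector field tangent to the curve. -/
def field (y : Bool × Bool → ℝ) : Bool × Bool → ℝ
  | (false, i) => y (false, !i) * y (true, false) * y (true, true)
  | (true, j) => -(y (false, false) * y (false, true) * y (true, !j))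

lemma contDiff_field : ContDiff ℝ 1 field := by
  refine contDiff_pi.2 ?_
  rintro ⟨_ | _, _ | _⟩ <;> simp only [field] <;> fun_prop

/-- Along the field, the products of Yᵢ and Zⱼ with their derivatives are Y₁Y₂Z₁Z₂ and −Y₁Y₂Z₁Z₂, so
every Yᵢ² + Zⱼ² is constant and the integral curve stays on the curve. -/
lemma exists_integralCurve {p q : Bool → ℝ} {y : Bool × Bool → ℝ} (hy : OnCurve p q y) :
    ∃ α : ℝ → Bool × Bool → ℝ, α 0 = y ∧ HasDerivAt α (field y) 0 ∧
      ∀ᶠ s in nhds 0, OnCurve p q (α s) := by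
  obtain ⟨α, h0, ε, hε, h⟩ := ContDiffAt.exists_forall_mem_closedBall_exists_eq_forall_mem_Ioo_hasDerivAt₀
    (contDiff_field.contDiffAt (x := y)) 0
  have h00 : (0 : ℝ) ∈ Set.Ioo (0 - ε) (0 + ε) := by simp [hε]
  refine ⟨α, h0, by simpa [h0] using h 0 h00, ?_⟩
  filter_upwards [isOpen_Ioo.mem_nhds h00] with s hs i j
  have hd : ∀ t ∈ Set.Ioo (0 - ε) (0 + ε),
      HasDerivAt (fun s => α s (false, i) ^ 2 + α s (true, j) ^ 2) 0 t := by
    intro t ht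
    have h1 := hasDerivAt_pi.1 (h t ht)
    have h2 := ((h1 (false, i)).fun_pow 2).fun_add ((h1 (true, j)).fun_pow 2)
    have h3 : ((2 : ℕ) : ℝ) * α t (false, i) ^ (2 - 1) * field (α t) (false, i) +
        ((2 : ℕ) : ℝ) * α t (true, j) ^ (2 - 1) * field (α t) (true, j) = 0 := by
      cases i <;> cases j <;> simp only [field, Bool.not_false, Bool.not_true] <;> push_cast <;>
        ring
    rwa [h3] at h2
  have := (convex_Ioo (0 - ε) (0 + ε)).is_const_of_fderivWithin_eq_zero (𝕜 := ℝ)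
    (f := fun s => α s (false, i) ^ 2 + α s (true, j) ^ 2)
    (fun t ht => (hd t ht).differentiableAt.differentiableWithinAt) (fun t ht => by
      have h3 := (hd t ht).hasFDerivAt.hasFDerivWithinAt.fderivWithin
        (isOpen_Ioo.uniqueDiffWithinAt ht) (s := Set.Ioo (0 - ε) (0 + ε))
      rw [h3]; ext; simp) hs h00
  simp only [h0] at this
  rw [this]
  exact hy i j

lemma rep_add (p q : Bool → ℝ) (k : Bool) (y y' : Bool × Bool → ℝ) (e : Edge) (l : Fin 2) :
    rep p q k (y + y') e l = rep p q k y e l + rep p q k y' e l := by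
  revert e
  apply edge_forall
  · intro i j
    simp only [rep_eAB, repAB]
    fin_cases l <;> simp; ring
  · intro i j
    simp only [rep_eAC, repAC]
    fin_cases l <;> cases k <;> simp <;> ring
  · intro i j
    simp only [rep_eBC, repBC]
    fin_cases l <;> cases k <;> simp <;> ring

lemma hasDerivAt_rep (p q : Bool → ℝ) (k : Bool) (e : Edge) (l : Fin 2)
    {α : ℝ → Bool × Bool → ℝ} {w : Bool × Bool → ℝ} (h : HasDerivAt α w 0) :
    HasDerivAt (fun s => rep p q k (α s) e l) (rep p q k w e l) 0 := by
  let F : (Bool × Bool → ℝ) →ₗ[ℝ] ℝ :=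
    { toFun := fun y => rep p q k y e l
      map_add' := fun y y' => rep_add p q k y y' e l
      map_smul' := fun c y => rep_smul p q k y c e l }
  exact (LinearMap.toContinuousLinearMap F).hasFDerivAt.comp_hasDerivAt 0 h

/-! ### The direction of motion as a tangent vector -/

section Tangent

variable {p q : Bool → ℝ} (H : Params p q) {y : Bool × Bool → ℝ} (hy : OnCurve p q y)
include H hy

lemma dirDeriv_rep_eq_zero (κ : Edge → Bool) {f : Poly} {d : Edge → ℕ}
    (hf : IsMultihomogeneous f d) (h0 : ∀ t ∈ curve p q, MvPolynomial.eval (coords t) f = 0) :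
    dirDeriv f (fun i => rep p q (κ i.1) y i.1 i.2) (fun i => rep p q (κ i.1) (field y) i.1 i.2)
      = 0 := by
  obtain ⟨α, hα, hα', hc⟩ := exists_integralCurve hy
  have h1 := dirDeriv_eq_zero_of_eventually
    (ζ := fun s (i : Edge × Fin 2) => rep p q (κ i.1) (α s) i.1 i.2)
    (fun i => hasDerivAt_rep p q (κ i.1) i.1 i.2 hα') (f := f) (by
      filter_upwards [hc] with s hs
      exact eval_eq_zero_of_isRep hf (v := fun e => rep p q (κ e) (α s) e) (fun e => hs.isRep_phi H (κ e) e) (h0 _ ⟨_, hs, rfl⟩))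
  simpa only [hα] using h1

/-- The tangent vector of the curve. -/
lemma exists_tangent : ∃ L : Edge × Fin 2 → ℝ, IsTangent p q (coords (phi p q y)) L ∧
    ∀ i j, ∃ c : ℝ, c ≠ 0 ∧ coords (phi p q y) (eAB i j, 0) * L (eAB i j, 1) -
      coords (phi p q y) (eAB i j, 1) * L (eAB i j, 0) =
      c * (y (true, j) * field y (false, i) - y (false, i) * field y (true, j)) := by
  choose κ hκ using hy.exists_rep_ne_zero H
  choose c hc using fun e => (hy.isRep_phi H (κ e) e).exists_smul
  have hc0 : ∀ e, c e ≠ 0 := fun e h => hκ e (by rw [hc, h, zero_smul])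
  have hz : ∀ i, coords (phi p q y) i = (c i.1)⁻¹ * rep p q (κ i.1) y i.1 i.2 := fun i => by
    rw [hc, Pi.smul_apply, smul_eq_mul, inv_mul_cancel_left₀ (hc0 i.1)]
    rfl
  refine ⟨fun i => (c i.1)⁻¹ * rep p q (κ i.1) (field y) i.1 i.2, ?_, ?_⟩
  · intro f d hf h0
    rw [funext hz]
    exact dirDeriv_scale_eq_zero hf (fun e => (c e)⁻¹)
      (eval_eq_zero_of_isRep hf (v := fun e => rep p q (κ e) y e) (fun e => hy.isRep_phi H (κ e) e) (h0 _ ⟨_, hy, rfl⟩))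
      (dirDeriv_rep_eq_zero H hy κ hf h0)
  · intro i j
    refine ⟨-(sg i * sg j) * (c (eAB i j))⁻¹ ^ 2, mul_ne_zero (neg_ne_zero.2
      (mul_ne_zero (sg_ne_zero _) (sg_ne_zero _))) (pow_ne_zero 2 (inv_ne_zero (hc0 _))), ?_⟩
    rw [hz, hz]
    simp only [rep_eAB, repAB, Matrix.cons_val_zero, Matrix.cons_val_one, smul_eq_mul]
    ring

end Tangent

section DirDeriv

variable {σ : Type*} [Fintype σ] (f : MvPolynomial σ ℝ) (z : σ → ℝ)

lemma dirDeriv_add_right (w w' : σ → ℝ) :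
    dirDeriv f z (w + w') = dirDeriv f z w + dirDeriv f z w' := by
  simp [dirDeriv, mul_add, Finset.sum_add_distrib]

lemma dirDeriv_smul_right (c : ℝ) (w : σ → ℝ) : dirDeriv f z (c • w) = c * dirDeriv f z w := by
  simp [dirDeriv, Finset.mul_sum, mul_left_comm]

end DirDeriv

/-- The tangent space of the cone over the curve. -/
def tangentSpace (p q : Bool → ℝ) (z : Edge × Fin 2 → ℝ) : Submodule ℝ (Edge × Fin 2 → ℝ) where
  carrier := {w | IsTangent p q z w}
  zero_mem' := fun f d _ _ => by simp [dirDeriv]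
  add_mem' := fun h h' f d hf h0 => by
    rw [dirDeriv_add_right, h f d hf h0, h' f d hf h0, add_zero]
  smul_mem' := fun c w h f d hf h0 => by rw [dirDeriv_smul_right, h f d hf h0, mul_zero]

lemma mem_tangentSpace {p q : Bool → ℝ} {z w : Edge × Fin 2 → ℝ} :
    w ∈ tangentSpace p q z ↔ IsTangent p q z w := Iff.rfl

/-- The moment of a displacement with respect to the point with homogeneous coordinates `z` at
an edge. -/
def moment (z w : Edge × Fin 2 → ℝ) (e : Edge) : ℝ := z (e, 0) * w (e, 1) - z (e, 1) * w (e, 0)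

lemma exists_of_moment_eq_zero {z w : Edge × Fin 2 → ℝ} {e : Edge}
    (hz : z (e, 0) ^ 2 + z (e, 1) ^ 2 ≠ 0) (h : moment z w e = 0) :
    ∃ a : ℝ, ∀ l, w (e, l) = a * z (e, l) := by
  refine ⟨(z (e, 0) * w (e, 0) + z (e, 1) * w (e, 1)) / (z (e, 0) ^ 2 + z (e, 1) ^ 2), fun l => ?_⟩
  unfold moment at h
  fin_cases l <;> field_simp <;> simp only [Fin.zero_eta, Fin.mk_one]
  · linear_combination -z (e, 1) * h
  · linear_combination z (e, 0) * h

/-! ### Linear relations satisfied by tangent vectors -/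

section Moment

variable {p q : Bool → ℝ} (H : Params p q) {y : Bool × Bool → ℝ} (hy : OnCurve p q y)
include H hy

lemma coords_eAB_zero (i j : Bool) :
    coords (phi p q y) (eAB i j, 0) ≠ 0 ↔ y (true, j) ≠ 0 := by
  obtain ⟨c, hc, h1, -⟩ := hy.coords_scale H i j
  rw [h1]
  simp [hc, sg_ne_zero]

lemma coords_eAB_one (i j : Bool) :
    coords (phi p q y) (eAB i j, 1) ≠ 0 ↔ y (false, i) ≠ 0 := by
  obtain ⟨c, hc, -, h1⟩ := hy.coords_scale H i j
  rw [h1]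
  simp [hc]

variable {w : Edge × Fin 2 → ℝ} (hw : IsTangent p q (coords (phi p q y)) w)
include hw

/-- Differentiating `eqnA` and using the equation itself to remove its third term leaves an
expression in which the displacement enters only through its moments at two edges. -/
lemma moment_eqnA : Q p q true false ^ 2 * coords (phi p q y) (eAB false false, 1) *
      coords (phi p q y) (eAB true false, 0) ^ 3 * moment (coords (phi p q y)) w (eAB false false) =
    Q p q false false ^ 2 * coords (phi p q y) (eAB false false, 0) ^ 3 *
      coords (phi p q y) (eAB true false, 1) *
      moment (coords (phi p q y)) w (eAB true false) := by
  obtain ⟨d, hd⟩ := isMultihomogeneous_eqnA p q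
  have h0 : ∀ t ∈ curve p q, MvPolynomial.eval (coords t) (eqnA p q vars) = 0 := fun t ht => by
    rw [← MvPolynomial.aeval_eq_eval, aeval_eqnA]
    exact ((mem_curve_iff H t).1 ht).1
  have h1 := hw _ d hd h0
  rw [← (aeval_dual _ _ _).2, aeval_eqnA] at h1
  have h2 := (eqn_coords_eq_zero H hy).1
  simp only [eqnA, pow_two, smul_eq_mul, TrivSqZeroExt.snd_sub, TrivSqZeroExt.snd_smul,
    TrivSqZeroExt.snd_mul, TrivSqZeroExt.fst_mul, fst_dual, snd_dual, MulOpposite.smul_eq_mul_unop,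
    MulOpposite.unop_op] at h1 h2
  unfold moment
  set z := coords (phi p q y)
  linear_combination (z (eAB false false, 0) * z (eAB true false, 0) / 2) * h1
    - (w (eAB false false, 0) * z (eAB true false, 0) +
      w (eAB true false, 0) * z (eAB false false, 0)) * h2

lemma moment_eqnB : Q p q false true ^ 2 * coords (phi p q y) (eAB false false, 0) *
      coords (phi p q y) (eAB false true, 1) ^ 3 * moment (coords (phi p q y)) w (eAB false false) =
    Q p q false false ^ 2 * coords (phi p q y) (eAB false false, 1) ^ 3 *
      coords (phi p q y) (eAB false true, 0) *
      moment (coords (phi p q y)) w (eAB false true) := by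
  obtain ⟨d, hd⟩ := isMultihomogeneous_eqnB p q
  have h0 : ∀ t ∈ curve p q, MvPolynomial.eval (coords t) (eqnB p q vars) = 0 := fun t ht => by
    rw [← MvPolynomial.aeval_eq_eval, aeval_eqnB]
    exact ((mem_curve_iff H t).1 ht).2.1
  have h1 := hw _ d hd h0
  rw [← (aeval_dual _ _ _).2, aeval_eqnB] at h1
  have h2 := (eqn_coords_eq_zero H hy).2.1
  simp only [eqnB, pow_two, smul_eq_mul, TrivSqZeroExt.snd_sub, TrivSqZeroExt.snd_smul,
    TrivSqZeroExt.snd_mul, TrivSqZeroExt.fst_mul, fst_dual, snd_dual, MulOpposite.smul_eq_mul_unop,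
    MulOpposite.unop_op] at h1 h2
  unfold moment
  set z := coords (phi p q y)
  linear_combination -(z (eAB false false, 1) * z (eAB false true, 1) / 2) * h1
    + (w (eAB false false, 1) * z (eAB false true, 1) +
      w (eAB false true, 1) * z (eAB false false, 1)) * h2

/-- A tangent vector is determined, up to the Euler vectors, by its components at three edges. -/
lemma moment_eq_zero (h11 : moment (coords (phi p q y)) w (eAB false false) = 0)
    (h12 : moment (coords (phi p q y)) w (eAB false true) = 0)
    (h21 : moment (coords (phi p q y)) w (eAB true false) = 0) (e : Edge) :
    moment (coords (phi p q y)) w e = 0 := by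
  obtain ⟨a, ha⟩ := exists_of_moment_eq_zero (homog_sq_pos _).ne' h11
  obtain ⟨b, hb⟩ := exists_of_moment_eq_zero (homog_sq_pos _).ne' h12
  obtain ⟨c, hc⟩ := exists_of_moment_eq_zero (homog_sq_pos _).ne' h21
  obtain ⟨k, hk⟩ := hy.exists_rep_ne_zero H e
  have h0 : ∀ t ∈ curve p q, MvPolynomial.eval (coords t) (eqnRep p q k e vars) = 0 :=
    fun t ht => by
      rw [← MvPolynomial.aeval_eq_eval, aeval_eqnRep]
      exact ((mem_curve_iff H t).1 ht).2.2 k e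
  have h1 := hw _ _ (isMultihomogeneous_eqnRep p q k e) h0
  rw [← (aeval_dual _ _ _).2, aeval_eqnRep] at h1
  obtain ⟨r, hr, hrec⟩ := hy.recov_coords H
  obtain ⟨μ, hμ⟩ := (hy.isRep_phi H k e).exists_smul
  have hμ0 : μ ≠ 0 := fun h => hk (by rw [hμ, h, zero_smul])
  set z := coords (phi p q y) with hz
  have hrep : ∀ l, rep p q k (recov z) e l = r * (μ * z (e, l)) := fun l => by
    rw [funext hrec, rep_smul, hμ]; rfl
  -- At the three edges the displacement is a scaling by 1 + εa, 1 + εb, 1 + εc. Each coordinate of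
  -- `recov` has degree one at each of them, so all are multiplied by 1 + ε(a + b + c), and to first
  -- order the recovered projective point does not move.
  set m : DualNumber ℝ := TrivSqZeroExt.inl 1 + TrivSqZeroExt.inr (a + b + c) with hm
  have key : ∀ l₁ l₂ l₃, dual z w (eAB false false, l₁) * dual z w (eAB true false, l₂) *
      dual z w (eAB false true, l₃) = m * TrivSqZeroExt.inl (z (eAB false false, l₁) *
        z (eAB true false, l₂) * z (eAB false true, l₃)) := by
    intro l₁ l₂ l₃
    ext
    · simp [hm]
    · simp only [hm, TrivSqZeroExt.snd_mul, TrivSqZeroExt.fst_mul, fst_dual, snd_dual, ha, hb, hc,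
        MulOpposite.smul_eq_mul_unop, MulOpposite.unop_op, smul_eq_mul, TrivSqZeroExt.fst_add,
        TrivSqZeroExt.snd_add, TrivSqZeroExt.fst_inl, TrivSqZeroExt.snd_inl, TrivSqZeroExt.fst_inr,
        TrivSqZeroExt.snd_inr]
      ring
  have hrd : recov (dual z w) = fun i => m * (Algebra.ofId ℝ (DualNumber ℝ)) (recov z i) := by
    funext i
    have hneg : ∀ x : ℝ, (Algebra.ofId ℝ (DualNumber ℝ)) (-x) = -TrivSqZeroExt.inl x := fun x => by
      rw [map_neg]; rfl
    rcases i with ⟨_ | _, _ | _⟩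
    · simp only [recov, hneg, key]; ring
    · calc _ = dual z w (eAB false false, 0) * dual z w (eAB true false, 1) *
            dual z w (eAB false true, 1) := by simp only [recov]; ring
        _ = _ := by rw [key, recov, mul_comm (z (eAB true false, 1))]; rfl
    · simp only [recov, key]; rfl
    · calc _ = -(dual z w (eAB false false, 1) * dual z w (eAB true false, 0) *
            dual z w (eAB false true, 0)) := by simp only [recov]; ring
        _ = _ := by
          rw [key, recov, hneg, mul_neg]
          congr 3
          ring
  have h2 : ∀ l, rep p q k (recov (dual z w)) e l =
      m * TrivSqZeroExt.inl (r * (μ * z (e, l))) := fun l => by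
    rw [hrd, rep_smul, ← map_rep, hrep]; rfl
  rw [eqnRep, h2, h2] at h1
  simp only [hm, TrivSqZeroExt.snd_sub, TrivSqZeroExt.snd_mul, TrivSqZeroExt.fst_mul, fst_dual,
    snd_dual, MulOpposite.smul_eq_mul_unop, MulOpposite.unop_op, smul_eq_mul, TrivSqZeroExt.fst_add,
    TrivSqZeroExt.snd_add, TrivSqZeroExt.fst_inl, TrivSqZeroExt.snd_inl, TrivSqZeroExt.fst_inr,
    TrivSqZeroExt.snd_inr] at h1
  unfold moment
  refine mul_left_cancel₀ (mul_ne_zero hr hμ0) ?_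
  linear_combination -h1

end Moment

/-- Combinations of the Euler vectors and of a further vector. -/
def eulerMap (z L : Edge × Fin 2 → ℝ) : (Edge → ℝ) × ℝ →ₗ[ℝ] (Edge × Fin 2 → ℝ) where
  toFun a := fun i => a.1 i.1 * z i + a.2 * L i
  map_add' a b := by
    funext i
    simp only [Prod.fst_add, Prod.snd_add, Pi.add_apply]
    ring
  map_smul' c a := by
    funext i
    simp only [Prod.smul_fst, Prod.smul_snd, Pi.smul_apply, smul_eq_mul, RingHom.id_apply]
    ring

lemma eulerMap_apply (z L : Edge × Fin 2 → ℝ) (a : Edge → ℝ) (s : ℝ) (i : Edge × Fin 2) :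
    eulerMap z L (a, s) i = a i.1 * z i + s * L i := rfl

section Smooth

variable {p q : Bool → ℝ} (H : Params p q) {y : Bool × Bool → ℝ} (hy : OnCurve p q y)
include H hy

/-- If Y₂ ≠ 0, the tangent t₁₂ is a local parameter of the curve; otherwise Z₂ ≠ 0 and t₂₁ is one.
In either case the two moment relations carry the vanishing at that edge over to the three edges
that determine all others. -/
lemma exists_tangent_moment_ne_zero : ∃ (L : Edge × Fin 2 → ℝ) (e : Edge),
    IsTangent p q (coords (phi p q y)) L ∧ moment (coords (phi p q y)) L e ≠ 0 ∧
    ∀ w, IsTangent p q (coords (phi p q y)) w → moment (coords (phi p q y)) w e = 0 →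
      ∀ e', moment (coords (phi p q y)) w e' = 0 := by
  obtain ⟨L, hL, hm⟩ := exists_tangent H hy
  have hQ : ∀ i j, Q p q i j ^ 2 ≠ 0 := fun i j => pow_ne_zero 2 (H.Q_pos i j).ne'
  have hA := hy.A_ne_zero H
  have hB := hy.B_ne_zero H
  have x11 := (coords_eAB_zero H hy false false).2 hB
  have y11 := (coords_eAB_one H hy false false).2 hA
  have x21 := (coords_eAB_zero H hy true false).2 hB
  have y12 := (coords_eAB_one H hy false true).2 hA
  rcases hy.true_ne_zero H with h | h
  · refine ⟨L, eAB false true, hL, ?_, fun w hw hw0 => ?_⟩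
    · obtain ⟨c, hc, h1⟩ := hm false true
      unfold moment
      rw [h1]
      refine mul_ne_zero hc ?_
      have h2 : y (true, true) * field y (false, false) - y (false, false) * field y (true, true) =
          y (false, true) * y (true, false) * Q p q false true ^ 2 := by
        rw [H.Q_sq, ← hy false true]
        simp only [field, Bool.not_false, Bool.not_true]
        ring
      rw [h2]
      exact mul_ne_zero (mul_ne_zero h hB) (hQ _ _)
    · have h11 : moment (coords (phi p q y)) w (eAB false false) = 0 := by
        have := moment_eqnB H hy hw
        rw [hw0, mul_zero] at this
        exact (mul_eq_zero.1 this).resolve_left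
          (mul_ne_zero (mul_ne_zero (hQ _ _) x11) (pow_ne_zero 3 y12))
      refine moment_eq_zero H hy hw h11 hw0 ?_
      have := moment_eqnA H hy hw
      rw [h11, mul_zero] at this
      exact (mul_eq_zero.1 this.symm).resolve_left (mul_ne_zero (mul_ne_zero (hQ _ _)
        (pow_ne_zero 3 x11)) ((coords_eAB_one H hy true false).2 h))
  · refine ⟨L, eAB true false, hL, ?_, fun w hw hw0 => ?_⟩
    · obtain ⟨c, hc, h1⟩ := hm true false
      unfold moment
      rw [h1]
      refine mul_ne_zero hc ?_
      have h2 : y (true, false) * field y (false, true) - y (false, true) * field y (true, false) =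
          y (false, false) * y (true, true) * Q p q true false ^ 2 := by
        rw [H.Q_sq, ← hy true false]
        simp only [field, Bool.not_false, Bool.not_true]
        ring
      rw [h2]
      exact mul_ne_zero (mul_ne_zero hA h) (hQ _ _)
    · have h11 : moment (coords (phi p q y)) w (eAB false false) = 0 := by
        have := moment_eqnA H hy hw
        rw [hw0, mul_zero] at this
        exact (mul_eq_zero.1 this).resolve_left
          (mul_ne_zero (mul_ne_zero (hQ _ _) y11) (pow_ne_zero 3 x21))
      refine moment_eq_zero H hy hw h11 ?_ hw0
      have := moment_eqnB H hy hw
      rw [h11, mul_zero] at this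
      exact (mul_eq_zero.1 this.symm).resolve_left (mul_ne_zero (mul_ne_zero (hQ _ _)
        (pow_ne_zero 3 y11)) ((coords_eAB_zero H hy false true).2 h))

/-- Subtracting the right multiple of L makes the moment at `e` zero, hence all moments, and what
remains is an Euler vector at each edge. So the space has dimension 12 + 1. -/
lemma finrank_tangentSpace :
    Module.finrank ℝ (tangentSpace p q (coords (phi p q y))) = 13 := by
  obtain ⟨L, e, hL, hLe, h⟩ := exists_tangent_moment_ne_zero H hy
  set z := coords (phi p q y) with hz
  have hrange : LinearMap.range (eulerMap z L) = tangentSpace p q z := by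
    ext w
    rw [LinearMap.mem_range, mem_tangentSpace]
    constructor
    · rintro ⟨⟨a, s⟩, rfl⟩
      exact (tangentSpace p q z).add_mem (isTangent_euler ⟨y, hy, rfl⟩ a)
        ((tangentSpace p q z).smul_mem s hL)
    · intro hw
      set s := moment z w e / moment z L e with hs
      have hw' : IsTangent p q z (w + (-s) • L) :=
        (tangentSpace p q z).add_mem hw ((tangentSpace p q z).smul_mem (-s) hL)
      have h0 : moment z (w + (-s) • L) e = 0 := by
        have : moment z (w + (-s) • L) e = moment z w e - s * moment z L e := by
          simp only [moment, Pi.add_apply, Pi.smul_apply, smul_eq_mul]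
          ring
        rw [this, hs, div_mul_cancel₀ _ hLe, sub_self]
      choose a ha using fun e' =>
        exists_of_moment_eq_zero (homog_sq_pos (phi p q y e')).ne' (h _ hw' h0 e')
      refine ⟨(a, s), funext fun i => ?_⟩
      have := ha i.1 i.2
      simp only [Pi.add_apply, Pi.smul_apply, smul_eq_mul] at this
      rw [eulerMap_apply]
      linarith
  have hinj : Function.Injective (eulerMap z L) := by
    rw [← LinearMap.ker_eq_bot, LinearMap.ker_eq_bot']
    rintro ⟨a, s⟩ h0
    have h1 : ∀ e l, a e * z (e, l) + s * L (e, l) = 0 := fun e l => congrFun h0 (e, l)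
    have hs : s = 0 := by
      have h2 : s * moment z L e = 0 := by
        unfold moment
        linear_combination z (e, 0) * h1 e 1 - z (e, 1) * h1 e 0
      exact (mul_eq_zero.1 h2).resolve_right hLe
    have ha : a = 0 := by
      funext e'
      have h2 : a e' * (z (e', 0) ^ 2 + z (e', 1) ^ 2) = 0 := by
        have h3 := h1 e' 0
        have h4 := h1 e' 1
        rw [hs] at h3 h4
        linear_combination z (e', 0) * h3 + z (e', 1) * h4
      exact (mul_eq_zero.1 h2).resolve_right (homog_sq_pos (phi p q y e')).ne'
    rw [hs, ha]
    rfl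
  rw [← hrange, LinearMap.finrank_range_of_inj hinj, Module.finrank_prod,
    Module.finrank_fintype_fun_eq_card, card_edge, Module.finrank_self]

end Smooth

lemma finrank_add_finrank_of_dotProduct {n : Type*} [Fintype n] (S T : Submodule ℝ (n → ℝ))
    (h : ∀ w, w ∈ T ↔ ∀ v ∈ S, v ⬝ᵥ w = 0) :
    Module.finrank ℝ S + Module.finrank ℝ T = Fintype.card n := by
  classical
  have h1 : T = (S.map (dotProductEquiv ℝ n).toLinearMap).dualCoannihilator := by
    ext w
    rw [h, Submodule.mem_dualCoannihilator]
    simp only [Submodule.mem_map, forall_exists_index, and_imp, forall_apply_eq_imp_iff₂]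
    rfl
  have h2 := Subspace.finrank_add_finrank_dualCoannihilator_eq
    (S.map (dotProductEquiv ℝ n).toLinearMap)
  rw [← h1, Module.finrank_fintype_fun_eq_card] at h2
  rw [← h2, LinearEquiv.finrank_map_eq]

/-- The differentials span the annihilator of the tangent space of the cone, of dimension 24 − 13 =
11, the codimension of a curve in a product of twelve lines. -/
lemma isSmoothPoint_curve {p q : Bool → ℝ} (H : Params p q) {γ : Conf} (hγ : γ ∈ curve p q) :
    IsSmoothPoint (curve p q) γ := by
  obtain ⟨y, hy, rfl⟩ := hγ
  unfold IsSmoothPoint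
  have h := finrank_add_finrank_of_dotProduct (Submodule.span ℝ
    {v : Edge × Fin 2 → ℝ | ∃ (f : Poly) (d : Edge → ℕ), IsMultihomogeneous f d ∧
      (∀ t ∈ curve p q, MvPolynomial.eval (coords t) f = 0) ∧
      v = fun i => MvPolynomial.eval (coords (phi p q y)) (MvPolynomial.pderiv i f)})
    (tangentSpace p q (coords (phi p q y))) (fun w => by
      constructor
      · intro hw v hv
        induction hv using Submodule.span_induction with
        | mem v hv =>
          obtain ⟨f, d, hf, h0, rfl⟩ := hv
          exact hw f d hf h0
        | zero => simp
        | add u v _ _ hu hv => rw [add_dotProduct, hu, hv, add_zero]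
        | smul c v _ hv => rw [smul_dotProduct, hv, smul_zero]
      · intro hw f d hf h0
        exact hw _ (Submodule.subset_span ⟨f, d, hf, h0, rfl⟩))
  rw [finrank_tangentSpace H hy, Fintype.card_prod, card_edge, Fintype.card_fin] at h
  rw [card_edge]
  omega

/-! ### The explicit flexion -/

lemma sgn_sq (σ : ℤˣ) : sgn σ ^ 2 = 1 := by
  rcases Int.units_eq_one_or σ with rfl | rfl <;> simp [sgn]

lemma sgn_mul (σ τ : ℤˣ) : sgn (σ * τ) = sgn σ * sgn τ := by simp [sgn]

lemma exists_sgn_mul_abs (r : ℝ) : ∃ σ : ℤˣ, r = sgn σ * |r| := by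
  rcases abs_cases r with h | h
  · exact ⟨1, by simp [sgn, h.1]⟩
  · exact ⟨-1, by simp [sgn, h.1]⟩

lemma eq_of_sgn_mul_pos {σ τ : ℤˣ} {r : ℝ} (h : 0 < sgn σ * r) (h' : 0 < sgn τ * r) :
    σ = τ := by
  rcases Int.units_eq_one_or σ with rfl | rfl <;> rcases Int.units_eq_one_or τ with rfl | rfl <;>
    simp [sgn] at h h' ⊢ <;> linarith

/-- The signs of the coordinates. -/
def signs (δ₁ δ₂ ε₁ ε₂ : ℤˣ) : Bool × Bool → ℝ
  | (false, false) => sgn δ₁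
  | (false, true) => sgn δ₂
  | (true, false) => sgn ε₁
  | (true, true) => sgn ε₂

lemma signs_sq (δ₁ δ₂ ε₁ ε₂ : ℤˣ) (i : Bool × Bool) : signs δ₁ δ₂ ε₁ ε₂ i ^ 2 = 1 := by
  rcases i with ⟨_ | _, _ | _⟩ <;> exact sgn_sq _

/-! ### The parameter θ and the variable x = cos² θ -/

section Theta

variable {p q : Bool → ℝ} (H : Params p q)
include H

lemma Params.abs_p_lt_one : |p true| < 1 := by
  rw [← sq_lt_one_iff_abs_lt_one]
  linarith [H.one_sub_p_pos true]

lemma Params.abs_q_lt_one : |q true| < 1 := by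
  rw [← sq_lt_one_iff_abs_lt_one]
  linarith [H.one_sub_q_pos true]

lemma Params.abs_p_pos : 0 < |p true| := by
  rw [abs_pos]
  rintro h
  have := H.p_true_sq_pos
  rw [h] at this
  norm_num at this

lemma Params.abs_q_pos : 0 < |q true| := by
  rw [abs_pos]
  rintro h
  have := H.q_true_sq_pos
  rw [h] at this
  norm_num at this

lemma Params.thetaMin_pos : 0 < Real.arcsin |q true| := Real.arcsin_pos.2 H.abs_q_pos

lemma Params.thetaMax_lt : Real.arccos |p true| < Real.pi / 2 :=
  Real.arccos_lt_pi_div_two.2 H.abs_p_pos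

lemma sq_cos_thetaMin : Real.cos (Real.arcsin |q true|) ^ 2 = 1 - q true ^ 2 := by
  rw [Real.cos_sq', Real.sin_arcsin (by linarith [H.abs_q_pos]) H.abs_q_lt_one.le, sq_abs]

lemma sq_cos_thetaMax : Real.cos (Real.arccos |p true|) ^ 2 = p true ^ 2 := by
  rw [Real.cos_arccos (by linarith [H.abs_p_pos]) H.abs_p_lt_one.le, sq_abs]

omit H in
lemma strictAntiOn_sq_cos : StrictAntiOn (fun θ => Real.cos θ ^ 2) (Set.Icc 0 (Real.pi / 2)) := by
  intro a ha b hb hab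
  have h1 := Real.cos_lt_cos_of_nonneg_of_le_pi_div_two ha.1 hb.2 hab
  have h2 := Real.cos_nonneg_of_mem_Icc ⟨by linarith [hb.1, Real.pi_pos], hb.2⟩
  exact pow_lt_pow_left₀ h1 h2 two_ne_zero

omit H in
lemma arccos_sqrt_sq_cos {θ : ℝ} (h0 : 0 ≤ θ) (h1 : θ ≤ Real.pi / 2) :
    Real.arccos √(Real.cos θ ^ 2) = θ := by
  rw [Real.sqrt_sq (Real.cos_nonneg_of_mem_Icc ⟨by linarith [Real.pi_pos], h1⟩),
    Real.arccos_cos h0 (by linarith [Real.pi_pos])]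

omit H in
lemma sq_cos_arccos_sqrt {x : ℝ} (h0 : 0 ≤ x) (h1 : x ≤ 1) :
    Real.cos (Real.arccos √x) ^ 2 = x := by
  rw [Real.cos_arccos (by linarith [Real.sqrt_nonneg x]) (Real.sqrt_le_one.2 h1), Real.sq_sqrt h0]

lemma mem_quadrant_of_mem {θ : ℝ}
    (hθ : θ ∈ Set.Icc (Real.arcsin |q true|) (Real.arccos |p true|)) :
    θ ∈ Set.Icc 0 (Real.pi / 2) :=
  ⟨H.thetaMin_pos.le.trans hθ.1, hθ.2.trans H.thetaMax_lt.le⟩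

lemma thetaMin_lt_thetaMax : Real.arcsin |q true| < Real.arccos |p true| := by
  refine (strictAntiOn_sq_cos.lt_iff_gt ⟨Real.arccos_nonneg _, H.thetaMax_lt.le⟩
    ⟨H.thetaMin_pos.le, Real.arcsin_le_pi_div_two _⟩).1 ?_
  simp only [sq_cos_thetaMin H, sq_cos_thetaMax H]
  exact H.sq_lt_one_sub_sq

lemma sq_cos_mem_Icc {θ : ℝ} (hθ : θ ∈ Set.Icc (Real.arcsin |q true|) (Real.arccos |p true|)) :
    Real.cos θ ^ 2 ∈ Set.Icc (p true ^ 2) (1 - q true ^ 2) := by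
  have h := mem_quadrant_of_mem H hθ
  rw [← sq_cos_thetaMin H, ← sq_cos_thetaMax H]
  exact ⟨strictAntiOn_sq_cos.antitoneOn h ⟨Real.arccos_nonneg _, H.thetaMax_lt.le⟩ hθ.2,
    strictAntiOn_sq_cos.antitoneOn ⟨H.thetaMin_pos.le, Real.arcsin_le_pi_div_two _⟩ h hθ.1⟩

lemma sq_cos_mem_Ioo {θ : ℝ} (hθ : θ ∈ Set.Ioo (Real.arcsin |q true|) (Real.arccos |p true|)) :
    Real.cos θ ^ 2 ∈ Set.Ioo (p true ^ 2) (1 - q true ^ 2) := by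
  have h := mem_quadrant_of_mem H ⟨hθ.1.le, hθ.2.le⟩
  rw [← sq_cos_thetaMin H, ← sq_cos_thetaMax H]
  exact ⟨strictAntiOn_sq_cos h ⟨Real.arccos_nonneg _, H.thetaMax_lt.le⟩ hθ.2,
    strictAntiOn_sq_cos ⟨H.thetaMin_pos.le, Real.arcsin_le_pi_div_two _⟩ h hθ.1⟩

lemma exists_theta {x : ℝ} (hx : x ∈ Set.Icc (p true ^ 2) (1 - q true ^ 2)) :
    ∃ θ ∈ Set.Icc (Real.arcsin |q true|) (Real.arccos |p true|), Real.cos θ ^ 2 = x := by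
  have h0 : 0 ≤ x := (sq_nonneg _).trans hx.1
  have h1 : x ≤ 1 := hx.2.trans (by linarith [sq_nonneg (q true)])
  have e := sq_cos_arccos_sqrt h0 h1
  have hm : Real.arccos √x ∈ Set.Icc 0 (Real.pi / 2) :=
    ⟨Real.arccos_nonneg _, Real.arccos_le_pi_div_two.2 (Real.sqrt_nonneg _)⟩
  refine ⟨Real.arccos √x, ⟨?_, ?_⟩, e⟩
  · refine (strictAntiOn_sq_cos.le_iff_ge hm
      ⟨H.thetaMin_pos.le, Real.arcsin_le_pi_div_two _⟩).1 ?_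
    simp only [sq_cos_thetaMin H, e, hx.2]
  · refine (strictAntiOn_sq_cos.le_iff_ge ⟨Real.arccos_nonneg _, H.thetaMax_lt.le⟩ hm).1 ?_
    simp only [sq_cos_thetaMax H, e, hx.1]

/-- Both descriptions agree because √(1 − a²/c²) = √(c² − a²)/c for c > 0, applied to c = cos θ and
c = sin θ. -/
lemma flex_eq_oct {θ : ℝ} (hθ : θ ∈ Set.Icc (Real.arcsin |q true|) (Real.arccos |p true|))
    (δ₁ δ₂ ε₁ ε₂ : ℤˣ) : flex (p false) (p true) (q false) (q true) θ δ₁ δ₂ ε₁ ε₂ =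
      oct p q (arcPt p q (Real.cos θ ^ 2) (signs δ₁ δ₂ ε₁ ε₂)) := by
  have hx := sq_cos_mem_Icc H hθ
  have hm := mem_quadrant_of_mem H hθ
  have hc : 0 < Real.cos θ := Real.cos_pos_of_mem_Ioo
    ⟨by linarith [hm.1, Real.pi_pos], hθ.2.trans_lt H.thetaMax_lt⟩
  have hs : 0 < Real.sin θ := Real.sin_pos_of_pos_of_lt_pi (H.thetaMin_pos.trans_le hθ.1)
    (by linarith [hm.2, Real.pi_pos])
  have h1 := arcPt_A_sq H hx (signs_sq δ₁ δ₂ ε₁ ε₂) false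
  have h2 := arcPt_B_sq H hx (signs_sq δ₁ δ₂ ε₁ ε₂) false
  have e1 : √(arcPt p q (Real.cos θ ^ 2) (signs δ₁ δ₂ ε₁ ε₂) (false, false) ^ 2 + p false ^ 2)
      = Real.cos θ := by rw [h1, sub_add_cancel, Real.sqrt_sq hc.le]
  have e2 : √(arcPt p q (Real.cos θ ^ 2) (signs δ₁ δ₂ ε₁ ε₂) (true, false) ^ 2 + q false ^ 2)
      = Real.sin θ := by
    rw [h2, sub_add_cancel, ← Real.sin_sq, Real.sqrt_sq hs.le]
  have key : ∀ (a σ : ℝ) {c : ℝ}, 0 < c → σ * √(1 - a ^ 2 / c ^ 2) = σ * √(c ^ 2 - a ^ 2) / c := by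
    intro a σ c hc
    rw [show 1 - a ^ 2 / c ^ 2 = (c ^ 2 - a ^ 2) / c ^ 2 by field_simp,
      Real.sqrt_div' _ (sq_nonneg c), Real.sqrt_sq hc.le, mul_div_assoc]
  unfold oct
  rw [e1, e2]
  funext ⟨u, i⟩
  fin_cases u <;> cases i <;>
    simp only [flex, octPos, arcPt, signs, key _ _ hc, key _ _ hs, ← Real.sin_sq,
      sg_false, sg_true, one_mul, neg_mul]

omit H in
lemma exists_eq_arcPt {y : Bool × Bool → ℝ} (hy : OnCurve p q y) {δ₁ ε₁ : ℤˣ}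
    (h1 : 0 < sgn δ₁ * y (false, false)) (h2 : 0 < sgn ε₁ * y (true, false)) :
    ∃ x ∈ Set.Icc (p true ^ 2) (1 - q true ^ 2), ∃ δ₂ ε₂ : ℤˣ,
      y = arcPt p q x (signs δ₁ δ₂ ε₁ ε₂) := by
  obtain ⟨δ₂, hδ⟩ := exists_sgn_mul_abs (y (false, true))
  obtain ⟨ε₂, hε⟩ := exists_sgn_mul_abs (y (true, true))
  have key : ∀ {σ : ℤˣ} {r : ℝ}, 0 < sgn σ * r → r = sgn σ * |r| := by
    intro σ r h
    rcases Int.units_eq_one_or σ with rfl | rfl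
    · simp only [sgn, Units.val_one, Int.cast_one, one_mul] at h ⊢
      exact (abs_of_pos h).symm
    · simp only [sgn, Units.val_neg, Units.val_one, Int.cast_neg, Int.cast_one, neg_mul,
        one_mul] at h ⊢
      rw [abs_of_neg (by linarith), neg_neg]
  -- Computing x from Y₂ gives the lower bound for free, and the equation with Z₂ gives the upper
  -- one.
  refine ⟨y (false, true) ^ 2 + p true ^ 2, ⟨?_, ?_⟩, δ₂, ε₂, ?_⟩
  · linarith [sq_nonneg (y (false, true))]
  · linarith [hy true true, sq_nonneg (y (true, true))]
  · funext ⟨i, j⟩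
    have e1 : y (false, true) ^ 2 + p true ^ 2 - p false ^ 2 = y (false, false) ^ 2 := by
      linarith [hy.sq_sub_A]
    have e2 : ∀ j, 1 - (y (false, true) ^ 2 + p true ^ 2) - q j ^ 2 = y (true, j) ^ 2 := fun j => by
      linarith [hy true j]
    cases i <;> cases j <;> simp only [arcPt, signs, e1, e2, add_sub_cancel_right, Real.sqrt_sq_eq_abs]
    · exact key h1
    · exact hδ
    · exact key h2
    · exact hε

lemma sgn_mul_arcPt_pos {x : ℝ} (hx : x ∈ Set.Icc (p true ^ 2) (1 - q true ^ 2))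
    (δ₁ δ₂ ε₁ ε₂ : ℤˣ) : 0 < sgn δ₁ * arcPt p q x (signs δ₁ δ₂ ε₁ ε₂) (false, false) ∧
      0 < sgn ε₁ * arcPt p q x (signs δ₁ δ₂ ε₁ ε₂) (true, false) := by
  have hp := H.hp
  have hq := H.hq
  constructor
  · simp only [arcPt, signs, ← mul_assoc, ← sq, sgn_sq, one_mul]
    exact Real.sqrt_pos.2 (by linarith [hx.1])
  · simp only [arcPt, signs, ← mul_assoc, ← sq, sgn_sq, one_mul]
    exact Real.sqrt_pos.2 (by linarith [hx.2])

end Theta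

/-- The part of the curve where the product of the signs `δ₁`, `ε₁` is `σ`. -/
def curvePart (p q : Bool → ℝ) (σ : ℤˣ) : Set Conf :=
  phi p q '' {y | OnCurve p q y ∧ 0 < sgn σ * (y (false, false) * y (true, false))}

/-! ### The two pieces of the curve and their sign patterns -/

section Parts

variable {p q : Bool → ℝ} (H : Params p q)
include H

lemma curve_eq_union : curve p q = curvePart p q 1 ∪ curvePart p q (-1) := by
  ext t
  constructor
  · rintro ⟨y, hy, rfl⟩
    rcases (mul_ne_zero (hy.A_ne_zero H) (hy.B_ne_zero H)).lt_or_gt with h | h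
    · exact Or.inr ⟨y, ⟨hy, by simpa [sgn] using h⟩, rfl⟩
    · exact Or.inl ⟨y, ⟨hy, by simpa [sgn] using h⟩, rfl⟩
  · rintro (⟨y, ⟨hy, -⟩, rfl⟩ | ⟨y, ⟨hy, -⟩, rfl⟩) <;> exact ⟨y, hy, rfl⟩

omit H in
lemma curvePart_subset (σ : ℤˣ) : curvePart p q σ ⊆ curve p q := by
  rintro _ ⟨y, ⟨hy, -⟩, rfl⟩
  exact ⟨y, hy, rfl⟩

/-- The fibres of `phi` are pairs y, −y, and the sign of Y₁Z₁ is the same for both. -/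
lemma disjoint_curvePart {σ τ : ℤˣ} (h : σ ≠ τ) : Disjoint (curvePart p q σ) (curvePart p q τ) := by
  rw [Set.disjoint_left]
  rintro _ ⟨y, ⟨hy, h1⟩, rfl⟩ ⟨y', ⟨hy', h2⟩, he⟩
  refine h (eq_of_sgn_mul_pos h1 ?_)
  rcases hy.eq_or_neg_of_phi_eq H hy' he.symm with rfl | rfl
  · exact h2
  · simpa using h2

/-- On each part the sign of `Y₁` may be chosen. -/
lemma exists_of_mem_curvePart {δ₁ ε₁ : ℤˣ} {t : Conf} (ht : t ∈ curvePart p q (δ₁ * ε₁)) :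
    ∃ y, OnCurve p q y ∧ t = phi p q y ∧ 0 < sgn δ₁ * y (false, false) ∧
      0 < sgn ε₁ * y (true, false) := by
  obtain ⟨y, ⟨hy, h⟩, rfl⟩ := ht
  have h1 : 0 < sgn δ₁ * y (false, false) * (sgn ε₁ * y (true, false)) := by
    rw [sgn_mul] at h
    linarith
  rcases pos_and_pos_or_neg_and_neg_of_mul_pos h1 with ⟨h2, h3⟩ | ⟨h2, h3⟩
  · exact ⟨y, hy, rfl, h2, h3⟩
  · exact ⟨-y, hy.neg, (hy.phi_neg H).symm, by simpa using h2, by simpa using h3⟩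

lemma phi_arcPt_mem {x : ℝ} (hx : x ∈ Set.Icc (p true ^ 2) (1 - q true ^ 2))
    (δ₁ δ₂ ε₁ ε₂ : ℤˣ) :
    phi p q (arcPt p q x (signs δ₁ δ₂ ε₁ ε₂)) ∈ curvePart p q (δ₁ * ε₁) := by
  obtain ⟨h1, h2⟩ := sgn_mul_arcPt_pos H hx δ₁ δ₂ ε₁ ε₂
  refine ⟨_, ⟨onCurve_arcPt H hx (signs_sq _ _ _ _), ?_⟩, rfl⟩
  rw [sgn_mul]
  linarith [mul_pos h1 h2]

omit H in
lemma exists_arc (δ₂ ε₂ : ℤˣ) : ∃ k : Fin 4, arcDelta k = δ₂ ∧ arcEps k = ε₂ := by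
  revert δ₂ ε₂
  decide

omit H in
lemma arc_injective {k l : Fin 4} (h1 : arcDelta k = arcDelta l) (h2 : arcEps k = arcEps l) :
    k = l := by
  revert k l
  decide

lemma exists_arc_of_mem_curvePart {δ₁ ε₁ : ℤˣ} {t : Conf} (ht : t ∈ curvePart p q (δ₁ * ε₁)) :
    ∃ (k : Fin 4), ∃ θ ∈ Set.Icc (Real.arcsin |q true|) (Real.arccos |p true|),
      t = phi p q (arcPt p q (Real.cos θ ^ 2) (signs δ₁ (arcDelta k) ε₁ (arcEps k))) := by
  obtain ⟨y, hy, rfl, h1, h2⟩ := exists_of_mem_curvePart H ht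
  obtain ⟨x, hx, δ₂, ε₂, rfl⟩ := exists_eq_arcPt hy h1 h2
  obtain ⟨θ, hθ, rfl⟩ := exists_theta H hx
  obtain ⟨k, rfl, rfl⟩ := exists_arc δ₂ ε₂
  exact ⟨k, θ, hθ, rfl⟩

variable {ℓ : Edge → ℝ} (L : Lens ℓ p q)
include L

lemma isConfigOf_flex_iff {θ : ℝ}
    (hθ : θ ∈ Set.Icc (Real.arcsin |q true|) (Real.arccos |p true|)) (δ₁ δ₂ ε₁ ε₂ : ℤˣ)
    (t : Conf) : IsConfigOf ℓ (flex (p false) (p true) (q false) (q true) θ δ₁ δ₂ ε₁ ε₂) t ↔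
      t = phi p q (arcPt p q (Real.cos θ ^ 2) (signs δ₁ δ₂ ε₁ ε₂)) := by
  rw [flex_eq_oct H hθ]
  have := (onCurve_arcPt H (sq_cos_mem_Icc H hθ) (signs_sq δ₁ δ₂ ε₁ ε₂)).isConfigOf H L
  exact ⟨fun h => h.unique this, fun h => h ▸ this⟩

lemma flexComponent_eq (σ : ℤˣ) :
    flexComponent ℓ (p false) (p true) (q false) (q true) σ = curvePart p q σ := by
  ext t
  constructor
  · rintro ⟨θ, hθ, δ₁, δ₂, ε₁, ε₂, rfl, h⟩
    rw [isConfigOf_flex_iff H L hθ] at h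
    rw [h]
    exact phi_arcPt_mem H (sq_cos_mem_Icc H hθ) _ _ _ _
  · intro h
    rw [← one_mul σ] at h
    obtain ⟨k, θ, hθ, rfl⟩ := exists_arc_of_mem_curvePart H h
    exact ⟨θ, hθ, 1, _, σ, _, one_mul σ, (isConfigOf_flex_iff H L hθ _ _ _ _ _).2 rfl⟩

end Parts

/-! ### The parameter as a function on the curve -/

/-- The parameter `θ` as a function of the half-angle tangent at one edge. -/
noncomputable def theta (p q : Bool → ℝ) (t : Conf) : ℝ :=
  Real.arccos √(Q p q false false ^ 2 * coords t (eAB false false, 1) ^ 2 /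
    (coords t (eAB false false, 0) ^ 2 + coords t (eAB false false, 1) ^ 2) + p false ^ 2)

section Parts

variable {p q : Bool → ℝ} (H : Params p q)
include H

/-- From t₁₁ = −Z₁/Y₁ and Y₁² + Z₁² = Q₁₁² one gets Y₁² = Q₁₁²/(1 + t₁₁²), so θ is already a
function of t₁₁. -/
lemma theta_phi {y : Bool × Bool → ℝ} (hy : OnCurve p q y) :
    theta p q (phi p q y) = Real.arccos √(y (false, false) ^ 2 + p false ^ 2) := by
  obtain ⟨c, hc, h1, h2⟩ := hy.coords_scale H false false
  have h3 : 0 < coords (phi p q y) (eAB false false, 0) ^ 2 +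
    coords (phi p q y) (eAB false false, 1) ^ 2 := homog_sq_pos _
  unfold theta
  congr 3
  rw [H.Q_sq, ← hy false false, div_eq_iff h3.ne', h1, h2]
  simp only [sg_false]
  ring

lemma theta_phi_arcPt {θ : ℝ}
    (hθ : θ ∈ Set.Icc (Real.arcsin |q true|) (Real.arccos |p true|)) (δ₁ δ₂ ε₁ ε₂ : ℤˣ) :
    theta p q (phi p q (arcPt p q (Real.cos θ ^ 2) (signs δ₁ δ₂ ε₁ ε₂))) = θ := by
  have hx := sq_cos_mem_Icc H hθ
  have hm := mem_quadrant_of_mem H hθ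
  rw [theta_phi H (onCurve_arcPt H hx (signs_sq δ₁ δ₂ ε₁ ε₂)), arcPt_A_sq H hx (signs_sq _ _ _ _),
    sub_add_cancel, arccos_sqrt_sq_cos hm.1 hm.2]

lemma theta_image (σ : ℤˣ) : theta p q '' curvePart p q σ =
    Set.Icc (Real.arcsin |q true|) (Real.arccos |p true|) := by
  ext θ
  rw [← one_mul σ]
  constructor
  · rintro ⟨t, ht, rfl⟩
    obtain ⟨k, θ, hθ, rfl⟩ := exists_arc_of_mem_curvePart H ht
    rwa [theta_phi_arcPt H hθ]
  · intro hθ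
    exact ⟨_, phi_arcPt_mem H (sq_cos_mem_Icc H hθ) 1 1 σ 1, theta_phi_arcPt H hθ _ _ _ _⟩

lemma signs_eq_of_arcPt_eq {x : ℝ} (hx : x ∈ Set.Ioo (p true ^ 2) (1 - q true ^ 2))
    {δ₁ δ₂ δ₂' ε₁ ε₂ ε₂' : ℤˣ}
    (h : phi p q (arcPt p q x (signs δ₁ δ₂ ε₁ ε₂)) = phi p q (arcPt p q x (signs δ₁ δ₂' ε₁ ε₂'))) :
    δ₂ = δ₂' ∧ ε₂ = ε₂' := by
  have hx' : x ∈ Set.Icc (p true ^ 2) (1 - q true ^ 2) := ⟨hx.1.le, hx.2.le⟩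
  have e := (onCurve_arcPt H hx' (signs_sq δ₁ δ₂ ε₁ ε₂)).eq_of_phi_eq H
    (onCurve_arcPt H hx' (signs_sq δ₁ δ₂' ε₁ ε₂')) h false (by
      have h1 := (sgn_mul_arcPt_pos H hx' δ₁ δ₂ ε₁ ε₂).1
      have h2 := (sgn_mul_arcPt_pos H hx' δ₁ δ₂' ε₁ ε₂').1
      nlinarith [mul_pos h1 h2, sgn_sq δ₁])
  have hinj : ∀ {σ τ : ℤˣ}, sgn σ = sgn τ → σ = τ := fun h =>
    Units.ext (Int.cast_injective h)
  have h1 := congrFun e (false, true)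
  have h2 := congrFun e (true, true)
  simp only [arcPt, signs] at h1 h2
  constructor
  · exact hinj (mul_right_cancel₀ (Real.sqrt_pos.2 (sub_pos.2 hx.1)).ne' h1.symm)
  · exact hinj (mul_right_cancel₀ (Real.sqrt_pos.2 (by linarith [hx.2])).ne' h2.symm)

/-- Normalize δ₁ = 1, so that ε₁ = σ. At an interior θ both Y₂ and Z₂ are nonzero, and the four
choices of their signs give distinct points. -/
lemma ncard_theta_fiber (σ : ℤˣ) {θ : ℝ}
    (hθ : θ ∈ Set.Ioo (Real.arcsin |q true|) (Real.arccos |p true|)) :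
    {t ∈ curvePart p q σ | theta p q t = θ}.ncard = 4 := by
  have hθ' : θ ∈ Set.Icc (Real.arcsin |q true|) (Real.arccos |p true|) := ⟨hθ.1.le, hθ.2.le⟩
  have h1 : {t ∈ curvePart p q σ | theta p q t = θ} = Set.range fun k : Fin 4 =>
      phi p q (arcPt p q (Real.cos θ ^ 2) (signs 1 (arcDelta k) σ (arcEps k))) := by
    ext t
    rw [← one_mul σ]
    constructor
    · rintro ⟨ht, h⟩
      obtain ⟨k, θ', hθ', rfl⟩ := exists_arc_of_mem_curvePart H ht
      rw [theta_phi_arcPt H hθ'] at h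
      rw [h]
      exact ⟨k, by rw [one_mul]⟩
    · rintro ⟨k, rfl⟩
      rw [one_mul]
      refine ⟨?_, theta_phi_arcPt H hθ' _ _ _ _⟩
      have := phi_arcPt_mem H (sq_cos_mem_Icc H hθ') 1 (arcDelta k) σ (arcEps k)
      rwa [one_mul] at this
  have h2 : Function.Injective fun k : Fin 4 =>
      phi p q (arcPt p q (Real.cos θ ^ 2) (signs 1 (arcDelta k) σ (arcEps k))) := by
    intro k l h
    obtain ⟨h1, h2⟩ := signs_eq_of_arcPt_eq H (sq_cos_mem_Ioo H hθ) h
    exact arc_injective h1 h2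
  rw [h1, ← Set.image_univ, Set.ncard_image_of_injective _ h2, Set.ncard_univ, Nat.card_fin]

end Parts

/-! ### The components are circles -/

/-- The periodic piecewise linear function with values `0, 1, 0, 1, 0` at `0, 1, 2, 3, 4`. -/
def zigzag (τ : ℝ) : ℝ := 1 - |(|τ - 2| - 1)|

lemma continuous_zigzag : Continuous zigzag := by
  unfold zigzag
  fun_prop

lemma zigzag_mem {τ : ℝ} (h : τ ∈ Set.Icc 0 4) : zigzag τ ∈ Set.Icc 0 1 := by
  unfold zigzag
  have h1 : |τ - 2| ≤ 2 := abs_le.2 ⟨by linarith [h.1], by linarith [h.2]⟩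
  have h2 : |(|τ - 2| - 1)| ≤ 1 := abs_le.2 ⟨by linarith [abs_nonneg (τ - 2)], by linarith⟩
  exact ⟨by linarith, by linarith [abs_nonneg (|τ - 2| - 1)]⟩

/-- The two inequalities tell the four monotone pieces apart. Each may be dropped at the height
where the pieces it separates are joined, since the other one still distinguishes the remaining
candidates. -/
lemma eq_of_zigzag_eq {τ τ' : ℝ} (h : τ ∈ Set.Ico 0 4) (h' : τ' ∈ Set.Ico 0 4)
    (hz : zigzag τ = zigzag τ') (h1 : zigzag τ ≠ 1 → (1 ≤ |τ - 2| ↔ 1 ≤ |τ' - 2|))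
    (h2 : zigzag τ ≠ 0 → (τ ≤ 2 ↔ τ' ≤ 2)) : τ = τ' := by
  obtain ⟨a1, a2⟩ := h
  obtain ⟨b1, b2⟩ := h'
  unfold zigzag at *
  rcases abs_cases (τ - 2) with hA | hA <;> rcases abs_cases (τ' - 2) with hB | hB <;>
    rcases abs_cases (|τ - 2| - 1) with hC | hC <;>
    rcases abs_cases (|τ' - 2| - 1) with hD | hD <;> grind

/-- The parameter `θ` on the circle. -/
noncomputable def pathTheta (p q : Bool → ℝ) (τ : ℝ) : ℝ :=
  Real.arcsin |q true| + zigzag τ * (Real.arccos |p true| - Real.arcsin |q true|)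

/-- The sign `δ₂` on the circle. -/
noncomputable def pathDelta (τ : ℝ) : ℤˣ := if 1 ≤ |τ - 2| then 1 else -1

lemma pathDelta_eq_one {τ : ℝ} : pathDelta τ = 1 ↔ 1 ≤ |τ - 2| := by
  unfold pathDelta
  split_ifs with h
  · simp [h]
  · simp only [h, iff_false]; decide

/-- The sign `ε₂` on the circle. -/
noncomputable def pathEps (τ : ℝ) : ℤˣ := if τ ≤ 2 then 1 else -1

lemma pathEps_eq_one {τ : ℝ} : pathEps τ = 1 ↔ τ ≤ 2 := by
  unfold pathEps
  split_ifs with h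
  · simp [h]
  · simp only [h, iff_false]; decide

/-- The parametrization of a component by a circle. -/
noncomputable def pathPt (p q : Bool → ℝ) (δ₁ ε₁ : ℤˣ) (τ : ℝ) : Bool × Bool → ℝ :=
  arcPt p q (Real.cos (pathTheta p q τ) ^ 2) (signs δ₁ (pathDelta τ) ε₁ (pathEps τ))

section Path

variable {p q : Bool → ℝ} (H : Params p q) (δ₁ ε₁ : ℤˣ)
include H

lemma zigzag_combo_mem {r : ℝ} (hr : r ∈ Set.Icc 0 1) :
    Real.arcsin |q true| + r * (Real.arccos |p true| - Real.arcsin |q true|) ∈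
      Set.Icc (Real.arcsin |q true|) (Real.arccos |p true|) := by
  have h := thetaMin_lt_thetaMax H
  constructor <;> nlinarith [hr.1, hr.2]

lemma pathTheta_mem {τ : ℝ} (h : τ ∈ Set.Icc 0 4) :
    pathTheta p q τ ∈ Set.Icc (Real.arcsin |q true|) (Real.arccos |p true|) :=
  zigzag_combo_mem H (zigzag_mem h)

omit H in
lemma continuous_pathTheta : Continuous (pathTheta p q) :=
  continuous_const.add (continuous_zigzag.mul continuous_const)

lemma sqrt_eq_zero_of_zigzag_eq_one {τ : ℝ} (h : zigzag τ = 1) :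
    √(Real.cos (pathTheta p q τ) ^ 2 - p true ^ 2) = 0 := by
  rw [pathTheta, h, one_mul, add_sub_cancel, sq_cos_thetaMax H, sub_self, Real.sqrt_zero]

lemma sqrt_eq_zero_of_zigzag_eq_zero {τ : ℝ} (h : zigzag τ = 0) :
    √(1 - Real.cos (pathTheta p q τ) ^ 2 - q true ^ 2) = 0 := by
  rw [pathTheta, h, zero_mul, add_zero, sq_cos_thetaMin H, sub_sub_cancel, sub_self, Real.sqrt_zero]

/-- Each sign jumps only where the square root that it multiplies is zero. -/
lemma continuous_pathPt : Continuous (pathPt p q δ₁ ε₁) := by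
  have hx : Continuous fun τ => Real.cos (pathTheta p q τ) ^ 2 :=
    (Real.continuous_cos.comp continuous_pathTheta).pow 2
  refine continuous_pi ?_
  rintro ⟨_ | _, _ | _⟩ <;> simp only [pathPt, arcPt, signs]
  · exact continuous_const.mul (hx.sub continuous_const).sqrt
  · have h1 : (fun τ => sgn (pathDelta τ) * √(Real.cos (pathTheta p q τ) ^ 2 - p true ^ 2)) =
        fun τ => if 1 ≤ |τ - 2| then √(Real.cos (pathTheta p q τ) ^ 2 - p true ^ 2)
          else -√(Real.cos (pathTheta p q τ) ^ 2 - p true ^ 2) := by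
      funext τ
      unfold pathDelta
      split_ifs <;> simp [sgn]
    rw [h1]
    refine Continuous.if_le (hx.sub continuous_const).sqrt (hx.sub continuous_const).sqrt.neg
      continuous_const (by fun_prop) fun τ hτ => ?_
    rw [sqrt_eq_zero_of_zigzag_eq_one H (by simp [zigzag, ← hτ]), neg_zero]
  · exact continuous_const.mul ((continuous_const.sub hx).sub continuous_const).sqrt
  · have h1 : (fun τ => sgn (pathEps τ) * √(1 - Real.cos (pathTheta p q τ) ^ 2 - q true ^ 2)) =
        fun τ => if τ ≤ 2 then √(1 - Real.cos (pathTheta p q τ) ^ 2 - q true ^ 2)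
          else -√(1 - Real.cos (pathTheta p q τ) ^ 2 - q true ^ 2) := by
      funext τ
      unfold pathEps
      split_ifs <;> simp [sgn]
    rw [h1]
    refine Continuous.if_le ((continuous_const.sub hx).sub continuous_const).sqrt
      ((continuous_const.sub hx).sub continuous_const).sqrt.neg
      continuous_id continuous_const fun τ hτ => ?_
    rw [sqrt_eq_zero_of_zigzag_eq_zero H (by simp [zigzag, show τ = 2 from hτ]), neg_zero]

lemma arcPt_signs_congr {θ : ℝ} {δ₂ δ₂' ε₂ ε₂' : ℤˣ}
    (hδ : δ₂ = δ₂' ∨ θ = Real.arccos |p true|) (hε : ε₂ = ε₂' ∨ θ = Real.arcsin |q true|) :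
    arcPt p q (Real.cos θ ^ 2) (signs δ₁ δ₂ ε₁ ε₂) =
      arcPt p q (Real.cos θ ^ 2) (signs δ₁ δ₂' ε₁ ε₂') := by
  funext ⟨i, j⟩
  cases i <;> cases j <;> simp only [arcPt, signs]
  · rcases hδ with rfl | rfl
    · rfl
    · rw [sq_cos_thetaMax H, sub_self, Real.sqrt_zero, mul_zero, mul_zero]
  · rcases hε with rfl | rfl
    · rfl
    · rw [sq_cos_thetaMin H, sub_sub_cancel, sub_self, Real.sqrt_zero, mul_zero, mul_zero]

lemma pathPt_arc (k : Fin 4) {s : ℝ} (hs : s ∈ Set.Icc 0 1) :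
    pathPt p q δ₁ ε₁ ((k : ℕ) + s) =
      arcPt p q (Real.cos (arcTheta (Real.arcsin |q true|) (Real.arccos |p true|) k s) ^ 2)
        (signs δ₁ (arcDelta k) ε₁ (arcEps k)) := by
  obtain ⟨h0, h1⟩ := hs
  have key : ∀ {τ θ : ℝ} {k : Fin 4}, pathTheta p q τ = θ →
      (pathDelta τ = arcDelta k ∨ θ = Real.arccos |p true|) →
      (pathEps τ = arcEps k ∨ θ = Real.arcsin |q true|) →
      pathPt p q δ₁ ε₁ τ = arcPt p q (Real.cos θ ^ 2) (signs δ₁ (arcDelta k) ε₁ (arcEps k)) := by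
    rintro τ θ k rfl hδ hε
    exact arcPt_signs_congr H δ₁ ε₁ hδ hε
  fin_cases k
  · have e : |((0 : ℕ) : ℝ) + s - 2| = 2 - s := by
      rw [abs_of_nonpos] <;> push_cast <;> linarith
    have e2 : |2 - s - 1| = 1 - s := by rw [abs_of_nonneg] <;> linarith
    refine key ?_ (Or.inl ?_) (Or.inl ?_)
    · simp only [pathTheta, zigzag, e, e2, arcTheta]
      simp
    · rw [pathDelta, e, if_pos (by linarith)]; rfl
    · rw [pathEps, if_pos (by push_cast; linarith)]; rfl
  · have e : |((1 : ℕ) : ℝ) + s - 2| = 1 - s := by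
      rw [abs_of_nonpos] <;> push_cast <;> linarith
    have e2 : |1 - s - 1| = s := by rw [abs_of_nonpos] <;> linarith
    refine key ?_ ?_ (Or.inl ?_)
    · simp only [pathTheta, zigzag, e, e2, arcTheta]
      simp
      ring
    -- At the initial point of this arc `pathDelta` still has its previous value, but there θ = θmax
    -- and the sign multiplies zero.
    · rcases h0.eq_or_lt with rfl | h0
      · right; simp [arcTheta]
      · left; rw [pathDelta, e, if_neg (by linarith)]; rfl
    · rw [pathEps, if_pos (by push_cast; linarith)]; rfl
  · have e : |((2 : ℕ) : ℝ) + s - 2| = s := by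
      rw [abs_of_nonneg] <;> push_cast <;> linarith
    have e2 : |s - 1| = 1 - s := by rw [abs_of_nonpos] <;> linarith
    have ev : Even (2 : ℕ) := even_two
    refine key ?_ ?_ ?_
    · simp only [pathTheta, zigzag, e, e2, arcTheta]
      simp
    · rcases h1.eq_or_lt with rfl | h1
      · right; simp [arcTheta]
      · left; rw [pathDelta, e, if_neg (by linarith)]; rfl
    · rcases h0.eq_or_lt with rfl | h0
      · right; simp [arcTheta]
      · left; rw [pathEps, if_neg (by push_cast; linarith)]; rfl
  · have e : |((3 : ℕ) : ℝ) + s - 2| = 1 + s := by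
      rw [abs_of_nonneg] <;> push_cast <;> linarith
    have e2 : |1 + s - 1| = s := by rw [abs_of_nonneg] <;> linarith
    have ev : ¬ Even (3 : ℕ) := by decide
    refine key ?_ (Or.inl ?_) (Or.inl ?_)
    · simp only [pathTheta, zigzag, e, e2, arcTheta]
      simp [ev]
      ring
    · rw [pathDelta, e, if_pos (by linarith)]; rfl
    · rw [pathEps, if_neg (by push_cast; linarith)]; rfl

lemma onCurve_pathPt {τ : ℝ} (h : τ ∈ Set.Icc 0 4) : OnCurve p q (pathPt p q δ₁ ε₁ τ) :=
  onCurve_arcPt H (sq_cos_mem_Icc H (pathTheta_mem H h)) (signs_sq _ _ _ _)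

lemma phi_pathPt_mem {τ : ℝ} (h : τ ∈ Set.Icc 0 4) :
    phi p q (pathPt p q δ₁ ε₁ τ) ∈ curvePart p q (δ₁ * ε₁) :=
  phi_arcPt_mem H (sq_cos_mem_Icc H (pathTheta_mem H h)) _ _ _ _

/-- The value of θ gives the height of `zigzag`. With the sign of Y₁ fixed the point y is
determined, and its coordinates Y₂, Z₂ give the signs wherever they are nonzero, which is what
`eq_of_zigzag_eq` asks for. -/
lemma injOn_phi_pathPt : Set.InjOn (fun τ => phi p q (pathPt p q δ₁ ε₁ τ)) (Set.Ico 0 4) := by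
  intro τ hτ τ' hτ' h
  have m : ∀ {τ : ℝ}, τ ∈ Set.Ico (0 : ℝ) 4 → τ ∈ Set.Icc (0 : ℝ) 4 := fun h => ⟨h.1, h.2.le⟩
  have x := sq_cos_mem_Icc H (pathTheta_mem H (m hτ))
  have hθ : pathTheta p q τ = pathTheta p q τ' := by
    have := congrArg (theta p q) h
    simpa only [pathPt, theta_phi_arcPt H (pathTheta_mem H (m hτ)),
      theta_phi_arcPt H (pathTheta_mem H (m hτ'))] using this
  have hpos := (sub_pos.2 (thetaMin_lt_thetaMax H))
  have hz : zigzag τ = zigzag τ' := by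
    unfold pathTheta at hθ
    exact mul_right_cancel₀ hpos.ne' (add_left_cancel hθ)
  have e := (onCurve_pathPt H δ₁ ε₁ (m hτ)).eq_of_phi_eq H (onCurve_pathPt H δ₁ ε₁ (m hτ')) h false
    (by
      have h1 := (sgn_mul_arcPt_pos H x δ₁ (pathDelta τ) ε₁ (pathEps τ)).1
      have h2 := (sgn_mul_arcPt_pos H (sq_cos_mem_Icc H (pathTheta_mem H (m hτ')))
        δ₁ (pathDelta τ') ε₁ (pathEps τ')).1
      simp only [pathPt]
      nlinarith [mul_pos h1 h2, sgn_sq δ₁])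
  simp only [pathPt, ← hθ] at e
  have hinj : ∀ {σ τ : ℤˣ}, sgn σ = sgn τ → σ = τ := fun h => Units.ext (Int.cast_injective h)
  have e1 := congrFun e (false, true)
  have e2 := congrFun e (true, true)
  simp only [arcPt, signs] at e1 e2
  have hm := mem_quadrant_of_mem H (pathTheta_mem H (m hτ))
  have hlt := thetaMin_lt_thetaMax H
  refine eq_of_zigzag_eq hτ hτ' hz (fun h1 => ?_) (fun h0 => ?_)
  · have h2 : pathTheta p q τ < Real.arccos |p true| := by
      have := (zigzag_mem (m hτ)).2.lt_of_ne h1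
      unfold pathTheta
      nlinarith
    have h3 := strictAntiOn_sq_cos hm ⟨Real.arccos_nonneg _, H.thetaMax_lt.le⟩ h2
    simp only [sq_cos_thetaMax H] at h3
    have h4 := hinj (mul_right_cancel₀ (Real.sqrt_pos.2 (sub_pos.2 h3)).ne' e1)
    rw [← pathDelta_eq_one, ← pathDelta_eq_one, h4]
  · have h2 : Real.arcsin |q true| < pathTheta p q τ := by
      have := (zigzag_mem (m hτ)).1.lt_of_ne' h0
      unfold pathTheta
      nlinarith
    have h3 := strictAntiOn_sq_cos ⟨H.thetaMin_pos.le, Real.arcsin_le_pi_div_two _⟩ hm h2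
    simp only [sq_cos_thetaMin H] at h3
    have h4 := hinj (mul_right_cancel₀ (Real.sqrt_pos.2 (by linarith)).ne' e2)
    rw [← pathEps_eq_one, ← pathEps_eq_one, h4]

lemma exists_pathPt {t : Conf} (ht : t ∈ curvePart p q (δ₁ * ε₁)) :
    ∃ τ ∈ Set.Icc (0 : ℝ) 4, t = phi p q (pathPt p q δ₁ ε₁ τ) := by
  obtain ⟨k, θ, hθ, rfl⟩ := exists_arc_of_mem_curvePart H ht
  have hpos := (sub_pos.2 (thetaMin_lt_thetaMax H))
  have h1 := hθ.1
  have h2 := hθ.2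
  obtain ⟨s, hs, hsθ⟩ : ∃ s ∈ Set.Icc (0 : ℝ) 1,
      arcTheta (Real.arcsin |q true|) (Real.arccos |p true|) k s = θ := by
    unfold arcTheta
    split_ifs
    · refine ⟨(θ - Real.arcsin |q true|) / (Real.arccos |p true| - Real.arcsin |q true|),
        ⟨div_nonneg (by linarith) hpos.le, (div_le_one hpos).2 (by linarith)⟩, ?_⟩
      field_simp
      ring
    · refine ⟨(Real.arccos |p true| - θ) / (Real.arccos |p true| - Real.arcsin |q true|),
        ⟨div_nonneg (by linarith) hpos.le, (div_le_one hpos).2 (by linarith)⟩, ?_⟩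
      field_simp
      ring
  refine ⟨(k : ℕ) + s, ⟨by linarith [hs.1, (Nat.cast_nonneg (k : ℕ) : (0 : ℝ) ≤ _)], ?_⟩, ?_⟩
  · have : ((k : ℕ) : ℝ) ≤ 3 := by exact_mod_cast (by omega : (k : ℕ) ≤ 3)
    linarith [hs.2]
  · rw [pathPt_arc H δ₁ ε₁ k hs, hsθ]

/-- The signs ε₂ at the two ends disagree, but both ends have θ = θmin, where Z₂ = 0. -/
lemma pathPt_four : pathPt p q δ₁ ε₁ 4 = pathPt p q δ₁ ε₁ 0 := by
  have h1 := pathPt_arc H δ₁ ε₁ 3 (s := 1) (by simp)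
  have h2 := pathPt_arc H δ₁ ε₁ 0 (s := 0) (by simp)
  have e1 : ((3 : Fin 4) : ℕ) + (1 : ℝ) = 4 := by norm_num [show ((3 : Fin 4) : ℕ) = 3 from rfl]
  have e2 : ((0 : Fin 4) : ℕ) + (0 : ℝ) = 0 := by simp
  rw [e1] at h1
  rw [e2] at h2
  rw [h1, h2]
  have ev : ¬ Even (3 : ℕ) := by decide
  have t1 : arcTheta (Real.arcsin |q true|) (Real.arccos |p true|) 3 1 = Real.arcsin |q true| := by
    simp [arcTheta, ev]
  have t2 : arcTheta (Real.arcsin |q true|) (Real.arccos |p true|) 0 0 = Real.arcsin |q true| := by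
    simp [arcTheta]
  rw [t1, t2]
  exact arcPt_signs_congr H δ₁ ε₁ (Or.inl rfl) (Or.inr rfl)

/-- The parametrization of a component by a circle. -/
lemma exists_homeomorph : ∃ h : AddCircle (4 : ℝ) ≃ₜ curvePart p q (δ₁ * ε₁),
    ∀ τ ∈ Set.Icc (0 : ℝ) 4, (h (τ : AddCircle (4 : ℝ)) : Conf) =
      phi p q (pathPt p q δ₁ ε₁ τ) := by
  have : Fact ((0 : ℝ) < 4) := ⟨by norm_num⟩
  set g : ℝ → Conf := fun τ => phi p q (pathPt p q δ₁ ε₁ τ) with hg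
  have hgc : ContinuousOn g (Set.Icc 0 4) :=
    (continuousOn_phi H).comp (continuous_pathPt H δ₁ ε₁).continuousOn
      fun τ hτ => onCurve_pathPt H δ₁ ε₁ hτ
  have hg4 : g 0 = g 4 := by simp only [hg, pathPt_four H]
  set F : AddCircle (4 : ℝ) → Conf := AddCircle.liftIco 4 0 g with hF
  have hFτ : ∀ τ ∈ Set.Icc (0 : ℝ) 4, F (τ : AddCircle (4 : ℝ)) = g τ := by
    intro τ hτ
    rcases hτ.2.eq_or_lt with rfl | h4
    · have : ((4 : ℝ) : AddCircle (4 : ℝ)) = ((0 : ℝ) : AddCircle (4 : ℝ)) := by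
        rw [AddCircle.coe_period]; simp
      rw [this, hF, AddCircle.liftIco_coe_apply (by simp), hg4]
    · exact AddCircle.liftIco_coe_apply (by simpa using ⟨hτ.1, h4⟩)
  have hFc : Continuous F := AddCircle.liftIco_continuous (by simpa using hg4) (by simpa using hgc)
  have hrep : ∀ a : AddCircle (4 : ℝ), ∃ τ ∈ Set.Ico (0 : ℝ) 4, (τ : AddCircle (4 : ℝ)) = a := by
    intro a
    have := AddCircle.coe_image_Ico_eq (4 : ℝ) 0
    obtain ⟨τ, hτ, h⟩ := this.symm ▸ Set.mem_univ a
    exact ⟨τ, by simpa using hτ, h⟩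
  have hmem : ∀ a, F a ∈ curvePart p q (δ₁ * ε₁) := by
    intro a
    obtain ⟨τ, hτ, rfl⟩ := hrep a
    rw [hFτ τ ⟨hτ.1, hτ.2.le⟩]
    exact phi_pathPt_mem H δ₁ ε₁ ⟨hτ.1, hτ.2.le⟩
  have hbij : Function.Bijective fun a => (⟨F a, hmem a⟩ : curvePart p q (δ₁ * ε₁)) := by
    constructor
    · intro a b hab
      obtain ⟨τ, hτ, rfl⟩ := hrep a
      obtain ⟨τ', hτ', rfl⟩ := hrep b
      have h := congrArg Subtype.val hab
      simp only [hFτ τ ⟨hτ.1, hτ.2.le⟩, hFτ τ' ⟨hτ'.1, hτ'.2.le⟩] at h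
      rw [injOn_phi_pathPt H δ₁ ε₁ hτ hτ' h]
    · rintro ⟨t, ht⟩
      obtain ⟨τ, hτ, rfl⟩ := exists_pathPt H δ₁ ε₁ ht
      exact ⟨τ, Subtype.ext (hFτ τ hτ)⟩
  -- A continuous bijection from the compact circle to a Hausdorff space is a homeomorphism.
  refine ⟨Continuous.homeoOfEquivCompactToT2 (f := Equiv.ofBijective _ hbij)
    (hFc.subtype_mk hmem), fun τ hτ => ?_⟩
  exact hFτ τ hτ

lemma isConnected_curvePart (σ : ℤˣ) : IsConnected (curvePart p q σ) := by
  obtain ⟨h, -⟩ := exists_homeomorph H 1 σ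
  rw [one_mul] at h
  have : ConnectedSpace (curvePart p q σ) := h.surjective.connectedSpace h.continuous
  exact isConnected_iff_connectedSpace.2 this

lemma isClosed_curvePart (σ : ℤˣ) : IsClosed (curvePart p q σ) := by
  obtain ⟨h, -⟩ := exists_homeomorph H 1 σ
  rw [one_mul] at h
  have : Fact ((0 : ℝ) < 4) := ⟨by norm_num⟩
  have : CompactSpace (curvePart p q σ) := h.compactSpace
  exact (isCompact_iff_compactSpace.2 this).isClosed

/-- The two pieces are compact, hence closed, and disjoint, so a connected subset of the curve lies
in one of them; each piece is connected as the image of a circle. -/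
lemma connectedComponentIn_curve (σ : ℤˣ) {γ : Conf} (hγ : γ ∈ curvePart p q σ) :
    connectedComponentIn (curve p q) γ = curvePart p q σ := by
  have hmem := curvePart_subset σ hγ
  refine Set.Subset.antisymm ?_ ((isConnected_curvePart H σ).isPreconnected.subset_connectedComponentIn
    hγ (curvePart_subset σ))
  have hu : curve p q ⊆ curvePart p q σ ∪ curvePart p q (-σ) := by
    rw [curve_eq_union H]
    rcases Int.units_eq_one_or σ with rfl | rfl
    · exact le_rfl
    · rw [neg_neg, Set.union_comm]
  have hd : Disjoint (curvePart p q σ) (curvePart p q (-σ)) :=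
    disjoint_curvePart H (by
      rcases Int.units_eq_one_or σ with rfl | rfl <;> decide)
  have := isPreconnected_iff_subset_of_disjoint_closed.1
    (isPreconnected_connectedComponentIn (F := curve p q) (x := γ)) _ _
    (isClosed_curvePart H σ) (isClosed_curvePart H (-σ))
    ((connectedComponentIn_subset _ _).trans hu) (by
      rw [Set.disjoint_iff_inter_eq_empty.1 hd, Set.inter_empty])
  rcases this with h | h
  · exact h
  · exact absurd (h (mem_connectedComponentIn hmem)) (Set.disjoint_left.1 hd hγ)

end Path

/-! ### Recovering an octahedron from its half-angle tangents -/

/-- The real number `t`, or `0` if `t = ∞`. -/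
noncomputable def fval (t : OnePoint ℝ) : ℝ := t.elim 0 id

@[simp] lemma fval_coe (r : ℝ) : fval r = r := rfl
@[simp] lemma fval_infty : fval OnePoint.infty = 0 := rfl

lemma localCoord_coe (r : ℝ) (t : OnePoint ℝ) : localCoord r t = fval t := rfl

lemma localCoord_infty (t : OnePoint ℝ) : localCoord OnePoint.infty t = (fval t)⁻¹ := by
  induction t using OnePoint.rec with
  | infty => exact inv_zero.symm
  | coe r => rfl

/-- The point of the curve whose half-angle tangents at three edges are `r`, `s`, `w⁻¹`;
`δ` is the sign of its first coordinate. -/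
noncomputable def yAff (p q : Bool → ℝ) (δ r s w : ℝ) : Bool × Bool → ℝ
  | (false, false) => δ * Q p q false false / √(1 + r ^ 2)
  | (true, false) => -(r * (δ * Q p q false false / √(1 + r ^ 2)))
  | (true, true) => s * (δ * Q p q false false / √(1 + r ^ 2))
  | (false, true) => -(r * (δ * Q p q false false / √(1 + r ^ 2))) * w

/-- The point of the curve over a configuration. -/
noncomputable def yOf (p q : Bool → ℝ) (δ : ℝ) (t : Conf) : Bool × Bool → ℝ :=
  yAff p q δ (fval (t (eAB false false))) (fval (t (eAB false true)))
    (fval (t (eAB true false)))⁻¹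

section

variable {p q : Bool → ℝ} {y : Bool × Bool → ℝ} (H : Params p q) (hy : OnCurve p q y)
include H hy

lemma OnCurve.exists_phi_eAB_false (j : Bool) : ∃ r : ℝ,
    phi p q y (eAB false j) = r ∧ y (true, j) = -sg j * (r * y (false, false)) := by
  obtain ⟨c, -, h0, h1⟩ := hy.coords_scale H false j
  have hA := hy.A_ne_zero H
  simp only [coords] at h0 h1
  generalize phi p q y (eAB false j) = t at *
  induction t using OnePoint.rec with
  | infty => exact absurd (by simpa using h1) hA
  | coe r =>
    refine ⟨r, rfl, ?_⟩
    simp only [homog_coe, Matrix.cons_val_zero, Matrix.cons_val_one, mul_one, sg_false,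
      one_mul] at h0 h1
    rw [h0, h1]; ring

/-- Z₁ ≠ 0 keeps t₂₁ away from 0, so its inverse is finite. At t₂₁ = ∞ the conventions `fval ∞ = 0`
and 0⁻¹ = 0 give the correct inverse 0. -/
lemma OnCurve.phi_eAB_true_false : phi p q y (eAB true false) ≠ ((0 : ℝ) : OnePoint ℝ) ∧
    y (false, true) = y (true, false) * (fval (phi p q y (eAB true false)))⁻¹ := by
  obtain ⟨c, -, h0, h1⟩ := hy.coords_scale H true false
  have hB := hy.B_ne_zero H
  simp only [coords] at h0 h1
  generalize phi p q y (eAB true false) = t at *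
  induction t using OnePoint.rec with
  | infty => exact ⟨OnePoint.infty_ne_coe _, by simpa using h1⟩
  | coe r =>
    simp only [homog_coe, Matrix.cons_val_zero, Matrix.cons_val_one, mul_one, sg_false,
      sg_true] at h0 h1
    have hr : r ≠ 0 := by
      rintro rfl
      exact hB (by simpa using h0)
    refine ⟨by simpa using hr, ?_⟩
    rw [h0, h1, fval_coe]
    field_simp

/-- The equation Y₁²(1 + t₁₁²) = Q₁₁² determines Y₁ once its sign δ is given, and the other
coordinates are then read off from the three tangents. -/
lemma OnCurve.yOf_phi {δ : ℤˣ} (hδ : 0 < sgn δ * y (false, false)) :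
    yOf p q (sgn δ) (phi p q y) = y := by
  obtain ⟨r, hr, hr'⟩ := hy.exists_phi_eAB_false H false
  obtain ⟨s, hs, hs'⟩ := hy.exists_phi_eAB_false H true
  obtain ⟨-, hw⟩ := hy.phi_eAB_true_false H
  have hY : sgn δ * Q p q false false / √(1 + r ^ 2) = y (false, false) := by
    have h1 : Q p q false false = √(1 + r ^ 2) * (sgn δ * y (false, false)) := by
      rw [Q, ← hy false false, hr', ← Real.sqrt_sq hδ.le, ← Real.sqrt_mul (by positivity),
        sg_false]
      congr 1
      linear_combination -(1 + r ^ 2) * y (false, false) ^ 2 * sgn_sq δ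
    have h2 : √(1 + r ^ 2) ≠ 0 := (Real.sqrt_pos.2 (by positivity)).ne'
    rw [h1, div_eq_iff h2]
    linear_combination √(1 + r ^ 2) * y (false, false) * sgn_sq δ
  have hZ : -(r * y (false, false)) = y (true, false) := by rw [hr', sg_false]; ring
  funext i
  unfold yOf
  rw [hr, hs, fval_coe, fval_coe]
  rcases i with ⟨_ | _, _ | _⟩ <;> simp only [yAff, hY, hZ]
  · exact hw.symm
  · rw [hs', sg_true]; ring

end

/-! ### Analyticity -/

lemma analyticAt_sqrt {x : ℝ} (hx : 0 < x) : AnalyticAt ℝ (fun x => √x) x :=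
  (Real.contDiffAt_sqrt (n := ⊤) hx.ne').analyticAt

section

variable {E : Type*} [NormedAddCommGroup E] [NormedSpace ℝ E] {p q : Bool → ℝ}

lemma analyticAt_yAff (δ : ℝ) {r s w : E → ℝ} {u : E} (hr : AnalyticAt ℝ r u)
    (hs : AnalyticAt ℝ s u) (hw : AnalyticAt ℝ w u) (i : Bool × Bool) :
    AnalyticAt ℝ (fun v => yAff p q δ (r v) (s v) (w v) i) u := by
  have hpos : 0 < 1 + r u ^ 2 := by positivity
  have h : AnalyticAt ℝ (fun v => δ * Q p q false false / √(1 + r v ^ 2)) u :=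
    analyticAt_const.div
      ((analyticAt_sqrt hpos).comp (f := fun v => 1 + r v ^ 2) (analyticAt_const.add (hr.pow 2)))
      (Real.sqrt_pos.2 hpos).ne'
  rcases i with ⟨_ | _, _ | _⟩
  · exact h
  · exact (hr.mul h).neg.mul hw
  · exact (hr.mul h).neg
  · exact hs.mul h

lemma analyticAt_oct (H : Params p q) {y : E → Bool × Bool → ℝ} {u : E}
    (hy : ∀ i, AnalyticAt ℝ (fun v => y v i) u) (hu : OnCurve p q (y u)) (w : Vertex) (l : Fin 4) :
    AnalyticAt ℝ (fun v => oct p q (y v) w l) u := by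
  have hc0 := hu.cos_sq_pos H
  have hs0 := hu.sin_sq_pos H
  have hc : AnalyticAt ℝ (fun v => √(y v (false, false) ^ 2 + p false ^ 2)) u :=
    (analyticAt_sqrt hc0).comp (f := fun v => y v (false, false) ^ 2 + p false ^ 2)
      (((hy _).pow 2).add analyticAt_const)
  have hs : AnalyticAt ℝ (fun v => √(y v (true, false) ^ 2 + q false ^ 2)) u :=
    (analyticAt_sqrt hs0).comp (f := fun v => y v (true, false) ^ 2 + q false ^ 2)
      (((hy _).pow 2).add analyticAt_const)
  have hc' := (Real.sqrt_pos.2 hc0).ne'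
  have hs' := (Real.sqrt_pos.2 hs0).ne'
  obtain ⟨m, i⟩ := w
  fin_cases m <;> fin_cases l
  · exact analyticAt_const.div hc hc'
  · exact (hy _).div hc hc'
  · exact analyticAt_const
  · exact analyticAt_const
  · exact analyticAt_const
  · exact analyticAt_const
  · exact analyticAt_const.div hs hs'
  · exact (hy _).div hs hs'
  · exact hc
  · exact analyticAt_const
  · exact analyticAt_const.mul hs
  · exact analyticAt_const

lemma analyticAt_eval (e : Edge) (u : Edge → ℝ) : AnalyticAt ℝ (fun v : Edge → ℝ => v e) u :=
  (ContinuousLinearMap.proj (R := ℝ) (φ := fun _ : Edge => ℝ) e).analyticAt u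

lemma isAnalyticOn_oct (H : Params p q) {σ δ : ℤˣ} (hσ : ∀ γ ∈ curvePart p q σ, ∃ y,
    OnCurve p q y ∧ γ = phi p q y ∧ 0 < sgn δ * y (false, false)) (w : Vertex) (l : Fin 4) :
    IsAnalyticOn (curvePart p q σ) (fun γ => oct p q (yOf p q (sgn δ) γ) w l) := by
  intro γ hγ
  obtain ⟨y, hy, rfl, hδ⟩ := hσ γ hγ
  obtain ⟨r, hr, -⟩ := hy.exists_phi_eAB_false H false
  obtain ⟨s, hs, -⟩ := hy.exists_phi_eAB_false H true
  obtain ⟨hw0, -⟩ := hy.phi_eAB_true_false H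
  have hyy := hy.yOf_phi H hδ
  set γ := phi p q y
  obtain ⟨g, hg, hgt⟩ : ∃ g : (Edge → ℝ) → ℝ,
      AnalyticAt ℝ g (fun e => localCoord (γ e) (γ e)) ∧
      ∀ t : Conf, (fval (t (eAB true false)))⁻¹ = g (fun e => localCoord (γ e) (t e)) := by
    -- The inverse of t₂₁ is itself the local coordinate at ∞, and at a finite value it is analytic
    -- because that value is nonzero.
    rcases hγt : γ (eAB true false) with _ | v
    · refine ⟨fun u => u (eAB true false), analyticAt_eval _ _, fun t => ?_⟩
      have := localCoord_infty (t (eAB true false))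
      simp only [hγt]
      exact this.symm
    · have hloc : ∀ t, localCoord (γ (eAB true false)) t = fval t := fun t => by
        rw [hγt]; rfl
      refine ⟨fun u => (u (eAB true false))⁻¹, (analyticAt_eval _ _).inv ?_, fun t => ?_⟩
      · intro h
        simp only [hγt] at h
        apply hw0
        rw [hγt]
        exact congrArg _ h
      · simp only [hloc]
  have hyt : ∀ t : Conf, yOf p q (sgn δ) t =
      (fun u => yAff p q (sgn δ) (u (eAB false false)) (u (eAB false true)) (g u))
        (fun e => localCoord (γ e) (t e)) := fun t => by
    simp only [yOf, hgt, hr, hs, localCoord_coe]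
  refine ⟨fun u => oct p q (yAff p q (sgn δ) (u (eAB false false)) (u (eAB false true)) (g u)) w l,
    analyticAt_oct H (fun i => analyticAt_yAff _ (analyticAt_eval _ _) (analyticAt_eval _ _) hg i)
      ?_ w l, Filter.Eventually.of_forall fun t => ?_⟩
  · have := hyt γ
    rw [hyy] at this
    rw [this] at hy
    exact hy
  · simp only [hyt]

end

lemma arcTheta_mem {p q : Bool → ℝ} (H : Params p q) (k : Fin 4) {s : ℝ} (hs : s ∈ Set.Icc 0 1) :
    arcTheta (Real.arcsin |q true|) (Real.arccos |p true|) k s ∈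
      Set.Icc (Real.arcsin |q true|) (Real.arccos |p true|) := by
  have h := thetaMin_lt_thetaMax H
  obtain ⟨h0, h1⟩ := hs
  unfold arcTheta
  split_ifs <;> constructor <;> nlinarith

end ExoticOctahedron

/-! ### Assembly of the result -/

open ExoticOctahedron in
theorem mainTheorem4 (ℓ : Edge → ℝ) (hℓ : ∀ e, 0 < ℓ e ∧ ℓ e < Real.pi)
    (h₁₂ : ℓ (edge (a 0) (a 1)) = Real.pi / 2 ∧ ℓ (edge (a 0) (b 1)) = Real.pi / 2 ∧
      ℓ (edge (b 0) (a 1)) = Real.pi / 2 ∧ ℓ (edge (b 0) (b 1)) = Real.pi / 2)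
    (h₁₃ : ℓ (edge (a 0) (a 2)) = ℓ (edge (a 0) (b 2)) ∧
      ℓ (edge (b 0) (a 2)) = ℓ (edge (b 0) (b 2)))
    (h₂₃ : ℓ (edge (a 1) (a 2)) + ℓ (edge (a 1) (b 2)) = Real.pi ∧
      ℓ (edge (b 1) (a 2)) + ℓ (edge (b 1) (b 2)) = Real.pi)
    (p₁ p₂ q₁ q₂ : ℝ)
    (hp₁ : p₁ = Real.cos (ℓ (edge (a 0) (a 2)))) (hp₂ : p₂ = Real.cos (ℓ (edge (b 0) (a 2))))
    (hq₁ : q₁ = Real.cos (ℓ (edge (a 1) (a 2)))) (hq₂ : q₂ = Real.cos (ℓ (edge (b 1) (a 2))))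
    (hp : |p₁| < |p₂|) (hq : |q₁| < |q₂|) (hpq : p₂ ^ 2 + q₂ ^ 2 < 1)
    (θmin θmax : ℝ) (hθmin : θmin = Real.arcsin |q₂|) (hθmax : θmax = Real.arccos |p₂|) :
    ∃ Γ : Set Conf,
      -- `Γ` is the unique essential one-dimensional irreducible component
      IsEssentialComponent ℓ Γ ∧ (∀ Γ' : Set Conf, IsEssentialComponent ℓ Γ' → Γ' = Γ) ∧
      -- all real points of `Γ` are smooth
      (∀ γ ∈ Γ, IsSmoothPoint Γ γ) ∧
      ∃ Γs : ℤˣ → Set Conf,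
        -- the component for the sign `σ` corresponds to `δ₁ ε₁ = σ`
        (∀ σ, Γs σ = flexComponent ℓ p₁ p₂ q₁ q₂ σ) ∧
        -- `Γ` has exactly two connected components
        Γ = Γs 1 ∪ Γs (-1) ∧ Disjoint (Γs 1) (Γs (-1)) ∧
        (∀ σ, (Γs σ).Nonempty ∧ ∀ γ ∈ Γs σ, connectedComponentIn Γ γ = Γs σ) ∧
        -- each one projects 4-fold (at interior points) onto the segment of values of `θ`
        (∃ Θ : Conf → ℝ,
          (∀ γ ∈ Γ, ∀ θ ∈ Set.Icc θmin θmax, ∀ δ₁ δ₂ ε₁ ε₂ : ℤˣ,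
            IsConfigOf ℓ (flex p₁ p₂ q₁ q₂ θ δ₁ δ₂ ε₁ ε₂) γ → Θ γ = θ) ∧
          ∀ σ, Θ '' Γs σ = Set.Icc θmin θmax ∧
            ∀ θ ∈ Set.Ioo θmin θmax, {γ ∈ Γs σ | Θ γ = θ}.ncard = 4) ∧
        -- for any constant signs `δ₁, ε₁`, the flexion along the component with `σ = δ₁ ε₁`
        ∀ δ₁ ε₁ : ℤˣ, ∃ (h : AddCircle (4 : ℝ) ≃ₜ Γs (δ₁ * ε₁)) (V : Conf → Vertex → E4),
          -- `V γ` is a position of the octahedron, unique up to rotation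
          (∀ γ ∈ Γs (δ₁ * ε₁), IsConfigOf ℓ (V γ) γ ∧
            ∀ P : Vertex → E4, IsConfigOf ℓ P γ →
              ∃ R : E4 ≃ₗᵢ[ℝ] E4, LinearMap.det (R.toLinearEquiv : E4 →ₗ[ℝ] E4) = 1 ∧
                ∀ u, P u = R (V γ u)) ∧
          -- it is given by the explicit formulae, where `δ₂` changes when `θ = θmax` and
          -- `ε₂` changes when `θ = θmin`
          (∀ (k : Fin 4), ∀ s ∈ Set.Icc (0 : ℝ) 1,
            V (h (((k : ℕ) + s : ℝ) : AddCircle (4 : ℝ))) =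
              flex p₁ p₂ q₁ q₂ (arcTheta θmin θmax k s) δ₁ (arcDelta k) ε₁ (arcEps k)) ∧
          -- and the coordinates of its vertices are real analytic on the component
          ∀ (u : Vertex) (i : Fin 4), IsAnalyticOn (Γs (δ₁ * ε₁)) (fun γ => V γ u i) := by
  subst hθmin hθmax
  set p : Bool → ℝ := fun k => bif k then p₂ else p₁
  set q : Bool → ℝ := fun k => bif k then q₂ else q₁
  have H : Params p q := ⟨sq_lt_sq.2 hp, sq_lt_sq.2 hq, hpq⟩
  have L : Lens ℓ p q := by
    refine ⟨fun e => (hℓ e).1, fun e => (hℓ e).2, fun i j => ?_, fun i k => ?_, fun j k => ?_⟩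
    · rw [← Real.cos_pi_div_two]
      rcases i with _ | _ <;> rcases j with _ | _
      exacts [congrArg _ h₁₂.1, congrArg _ h₁₂.2.1, congrArg _ h₁₂.2.2.1, congrArg _ h₁₂.2.2.2]
    · rcases i with _ | _ <;> rcases k with _ | _
      exacts [hp₁.symm, (congrArg Real.cos h₁₃.1).symm.trans hp₁.symm, hp₂.symm,
        (congrArg Real.cos h₁₃.2).symm.trans hp₂.symm]
    · have neg : ∀ {x z : ℝ}, x + z = Real.pi → Real.cos z = -1 * Real.cos x := fun {x z} h => by
        rw [← sub_eq_of_eq_add' h.symm, Real.cos_pi_sub, neg_one_mul]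
      rcases j with _ | _ <;> rcases k with _ | _
      · exact hq₁.symm.trans (one_mul _).symm
      · exact (neg h₂₃.1).trans (congrArg _ hq₁.symm)
      · exact hq₂.symm.trans (one_mul _).symm
      · exact (neg h₂₃.2).trans (congrArg _ hq₂.symm)
  refine ⟨curve p q, isEssentialComponent_curve H L, fun Γ' h => h.eq_curve H L,
    fun γ hγ => isSmoothPoint_curve H hγ, curvePart p q, fun σ => (flexComponent_eq H L σ).symm,
    curve_eq_union H, disjoint_curvePart H (by decide),
    fun σ => ⟨(isConnected_curvePart H σ).nonempty, fun γ hγ => connectedComponentIn_curve H σ hγ⟩,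
    ⟨theta p q, fun γ _ θ hθ δ₁ δ₂ ε₁ ε₂ h => ?_,
      fun σ => ⟨theta_image H σ, fun θ hθ => ncard_theta_fiber H σ hθ⟩⟩, fun δ₁ ε₁ => ?_⟩
  · rw [(isConfigOf_flex_iff H L hθ δ₁ δ₂ ε₁ ε₂ γ).1 h]
    exact theta_phi_arcPt H hθ δ₁ δ₂ ε₁ ε₂
  · obtain ⟨h, hh⟩ := exists_homeomorph H δ₁ ε₁
    refine ⟨h, fun γ => oct p q (yOf p q (sgn δ₁) γ), fun γ hγ => ?_, fun k s hs => ?_,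
      isAnalyticOn_oct H fun γ hγ => ?_⟩
    · obtain ⟨y, hy, rfl, hδ, -⟩ := exists_of_mem_curvePart H hγ
      simp only [hy.yOf_phi H hδ]
      refine ⟨hy.isConfigOf H L, fun P hP => ?_⟩
      obtain ⟨y', R, hy', hδ', he, hR, hPR⟩ := hP.exists_oct H L (sgn_sq δ₁)
      -- Both points lie over the same configuration and have the same sign of Y₁, so `yOf` returns
      -- each of them.
      obtain rfl : y = y' := by
        rw [← hy.yOf_phi H hδ, he, hy'.yOf_phi H hδ']
      exact ⟨R, hR, hPR⟩
    · have hk : ((k : ℕ) : ℝ) ≤ 3 := by exact_mod_cast Nat.le_of_lt_succ k.2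
      have hθ := arcTheta_mem H k hs
      have hx := sq_cos_mem_Icc H hθ
      rw [hh _ ⟨add_nonneg (Nat.cast_nonneg _) hs.1, by linarith [hs.2]⟩, pathPt_arc H δ₁ ε₁ k hs]
      exact (congrArg (oct p q) ((onCurve_arcPt H hx (signs_sq _ _ _ _)).yOf_phi H
        (sgn_mul_arcPt_pos H hx _ _ _ _).1)).trans (flex_eq_oct H hθ _ _ _ _).symm
    · obtain ⟨y, hy, e, hδ, -⟩ := exists_of_mem_curvePart H hγ
      exact ⟨y, hy, e, hδ⟩
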